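/- Conventions. Algorithms are programs for the unit-cost word RAM: a fixed finite number of registers, a working memory addressed by words, instructions for addition, subtraction, multiplication, division, comparison and jumps, read-only access to the input (its sizes and constant-time adjacency queries), and a write-only output on which words are written and completed solutions are marked off. All words have $O(\log|\mathcal U|)$ bits, time is the number of executed instructions, and space is the number of memory words used (input and output not counted). The delay is the maximum number of steps before the first solution, between two consecutive solutions, and after the last one. A program lists a family if it halts having written every member exactly once. Let $G$ be a finite graph with vertex set $\mathcal U\neq\emptyset$, each of whose edges is either black or white, and let $G_B$ be the subgraph of its black edges. A bc-clique is a set $X\subseteq\mathcal U$ that is a clique of $G$ and induces a connected subgraph of $G_B$ (the empty set being admitted); $q$ is the maximum size of a bc-clique. Theorem. (1) There is an algorithm that, given such a graph $G$, lists all inclusion-maximal bc-cliques of $G$ with delay $O(q^5|\mathcal U|^2)$ and space $O(q)$, with absolute constants. (2) For graphs $A,B$ let the product graph have vertex set $\mathcal U=V(A)\times V(B)$, and for $u\ne v$, $x\neq y$ a black edge between $(u,x)$ and $(v,y)$ if $uv\in E(A)$ and $xy\in E(B)$, and a white edge if $uv\notin E(A)$ and $xy\notin E(B)$. Then a set $X\subseteq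 V(A)\times V(B)$ is a bc-clique of the product graph if and only if it is the set of pairs $(s,\varphi(s))$ of an isomorphism $\varphi:A[S]\to B[T]$ between connected induced subgraphs of $A$ and $B$ (the empty one being admitted); hence the maximal bc-cliques are exactly the maximal such isomorphisms, i.e. those that do not extend to a larger one. Every isomorphism $A[S]\to B[T]$ for which $A[S]$ is a maximal common connected induced subgraph (that is, $S$ is inclusion-maximal among the sets $S\subseteq V(A)$ such that $A[S]$ is connected and isomorphic to an induced subgraph of $B$) is among these maximal isomorphisms. (3) There is an algorithm that, given two finite nonempty graphs $A$ and $B$, lists all maximal isomorphisms between connected induced subgraphs of $A$ and $B$ with delay $O(q^5(|V(A)||V(B)|)^2)$ and space $O(q)$, where $q$ is the maximum number of vertices of a common connected induced subgraph; its total running time is $O(\alpha\, q^5(|V(A)||V(B)|)^2)$, where $\alpha$ is the number of these isomorphisms. -/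

import Mathlib

/-- A graph on `V` each of whose edges is either black or white. -/
structure BWGraph (V : Type*) where
  black : SimpleGraph V
  white : SimpleGraph V
  disjoint : Disjoint black white

/-- A bc-clique: a set of vertices that is a clique of the whole graph and induces a connected
subgraph of the black graph (the empty set counts as connected). -/
def BWGraph.IsBCClique {V : Type*} (G : BWGraph V) (X : Set V) : Prop :=
  (G.black ⊔ G.white).IsClique X ∧ (G.black.induce X).Preconnected

open Classical in
/-- The largest size of a solution of a set system on a finite ground set. -/
noncomputable def maxSolutionSize {V : Type*} [Fintype V] (F : Set V → Prop) : ℕ :=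
  (Finset.univ.filter (fun X : Finset V => F (X : Set V))).sup Finset.card

/-- The product graph of `A` and `B` with black and white edges: two pairs that differ in both
coordinates are joined by a black edge if both coordinates are adjacent, and by a white edge if
neither is. -/
def productGraph {V W : Type*} (A : SimpleGraph V) (B : SimpleGraph W) : BWGraph (V × W) where
  black :=
    { Adj := fun p q => A.Adj p.1 q.1 ∧ B.Adj p.2 q.2
      symm := ⟨fun _ _ h => ⟨h.1.symm, h.2.symm⟩⟩
      loopless := ⟨fun _ h => h.1.ne rfl⟩ }
  white :=
    { Adj := fun p q => (p.1 ≠ q.1 ∧ ¬ A.Adj p.1 q.1) ∧ (p.2 ≠ q.2 ∧ ¬ B.Adj p.2 q.2)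
      symm := ⟨fun _ _ h => ⟨⟨h.1.1.symm, fun k => h.1.2 k.symm⟩,
        ⟨h.2.1.symm, fun k => h.2.2 k.symm⟩⟩⟩
      loopless := ⟨fun _ h => h.1.1 rfl⟩ }
  disjoint := by
    rw [disjoint_iff_inf_le]
    intro p q h
    exact h.2.1.2 h.1.1

/-- The set of pairs `(s, φ s)` of an isomorphism between induced subgraphs. -/
def isoPairs {V W : Type*} {A : SimpleGraph V} {B : SimpleGraph W} {S : Set V} {T : Set W}
    (φ : A.induce S ≃g B.induce T) : Set (V × W) :=
  {p | ∃ s : S, p = ((s : V), (φ s : W))}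

/-- `X` is (the set of pairs of) an isomorphism between connected induced subgraphs of `A` and `B`
(the empty graph counts as connected). -/
def IsConnectedInducedIso {V W : Type*} (A : SimpleGraph V) (B : SimpleGraph W)
    (X : Set (V × W)) : Prop :=
  ∃ (S : Set V) (T : Set W) (φ : A.induce S ≃g B.induce T),
    (A.induce S).Preconnected ∧ X = isoPairs φ

/-- `S` induces a connected subgraph of `A` that is isomorphic to an induced subgraph of `B`. -/
def IsCommonConnectedInduced {V W : Type*} (A : SimpleGraph V) (B : SimpleGraph W)
    (S : Set V) : Prop :=
  (A.induce S).Preconnected ∧ ∃ T : Set W, Nonempty (A.induce S ≃g B.induce T)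

namespace WordRAM

/-- The read-only input: two sizes and two binary relations, to be accessed by queries. -/
structure Input where
  size₁ : ℕ
  size₂ : ℕ
  rel₁ : ℕ → ℕ → Prop
  rel₂ : ℕ → ℕ → Prop

/-- Instructions of a random access machine. Arguments called `r`, `a`, `b` are registers. -/
inductive Instr
  /-- `r := c` -/
  | const (r c : ℕ)
  /-- `r := a` -/
  | move (r a : ℕ)
  /-- `r := a + b` -/
  | add (r a b : ℕ)
  /-- `r := a - b` (truncated) -/
  | sub (r a b : ℕ)
  /-- `r := a * b` -/
  | mul (r a b : ℕ)
  /-- `r := a / b` (rounded down, `0` if `b = 0`) -/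
  | div (r a b : ℕ)
  /-- `r :=` first input size -/
  | size₁ (r : ℕ)
  /-- `r :=` second input size -/
  | size₂ (r : ℕ)
  /-- `r := 1` or `0` as the first input relation holds of `a, b` or not -/
  | query₁ (r a b : ℕ)
  /-- `r := 1` or `0` as the second input relation holds of `a, b` or not -/
  | query₂ (r a b : ℕ)
  /-- `r := mem[a]` -/
  | load (r a : ℕ)
  /-- `mem[a] := b` -/
  | store (a b : ℕ)
  /-- continue at program line `l` -/
  | jump (l : ℕ)
  /-- continue at program line `l` if `a < b` -/
  | jumpLt (a b l : ℕ)
  /-- append the word in `a` to the solution that is being written out -/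
  | write (a : ℕ)
  /-- complete the current solution and begin a new, empty one -/
  | emit

/-- A program is a finite list of instructions, so it uses a fixed finite number of registers. -/
abbrev Program := List Instr

/-- A configuration. The fields `cur` (the solution that is being written) and `out` (the completed
solutions, in order) are write-only output: no instruction reads them. -/
structure Config where
  pc : ℕ
  reg : ℕ → ℕ
  mem : ℕ → ℕ
  cur : List ℕ
  out : List (List ℕ)

def init : Config := ⟨0, fun _ => 0, fun _ => 0, [], []⟩

/-- Set register `r` to `x` and go on to the next line. -/
def Config.assign (c : Config) (r x : ℕ) : Config :=
  { c with pc := c.pc + 1, reg := Function.update c.reg r x }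

open Classical in
/-- The effect of one instruction. -/
noncomputable def Instr.exec (I : Input) (c : Config) : Instr → Config
  | .const r k => c.assign r k
  | .move r a => c.assign r (c.reg a)
  | .add r a b => c.assign r (c.reg a + c.reg b)
  | .sub r a b => c.assign r (c.reg a - c.reg b)
  | .mul r a b => c.assign r (c.reg a * c.reg b)
  | .div r a b => c.assign r (c.reg a / c.reg b)
  | .size₁ r => c.assign r I.size₁
  | .size₂ r => c.assign r I.size₂
  | .query₁ r a b => c.assign r (if I.rel₁ (c.reg a) (c.reg b) then 1 else 0)
  | .query₂ r a b => c.assign r (if I.rel₂ (c.reg a) (c.reg b) then 1 else 0)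
  | .load r a => c.assign r (c.mem (c.reg a))
  | .store a b =>
      { c with pc := c.pc + 1, mem := Function.update c.mem (c.reg a) (c.reg b) }
  | .jump l => { c with pc := l }
  | .jumpLt a b l => { c with pc := if c.reg a < c.reg b then l else c.pc + 1 }
  | .write a => { c with pc := c.pc + 1, cur := c.cur ++ [c.reg a] }
  | .emit => { c with pc := c.pc + 1, cur := [], out := c.out ++ [c.cur] }

/-- The memory address that an instruction accesses, if any. -/
def Instr.address (c : Config) : Instr → Option ℕ
  | .load _ a => some (c.reg a)
  | .store a _ => some (c.reg a)
  | _ => none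

/-- One step; the machine halts when the program counter leaves the program. -/
noncomputable def step (P : Program) (I : Input) (c : Config) : Config :=
  match P[c.pc]? with
  | some i => i.exec I c
  | none => c

/-- The configuration after `t` steps. -/
noncomputable def run (P : Program) (I : Input) (t : ℕ) : Config :=
  (step P I)^[t] init

/-- On input `I` the program `P` lists the members of `𝓢`, each exactly once and without repeated
elements, an element `v` being written as the words `enc v`; it halts after exactly `T` steps, has
delay at most `D` (a solution is completed in every `D` consecutive steps of the computation, so
also at its beginning and at its end), accesses only the first `S` memory cells, and all numbers in
its registers and its memory are below `W`. -/
structure Enumerates (P : Program) (I : Input) {α : Type*} (enc : α → List ℕ) (𝓢 : Set (Finset α))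
    (T D S W : ℕ) : Prop where
  running : ∀ t < T, (run P I t).pc < P.length
  halted : P.length ≤ (run P I T).pc
  output : ∃ L : List (List α), (run P I T).out = L.map (fun l => l.flatMap enc) ∧
    (∀ l ∈ L, l.Nodup) ∧
    L.Pairwise (fun l l' => ¬ ∀ v, v ∈ l ↔ v ∈ l') ∧
    ∀ X : Finset α, X ∈ 𝓢 ↔ ∃ l ∈ L, ∀ v, v ∈ X ↔ v ∈ l
  delay : ∀ t, t + D ≤ T → (run P I t).out.length < (run P I (t + D)).out.length
  space : ∀ t < T, ∀ i ∈ P[(run P I t).pc]?, ∀ a ∈ i.address (run P I t), a < S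
  word : ∀ t ≤ T, ∀ j, (run P I t).reg j < W ∧ (run P I t).mem j < W

/-- The adjacency relation of a graph with vertices `0, …, n - 1`, on natural numbers. -/
def adjRel {n : ℕ} (G : SimpleGraph (Fin n)) (i j : ℕ) : Prop :=
  ∃ (hi : i < n) (hj : j < n), G.Adj ⟨i, hi⟩ ⟨j, hj⟩

/-- A graph with black and white edges as an input: its number of vertices and its black and white
adjacency. -/
def bwInput {n : ℕ} (G : BWGraph (Fin n)) : Input :=
  ⟨n, n, adjRel G.black, adjRel G.white⟩

/-- A pair of graphs as an input. -/
def pairInput {a b : ℕ} (A : SimpleGraph (Fin a)) (B : SimpleGraph (Fin b)) : Input :=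
  ⟨a, b, adjRel A, adjRel B⟩

end WordRAM

/-! The listing is a reverse search. A bc-clique `Y` has a canonical order `ord Y`: it starts with
the smallest vertex, at level 1, and repeatedly appends that vertex of `Y` keeping the list a
bc-clique whose key (level, name) is least; the level of a vertex is one more than the least level
of its black neighbours already in the list. The same rule applied in the whole graph extends every
such list to a maximal bc-clique (`complete`).

If a maximal `Y` is not the completion of the empty list, take the shortest prefix of `ord Y` whose
completion is `Y` and drop its last vertex `v`; the completion of the rest is the parent of `Y`. It
precedes `Y` lexicographically (`MaxBC.parent_before`), so parents form a tree, with the completion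
of the empty list as root. The heart of the proof is that a child can be recovered from its parent
`X`, the vertex `v` and the first vertex `r` of its order (`MaxBC.take_candList`): because keys
increase along the order (`ord_increasing`), greedy search from `r` among `v` and the neighbours of
`v` in `X` reproduces the lost prefix. So the children of `X` are among the `n²` candidates `(v,
r)`, and only those with `r ∈ X` or `r = v`, at most `n (|X| + 1)` of them, need an expensive test
(`card_heavy_le`).

Depth-first search in this tree needs no stack: on the way back the parent and the pair `(v, r)` are
recomputed, and the number `n v + r` tells where to resume. Only a fixed number of arrays of length
`O(q)` is kept. Sets at even depth are written when they are entered, those at odd depth when they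
are left; hence the delay is at most a constant times the work at one node (`exists_rounds`), and
this work is `O(q⁴ n²)` (`listTime_le`).

The program is written in a small language whose execution relation carries bounds on all values and
indices, and whose states carry a clock and the largest gap between outputs. `Cmd.comp_correct`
simulates it on the machine with a constant number of steps per unit of time, and `Exec.run_comp`
reads off time, delay, space and word size.

For the product graph, a clique is the graph of a partial isomorphism, since its edges say that both
coordinates differ and that adjacency agrees; black connectivity is connectivity of the domain. The
second program is the first one with the adjacency of the product computed on demand, and its total
time follows from the delay and the number of solutions. -/

/-! ### A structured language on top of the word RAM -/

namespace RamWhile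

open WordRAM

/-- Program variables. -/
inductive Var
  | n | k | v | r | par | run | m | xm | om | pm | um | all | u | i | ok | lv | mem | bl | bu | go
  | j | go2 | sub | i2 | child | pos
  deriving DecidableEq

/-- The register that holds a program variable. -/
def Var.idx : Var → ℕ
  | n => 0 | k => 1 | v => 2 | r => 3 | par => 4 | run => 5 | m => 6 | xm => 7 | om => 8 | pm => 9
  | um => 10 | all => 11 | u => 12 | i => 13 | ok => 14 | lv => 15 | mem => 16 | bl => 17 | bu => 18
  | go => 19 | j => 20 | go2 => 21 | sub => 22 | i2 => 23 | child => 24 | pos => 25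

lemma Var.idx_lt (x : Var) : x.idx < 40 := by cases x <;> simp [idx]

/-- The variable that a register holds. -/
def Var.ofIdx : ℕ → Var
  | 0 => .n | 1 => .k | 2 => .v | 3 => .r | 4 => .par | 5 => .run | 6 => .m | 7 => .xm | 8 => .om
  | 9 => .pm | 10 => .um | 11 => .all | 12 => .u | 13 => .i | 14 => .ok | 15 => .lv | 16 => .mem
  | 17 => .bl | 18 => .bu | 19 => .go | 20 => .j | 21 => .go2 | 22 => .sub | 23 => .i2 | 24 => .child
  | _ => .pos

lemma Var.idx_injective : Function.Injective Var.idx :=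
  Function.LeftInverse.injective (g := Var.ofIdx) fun x => by cases x <;> rfl

/-- Arrays. -/
inductive Arr
  | A | L | X | O | OL | P | U
  deriving DecidableEq

/-- The arrays are interleaved in memory with stride `8`. -/
def Arr.idx : Arr → ℕ
  | A => 0 | L => 1 | X => 2 | O => 3 | OL => 4 | P => 5 | U => 6

lemma Arr.idx_lt (a : Arr) : a.idx < 8 := by cases a <;> simp [idx]

lemma Arr.idx_injective : Function.Injective Arr.idx := by
  intro x y h
  cases x <;> cases y <;> first | rfl | simp [idx] at h

/-- Terms. -/
inductive Tm
  | const (c : ℕ)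
  | var (x : Var)
  | add (a b : Tm)
  | sub (a b : Tm)
  | mul (a b : Tm)
  | div (a b : Tm)
  | size₁
  | size₂
  | query₁ (a b : Tm)
  | query₂ (a b : Tm)
  | get (a : Arr) (i : Tm)

/-- Commands. -/
inductive Cmd
  | skip
  | assign (x : Var) (e : Tm)
  | store (a : Arr) (i e : Tm)
  | write (e : Tm)
  | emit
  | seq (c d : Cmd)
  | ite (e : Tm) (c d : Cmd)
  | loop (e : Tm) (c : Cmd)

/-- Program states. The last three fields count the executed commands, the number that had been
executed at the last `emit`, and the largest gap between two consecutive ones. -/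
structure St where
  reg : Var → ℕ
  arr : Arr → ℕ → ℕ
  cur : List ℕ
  out : List (List ℕ)
  time : ℕ
  last : ℕ
  gap : ℕ

open Classical in
/-- The value of a term. -/
noncomputable def Tm.eval (I : Input) (s : St) : Tm → ℕ
  | const c => c
  | var x => s.reg x
  | add a b => a.eval I s + b.eval I s
  | sub a b => a.eval I s - b.eval I s
  | mul a b => a.eval I s * b.eval I s
  | div a b => a.eval I s / b.eval I s
  | size₁ => I.size₁
  | size₂ => I.size₂
  | query₁ a b => if I.rel₁ (a.eval I s) (b.eval I s) then 1 else 0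
  | query₂ a b => if I.rel₂ (a.eval I s) (b.eval I s) then 1 else 0
  | get a i => s.arr a (i.eval I s)

/-- No intermediate value of a term reaches `W`, and all array indices are below `S`. -/
def Tm.Safe (I : Input) (S W : ℕ) (s : St) : Tm → Prop
  | const c => c < W
  | var _ => True
  | add a b => a.Safe I S W s ∧ b.Safe I S W s ∧ a.eval I s + b.eval I s < W
  | sub a b => a.Safe I S W s ∧ b.Safe I S W s
  | mul a b => a.Safe I S W s ∧ b.Safe I S W s ∧ a.eval I s * b.eval I s < W
  | div a b => a.Safe I S W s ∧ b.Safe I S W s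
  | size₁ => I.size₁ < W
  | size₂ => I.size₂ < W
  | query₁ a b => a.Safe I S W s ∧ b.Safe I S W s
  | query₂ a b => a.Safe I S W s ∧ b.Safe I S W s
  | get _ i => i.Safe I S W s ∧ i.eval I s < S

/-- Assign a variable. -/
def St.set (s : St) (x : Var) (a : ℕ) : St :=
  { s with reg := Function.update s.reg x a, time := s.time + 1 }

/-- Assign an array entry. -/
def St.put (s : St) (a : Arr) (i x : ℕ) : St :=
  { s with arr := Function.update s.arr a (Function.update (s.arr a) i x), time := s.time + 1 }

/-- Append a word to the solution that is being written. -/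
def St.append (s : St) (x : ℕ) : St := { s with cur := s.cur ++ [x], time := s.time + 1 }

/-- Complete a solution. -/
def St.emit (s : St) : St :=
  { s with cur := [], out := s.out ++ [s.cur], time := s.time + 1, last := s.time + 1,
           gap := max s.gap (s.time + 1 - s.last) }

/-- Let one unit of time pass. -/
def St.tick (s : St) : St := { s with time := s.time + 1 }

/-- Execution of commands, with all values below `W` and all indices below `S`. -/
inductive Exec (I : Input) (S W : ℕ) : Cmd → St → St → Prop
  | skip {s} : Exec I S W .skip s s
  | assign {x e s} (h : e.Safe I S W s) : Exec I S W (.assign x e) s (s.set x (e.eval I s))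
  | store {a i e s} (hi : i.Safe I S W s) (he : e.Safe I S W s) (h : i.eval I s < S) :
      Exec I S W (.store a i e) s (s.put a (i.eval I s) (e.eval I s))
  | write {e s} (h : e.Safe I S W s) : Exec I S W (.write e) s (s.append (e.eval I s))
  | emit {s} : Exec I S W .emit s s.emit
  | seq {c d s s' s''} (h₁ : Exec I S W c s s') (h₂ : Exec I S W d s' s'') :
      Exec I S W (.seq c d) s s''
  | iteTrue {e c d s s'} (h : e.Safe I S W s) (he : 0 < e.eval I s)
      (h₁ : Exec I S W c s.tick s') : Exec I S W (.ite e c d) s s'.tick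
  | iteFalse {e c d s s'} (h : e.Safe I S W s) (he : e.eval I s = 0)
      (h₁ : Exec I S W d s.tick s') : Exec I S W (.ite e c d) s s'.tick
  | loopTrue {e c s s' s''} (h : e.Safe I S W s) (he : 0 < e.eval I s)
      (h₁ : Exec I S W c s.tick s') (h₂ : Exec I S W (.loop e c) s'.tick s'') :
      Exec I S W (.loop e c) s s''
  | loopFalse {e c s} (h : e.Safe I S W s) (he : e.eval I s = 0) :
      Exec I S W (.loop e c) s s.tick

/-- The largest gap without `emit` so far. -/
def St.maxGap (s : St) : ℕ := max s.gap (s.time - s.last)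

/-- Commands only advance the clock, and `emit` records the current gap before it starts a new one.
Hence a bound on the final state also bounds every intermediate gap. -/
lemma Exec.maxGap_mono {I : Input} {S W : ℕ} {c : Cmd} {s s' : St} (h : Exec I S W c s s') :
    s.last ≤ s.time → s'.last ≤ s'.time ∧ s.maxGap ≤ s'.maxGap := by
  induction h with
  | skip => exact fun h => ⟨h, le_rfl⟩
  | assign | store | write | emit | loopFalse =>
    intro h
    simp only [St.maxGap, St.set, St.put, St.append, St.emit, St.tick]
    omega
  | seq _ _ ih₁ ih₂ =>
    intro h
    have h₁ := ih₁ h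
    have h₂ := ih₂ h₁.1
    exact ⟨h₂.1, h₁.2.trans h₂.2⟩
  | iteTrue _ _ _ ih | iteFalse _ _ _ ih =>
    intro h
    have := ih (by simp only [St.tick]; omega)
    simp only [St.maxGap, St.tick] at *
    omega
  | loopTrue _ _ _ _ ih₁ ih₂ =>
    intro h
    have h₁ := ih₁ (by simp only [St.tick]; omega)
    have h₂ := ih₂ (by simp only [St.tick]; omega)
    simp only [St.maxGap, St.tick] at *
    omega

/-! ### Compilation -/

/-- Code that computes a term into register `40 + d`, using the registers from there on. -/
def Tm.comp (d : ℕ) : Tm → List Instr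
  | const c => [.const (40 + d) c]
  | var x => [.move (40 + d) x.idx]
  | add a b => a.comp d ++ (b.comp (d + 1) ++ [.add (40 + d) (40 + d) (40 + (d + 1))])
  | sub a b => a.comp d ++ (b.comp (d + 1) ++ [.sub (40 + d) (40 + d) (40 + (d + 1))])
  | mul a b => a.comp d ++ (b.comp (d + 1) ++ [.mul (40 + d) (40 + d) (40 + (d + 1))])
  | div a b => a.comp d ++ (b.comp (d + 1) ++ [.div (40 + d) (40 + d) (40 + (d + 1))])
  | size₁ => [.size₁ (40 + d)]
  | size₂ => [.size₂ (40 + d)]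
  | query₁ a b => a.comp d ++ (b.comp (d + 1) ++ [.query₁ (40 + d) (40 + d) (40 + (d + 1))])
  | query₂ a b => a.comp d ++ (b.comp (d + 1) ++ [.query₂ (40 + d) (40 + d) (40 + (d + 1))])
  | get a i => i.comp d ++ [.const (40 + (d + 1)) 8, .mul (40 + d) (40 + d) (40 + (d + 1)),
      .const (40 + (d + 1)) a.idx, .add (40 + d) (40 + d) (40 + (d + 1)),
      .load (40 + d) (40 + d)]

/-- The length of the code of a term. -/
def Tm.len (e : Tm) : ℕ := (e.comp 0).length

/-- The length of the code of a command. -/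
def Cmd.len : Cmd → ℕ
  | skip => 0
  | assign _ e => e.len + 1
  | store _ i e => (i.comp 0).length + 4 + (e.comp 1).length + 1
  | write e => e.len + 1
  | emit => 1
  | seq c d => c.len + d.len
  | ite e c d => e.len + 2 + d.len + 1 + c.len
  | loop e c => e.len + 3 + c.len + 1

/-- The code of a command, to be placed at line `off`. -/
def Cmd.comp : Cmd → ℕ → List Instr
  | skip, _ => []
  | assign x e, _ => e.comp 0 ++ [.move x.idx 40]
  | store a i e, _ => i.comp 0 ++ ([.const 41 8, .mul 40 40 41, .const 41 a.idx, .add 40 40 41] ++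
      (e.comp 1 ++ [.store 40 41]))
  | write e, _ => e.comp 0 ++ [.write 40]
  | emit, _ => [.emit]
  | seq c d, off => c.comp off ++ d.comp (off + c.len)
  | ite e c d, off => e.comp 0 ++ ([.const 41 0, .jumpLt 41 40 (off + e.len + 2 + d.len + 1)] ++
      (d.comp (off + e.len + 2) ++ ([.jump (off + e.len + 2 + d.len + 1 + c.len)] ++
      c.comp (off + e.len + 2 + d.len + 1))))
  | loop e c, off => e.comp 0 ++ ([.const 41 0, .jumpLt 41 40 (off + e.len + 3),
      .jump (off + e.len + 3 + c.len + 1)] ++ (c.comp (off + e.len + 3) ++ [.jump off]))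

lemma Cmd.length_comp (c : Cmd) (off : ℕ) : (c.comp off).length = c.len := by
  induction c generalizing off with
  | assign | write => simp [comp, len, Tm.len]
  | store => simp [comp, len]; omega
  | skip | emit => rfl
  | seq c d hc hd => simp [comp, len, hc, hd]
  | ite e c d hc hd => simp [comp, len, Tm.len, hc, hd]; omega
  | loop e c hc => simp [comp, len, Tm.len, hc]; omega

/-- A bound on the number of machine steps per unit of time. -/
def Cmd.cost : Cmd → ℕ
  | skip => 0
  | assign _ e => e.len + 1
  | store _ i e => (i.comp 0).length + 4 + (e.comp 1).length + 1
  | write e => e.len + 1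
  | emit => 1
  | seq c d => max c.cost d.cost
  | ite e c d => max (e.len + 3) (max c.cost d.cost)
  | loop e c => max (e.len + 4) c.cost

/-! ### Machine code, step counter and simulation -/

/-- The program `P` contains the piece of code at line `off`. -/
def CodeAt (P : Program) (off : ℕ) (code : List Instr) : Prop :=
  ∀ i < code.length, P[off + i]? = code[i]?

lemma codeAt_append {P : Program} {off : ℕ} {a b : List Instr} :
    CodeAt P off (a ++ b) ↔ CodeAt P off a ∧ CodeAt P (off + a.length) b := by
  constructor
  · intro h
    refine ⟨fun i hi => ?_, fun i hi => ?_⟩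
    · rw [h i (by simp; omega), List.getElem?_append_left hi]
    · have := h (a.length + i) (by simp; omega)
      rw [List.getElem?_append_right (by omega)] at this
      simpa [add_assoc] using this
  · rintro ⟨h₁, h₂⟩ i hi
    by_cases h : i < a.length
    · rw [h₁ i h, List.getElem?_append_left h]
    · rw [List.getElem?_append_right (by omega), ← h₂ (i - a.length) (by simp at hi; omega)]
      congr 1
      omega

lemma codeAt_cons {P : Program} {off : ℕ} {a : Instr} {b : List Instr} :
    CodeAt P off (a :: b) ↔ P[off]? = some a ∧ CodeAt P (off + 1) b := by
  rw [show a :: b = [a] ++ b from rfl, codeAt_append]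
  simp [CodeAt]

open Classical in
/-- A machine step that also counts the steps since the last `emit`. -/
noncomputable def gapStep (P : Program) (I : Input) (x : Config × ℕ) : Config × ℕ :=
  (step P I x.1, if P[x.1.pc]? = some .emit then 0 else x.2 + 1)

/-- All words are below `W`. -/
def Words (W : ℕ) (c : Config) : Prop := ∀ j, c.reg j < W ∧ c.mem j < W

/-- The machine may make a step from here. -/
structure Good (P : Program) (S W D : ℕ) (x : Config × ℕ) : Prop where
  pc : x.1.pc < P.length
  space : ∀ i ∈ P[x.1.pc]?, ∀ a ∈ i.address x.1, a < S
  word : Words W x.1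
  gap : x.2 < D

/-- Reachability by good steps. -/
def Reach (P : Program) (I : Input) (S W D : ℕ) : Config × ℕ → Config × ℕ → Prop :=
  Relation.ReflTransGen fun x y => Good P S W D x ∧ y = gapStep P I x

section Machine

variable {P : Program} {I : Input} {S W D : ℕ}

open Classical in
lemma reach_one {c : Config} {g : ℕ} {ins : Instr} (h : P[c.pc]? = some ins) (hw : Words W c)
    (hg : g < D) (ha : ∀ a ∈ ins.address c, a < S) :
    Reach P I S W D (c, g) (ins.exec I c, if ins = .emit then 0 else g + 1) := by
  refine Relation.ReflTransGen.single ⟨⟨?_, ?_, hw, hg⟩, ?_⟩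
  · exact (List.getElem?_eq_some_iff.mp h).1
  · intro i hi
    rw [h] at hi
    obtain rfl : ins = i := by simpa using hi
    exact ha
  · simp [gapStep, step, h]

/-- The registers and the memory agree with a program state. -/
structure Rel (s : St) (c : Config) : Prop where
  reg : ∀ x : Var, c.reg x.idx = s.reg x
  mem : ∀ (a : Arr) (i : ℕ), c.mem (8 * i + a.idx) = s.arr a i

lemma Words.assign {c : Config} (hw : Words W c) (r : ℕ) {x : ℕ} (hx : x < W) :
    Words W (c.assign r x) := by
  intro j
  refine ⟨?_, (hw j).2⟩
  simp only [Config.assign, Function.update_apply]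
  split_ifs
  · exact hx
  · exact (hw j).1

/-- The result of computing a term into register `40 + d`. -/
structure TmResult (W : ℕ) (c c' : Config) (d len x : ℕ) : Prop where
  pc : c'.pc = c.pc + len
  reg : c'.reg (40 + d) = x
  frame : ∀ r < 40 + d, c'.reg r = c.reg r
  mem : c'.mem = c.mem
  cur : c'.cur = c.cur
  out : c'.out = c.out
  words : Words W c'

lemma TmResult.rel {c c' : Config} {d len x : ℕ} {s : St} (h : TmResult W c c' d len x)
    (hr : Rel s c) : Rel s c' :=
  ⟨fun y => by rw [h.frame _ (by have := y.idx_lt; omega), hr.reg], fun a i => by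
    rw [h.mem, hr.mem]⟩

lemma reach_assign {c : Config} {g : ℕ} {ins : Instr} {r x : ℕ} (h : P[c.pc]? = some ins)
    (hw : Words W c) (hg : g < D) (ha : ∀ a ∈ ins.address c, a < S)
    (hi : ins.exec I c = c.assign r x) (he : ins ≠ .emit) :
    Reach P I S W D (c, g) (c.assign r x, g + 1) := by
  have := reach_one (I := I) h hw hg ha
  rwa [hi, if_neg he] at this

lemma Reach.trans {x y z : Config × ℕ} (h : Reach P I S W D x y) (h' : Reach P I S W D y z) :
    Reach P I S W D x z :=
  Relation.ReflTransGen.trans h h'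

lemma Reach.congr {x : Config × ℕ} {c : Config} {g g' : ℕ} (h : Reach P I S W D x (c, g))
    (hg : g = g') : Reach P I S W D x (c, g') := hg ▸ h

lemma tm_leaf {c : Config} {g d : ℕ} {ins : Instr} {x : ℕ} (h : P[c.pc]? = some ins)
    (hw : Words W c) (hg : g + 1 ≤ D) (ha : ∀ a ∈ ins.address c, a < S)
    (hi : ins.exec I c = c.assign (40 + d) x) (he : ins ≠ .emit) (hx : x < W) :
    ∃ c', Reach P I S W D (c, g) (c', g + 1) ∧ TmResult W c c' d 1 x :=
  ⟨_, reach_assign h hw hg ha hi he, by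
    refine ⟨rfl, by simp [Config.assign], fun r hr => ?_, rfl, rfl, rfl, hw.assign _ hx⟩
    simp [Config.assign, Function.update_of_ne (show r ≠ 40 + d by omega)]⟩

/-- The second operand is computed at depth `d + 1` and leaves the registers up to `40 + d` alone,
so the first operand survives. With `ins` abstract, one argument serves all six binary instructions.
-/
lemma tm_binary {s : St} {a b : Tm} {c : Config} {g d x : ℕ} {ins : Instr}
    (iha : ∀ {c : Config} {g d : ℕ}, CodeAt P c.pc (a.comp d) → Rel s c → Words W c →
      a.Safe I S W s → g + (a.comp d).length ≤ D → ∃ c', Reach P I (8 * S) W D (c, g)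
        (c', g + (a.comp d).length) ∧ TmResult W c c' d (a.comp d).length (a.eval I s))
    (ihb : ∀ {c : Config} {g d : ℕ}, CodeAt P c.pc (b.comp d) → Rel s c → Words W c →
      b.Safe I S W s → g + (b.comp d).length ≤ D → ∃ c', Reach P I (8 * S) W D (c, g)
        (c', g + (b.comp d).length) ∧ TmResult W c c' d (b.comp d).length (b.eval I s))
    (hP : CodeAt P c.pc (a.comp d ++ (b.comp (d + 1) ++ [ins])))
    (hr : Rel s c) (hw : Words W c) (ha : a.Safe I S W s) (hb : b.Safe I S W s)
    (hg : g + (a.comp d ++ (b.comp (d + 1) ++ [ins])).length ≤ D)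
    (he : ins ≠ .emit) (hx : x < W) (hadr : ∀ c, ins.address c = none)
    (hi : ∀ c : Config, c.reg (40 + d) = a.eval I s → c.reg (40 + (d + 1)) = b.eval I s →
      ins.exec I c = c.assign (40 + d) x) :
    ∃ c', Reach P I (8 * S) W D (c, g) (c', g + (a.comp d ++ (b.comp (d + 1) ++ [ins])).length) ∧
      TmResult W c c' d (a.comp d ++ (b.comp (d + 1) ++ [ins])).length x := by
  simp only [codeAt_append, codeAt_cons, List.length_append, List.length_cons,
    List.length_nil] at hP hg
  obtain ⟨c₁, h₁, r₁⟩ := iha (g := g) hP.1 hr hw ha (by omega)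
  obtain ⟨c₂, h₂, r₂⟩ := ihb (c := c₁) (g := g + (a.comp d).length) (d := d + 1)
    (by rw [r₁.pc]; exact hP.2.1) (r₁.rel hr) r₁.words hb (by omega)
  have h₃ := reach_assign (I := I) (S := 8 * S) (D := D) (c := c₂)
    (g := g + (a.comp d).length + (b.comp (d + 1)).length) (by rw [r₂.pc, r₁.pc]; exact hP.2.2.1)
    r₂.words (by omega) (by simp [hadr])
    (hi c₂ (by rw [r₂.frame _ (by omega), r₁.reg]) r₂.reg) he
  refine ⟨_, (h₁.trans h₂).trans (h₃.congr (by simp; omega)), ?_⟩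
  refine ⟨?_, by simp [Config.assign], fun r hr => ?_, ?_, ?_, ?_, r₂.words.assign _ hx⟩
  · simp [Config.assign, r₂.pc, r₁.pc]; omega
  · simp only [Config.assign]
    rw [Function.update_of_ne (by omega), r₂.frame _ (by omega), r₁.frame _ hr]
  · exact r₂.mem.trans r₁.mem
  · exact r₂.cur.trans r₁.cur
  · exact r₂.out.trans r₁.out

lemma TmResult.step {c c₁ : Config} {d len x y : ℕ} (h : TmResult W c c₁ d len x) (hy : y < W) :
    TmResult W c (c₁.assign (40 + d) y) d (len + 1) y := by
  refine ⟨?_, by simp [Config.assign], fun r hr => ?_, h.mem, h.cur, h.out, h.words.assign _ hy⟩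
  · simp [Config.assign, h.pc]; omega
  · simp only [Config.assign]
    rw [Function.update_of_ne (by omega), h.frame _ hr]

lemma TmResult.step_succ {c c₁ : Config} {d len x y : ℕ} (h : TmResult W c c₁ d len x)
    (hy : y < W) : TmResult W c (c₁.assign (40 + (d + 1)) y) d (len + 1) x := by
  refine ⟨?_, ?_, fun r hr => ?_, h.mem, h.cur, h.out, h.words.assign _ hy⟩
  · simp [Config.assign, h.pc]; omega
  · simp only [Config.assign]
    rw [Function.update_of_ne (by omega), h.reg]
  · simp only [Config.assign]
    rw [Function.update_of_ne (by omega), h.frame _ hr]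

/-- The address computation that follows the computation of an index. -/
lemma reach_address {c c₁ : Config} {g len d x : ℕ} {a : Arr} {rest : List Instr}
    (h : TmResult W c c₁ d len x) (hSW : 8 * S < W) (hx : x < S) (hg : g + 4 ≤ D)
    (hP : CodeAt P c₁.pc ([.const (40 + (d + 1)) 8, .mul (40 + d) (40 + d) (40 + (d + 1)),
      .const (40 + (d + 1)) a.idx, .add (40 + d) (40 + d) (40 + (d + 1))] ++ rest)) :
    ∃ c₂, Reach P I (8 * S) W D (c₁, g) (c₂, g + 4) ∧ TmResult W c c₂ d (len + 4) (8 * x + a.idx)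
      ∧ CodeAt P c₂.pc rest := by
  have ha := a.idx_lt
  simp only [List.cons_append, List.nil_append, codeAt_cons] at hP
  have s₁ := reach_assign (I := I) (S := 8 * S) (D := D) (g := g) hP.1 h.words (by omega)
    (by simp [Instr.address]) rfl (by simp)
  have r₁ := h.step_succ (y := 8) (by omega)
  have e₁ : (c₁.assign (40 + (d + 1)) 8).reg (40 + (d + 1)) = 8 := by simp [Config.assign]
  generalize hc₂ : c₁.assign (40 + (d + 1)) 8 = c₂ at *
  have p₂ : c₂.pc = c₁.pc + 1 := by rw [← hc₂]; rfl
  have s₂ := reach_assign (I := I) (S := 8 * S) (D := D) (c := c₂) (g := g + 1)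
    (by rw [p₂]; exact hP.2.1) r₁.words (by omega) (by simp [Instr.address]) rfl (by simp)
  rw [r₁.reg, e₁] at s₂
  have r₂ := r₁.step (y := x * 8) (by omega)
  generalize hc₃ : c₂.assign (40 + d) (x * 8) = c₃ at *
  have p₃ : c₃.pc = c₁.pc + 1 + 1 := by rw [← hc₃, ← p₂]; rfl
  have s₃ := reach_assign (I := I) (S := 8 * S) (D := D) (c := c₃) (g := g + 1 + 1)
    (by rw [p₃]; exact hP.2.2.1) r₂.words (by omega) (by simp [Instr.address]) rfl (by simp)
  have r₃ := r₂.step_succ (y := a.idx) (by omega)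
  have e₃ : (c₃.assign (40 + (d + 1)) a.idx).reg (40 + (d + 1)) = a.idx := by
    simp [Config.assign]
  generalize hc₄ : c₃.assign (40 + (d + 1)) a.idx = c₄ at *
  have p₄ : c₄.pc = c₁.pc + 1 + 1 + 1 := by rw [← hc₄, ← p₃]; rfl
  have s₄ := reach_assign (I := I) (S := 8 * S) (D := D) (c := c₄) (g := g + 1 + 1 + 1)
    (by rw [p₄]; exact hP.2.2.2.1) r₃.words (by omega) (by simp [Instr.address]) rfl (by simp)
  rw [r₃.reg, e₃] at s₄
  have r₄ := r₃.step (y := x * 8 + a.idx) (by omega)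
  rw [mul_comm x 8] at s₄ r₄
  refine ⟨_, ((s₁.trans s₂).trans s₃).trans s₄, r₄, ?_⟩
  have p₅ : (c₄.assign (40 + d) (8 * x + a.idx)).pc = c₁.pc + 1 + 1 + 1 + 1 := by rw [← p₄]; rfl
  rw [p₅]
  exact hP.2.2.2.2

/-- Only constants, sizes, sums and products can exceed what the state already holds, and `Safe`
bounds exactly these. -/
lemma Tm.eval_lt_word {s : St} {e : Tm} (hr : ∀ x, s.reg x < W) (hm : ∀ a i, s.arr a i < W)
    (h1 : 1 < W) (h : e.Safe I S W s) : e.eval I s < W := by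
  induction e with
  | const c => exact h
  | var x => exact hr x
  | add a b iha ihb => exact h.2.2
  | sub a b iha ihb => exact lt_of_le_of_lt (Nat.sub_le _ _) (iha h.1)
  | mul a b iha ihb => exact h.2.2
  | div a b iha ihb => exact lt_of_le_of_lt (Nat.div_le_self _ _) (iha h.1)
  | size₁ => exact h
  | size₂ => exact h
  | query₁ a b iha ihb => simp only [eval]; split_ifs <;> omega
  | query₂ a b iha ihb => simp only [eval]; split_ifs <;> omega
  | get a i ih => exact hm a _

lemma Rel.eval_lt {s : St} {c : Config} {e : Tm} (hr : Rel s c) (hw : Words W c)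
    (h1 : 1 < W) (h : e.Safe I S W s) : e.eval I s < W :=
  Tm.eval_lt_word (fun x => hr.reg x ▸ (hw _).1) (fun a i => hr.mem a i ▸ (hw _).2) h1 h

lemma Tm.comp_correct (hSW : 8 * S < W) (h1 : 1 < W) {s : St} (e : Tm) {c : Config} {g d : ℕ}
    (hP : CodeAt P c.pc (e.comp d)) (hr : Rel s c) (hw : Words W c) (hs : e.Safe I S W s)
    (hg : g + (e.comp d).length ≤ D) :
    ∃ c', Reach P I (8 * S) W D (c, g) (c', g + (e.comp d).length) ∧
      TmResult W c c' d (e.comp d).length (e.eval I s) := by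
  have hev := hr.eval_lt hw h1 hs
  induction e generalizing c g d with
  | const x =>
    exact tm_leaf (codeAt_cons.mp hP).1 hw hg (by simp [Instr.address]) rfl (by simp) hev
  | var x =>
    refine tm_leaf (codeAt_cons.mp hP).1 hw hg (by simp [Instr.address]) ?_ (by simp) hev
    simp [Instr.exec, hr.reg, eval]
  | size₁ | size₂ =>
    exact tm_leaf (codeAt_cons.mp hP).1 hw hg (by simp [Instr.address]) rfl (by simp) hev
  | add a b iha ihb | mul a b iha ihb =>
    refine tm_binary (fun h1 h2 h3 h4 h5 => iha h1 h2 h3 h4 h5 (h2.eval_lt h3 ‹_› h4))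
      (fun h1 h2 h3 h4 h5 => ihb h1 h2 h3 h4 h5 (h2.eval_lt h3 ‹_› h4))
      hP hr hw hs.1 hs.2.1 hg (by simp) hev (fun _ => rfl) fun c ha hb => ?_
    simp only [Instr.exec, ha, hb, eval]
  | sub a b iha ihb | div a b iha ihb =>
    refine tm_binary (fun h1 h2 h3 h4 h5 => iha h1 h2 h3 h4 h5 (h2.eval_lt h3 ‹_› h4))
      (fun h1 h2 h3 h4 h5 => ihb h1 h2 h3 h4 h5 (h2.eval_lt h3 ‹_› h4))
      hP hr hw hs.1 hs.2 hg (by simp) hev (fun _ => rfl) fun c ha hb => ?_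
    simp only [Instr.exec, ha, hb, eval]
  | query₁ a b iha ihb | query₂ a b iha ihb =>
    refine tm_binary (fun h1 h2 h3 h4 h5 => iha h1 h2 h3 h4 h5 (h2.eval_lt h3 ‹_› h4))
      (fun h1 h2 h3 h4 h5 => ihb h1 h2 h3 h4 h5 (h2.eval_lt h3 ‹_› h4))
      hP hr hw hs.1 hs.2 hg (by simp) hev (fun _ => rfl) fun c ha hb => ?_
    simp only [Instr.exec, ha, hb, eval]
    congr
  | get a i ih =>
    simp only [comp, codeAt_append, List.length_append, List.length_cons, List.length_nil]
      at hP hg ⊢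
    obtain ⟨c₁, h₁, r₁⟩ := ih (g := g) hP.1 hr hw hs.1 (by omega) (hr.eval_lt hw h1 hs.1)
    obtain ⟨c₂, h₂, r₂, hP₂⟩ := reach_address (I := I) (D := D)
      (g := g + (i.comp d).length) r₁ hSW hs.2 (by omega)
      (rest := [.load (40 + d) (40 + d)]) (by rw [r₁.pc]; exact hP.2)
    have hr₂ := r₂.rel hr
    have h₃ := reach_assign (I := I) (S := 8 * S) (D := D) (c := c₂)
      (g := g + (i.comp d).length + 4) (codeAt_cons.mp hP₂).1 r₂.words (by omega)
      (by have := a.idx_lt; have := hs.2; simp only [Instr.address, Option.mem_def,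
            Option.some.injEq, forall_eq', r₂.reg]; omega) rfl (by simp)
    rw [r₂.reg, hr₂.mem] at h₃
    exact ⟨_, (h₁.trans h₂).trans h₃, r₂.step hev⟩

/-- The machine configuration `x` is at line `pc` and represents the program state `s`. -/
structure Sim (W κ : ℕ) (s : St) (pc : ℕ) (x : Config × ℕ) : Prop where
  pc : x.1.pc = pc
  rel : Rel s x.1
  words : Words W x.1
  cur : x.1.cur = s.cur
  out : x.1.out = s.out
  last : s.last ≤ s.time
  gap : x.2 ≤ κ * (s.time - s.last)

lemma Rel.assign_var {s : St} {c : Config} (h : Rel s c) (x : Var) (a pc : ℕ) :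
    Rel (s.set x a) { c with pc := pc, reg := Function.update c.reg x.idx a } := by
  refine ⟨fun y => ?_, fun b i => h.mem b i⟩
  by_cases hy : y = x
  · subst hy; simp [St.set]
  · have : y.idx ≠ x.idx := fun hh => hy (Var.idx_injective hh)
    simp [St.set, this, hy, h.reg]

/-- As `a.idx < 8`, the address `8 * i + a.idx` determines `a` and `i`. Interleaving lets all arrays
grow together, although the program does not know `q` and could not reserve blocks of that length.
-/
lemma Rel.store {s : St} {c : Config} (h : Rel s c) (a : Arr) (i x pc : ℕ) :
    Rel (s.put a i x) { c with pc := pc, mem := Function.update c.mem (8 * i + a.idx) x } := by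
  refine ⟨fun y => h.reg y, fun b k => ?_⟩
  have ha := a.idx_lt
  have hb := b.idx_lt
  by_cases hab : b = a
  · subst hab
    by_cases hk : k = i
    · subst hk; simp [St.put]
    · simp [St.put, hk, h.mem]
  · have h1 : b.idx ≠ a.idx := fun hh => hab (Arr.idx_injective hh)
    have : 8 * k + b.idx ≠ 8 * i + a.idx := by omega
    simp [St.put, this, hab, h.mem]

lemma Rel.tick {s : St} {c : Config} (h : Rel s c) : Rel s.tick c := ⟨h.reg, h.mem⟩

/-- A unit of program time pays for `κ` machine steps, so up to `κ` further steps fit into the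
current unit. -/
lemma Sim.gap_add {κ M k pc : ℕ} {s : St} {x : Config × ℕ} (h : Sim W κ s pc x) (hk : k ≤ κ)
    (hM : s.time + 1 - s.last ≤ M) :
    x.2 + k ≤ κ * (s.time + 1 - s.last) ∧ x.2 + k < κ * M + 1 := by
  have h1 : κ * (s.time + 1 - s.last) = κ * (s.time - s.last) + κ := by
    rw [Nat.sub_add_comm h.last, mul_add, mul_one]
  have h2 := Nat.mul_le_mul_left κ hM
  have := h.gap
  omega

lemma reach_term {κ M pc : ℕ} {s : St} {x : Config × ℕ} {e : Tm} {rest : List Instr} {k : ℕ}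
    (hSW : 8 * S < W) (h1 : 1 < W) (h : Sim W κ s pc x)
    (hP : CodeAt P pc (e.comp 0 ++ rest)) (hs : e.Safe I S W s)
    (hk : e.len + k ≤ κ) (hM : s.time + 1 - s.last ≤ M) :
    ∃ c', Reach P I (8 * S) W (κ * M + 1) x (c', x.2 + e.len) ∧
      TmResult W x.1 c' 0 e.len (e.eval I s) ∧ CodeAt P (pc + e.len) rest ∧
      x.2 + e.len + k ≤ κ * (s.time + 1 - s.last) ∧ x.2 + e.len + k < κ * M + 1 := by
  rw [codeAt_append] at hP
  have hg := h.gap_add hk hM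
  obtain ⟨c', h₁, r₁⟩ := Tm.comp_correct (g := x.2) (D := κ * M + 1) hSW h1 e
    (by rw [h.pc]; exact hP.1) h.rel h.words hs (by have : (e.comp 0).length = e.len := rfl; omega)
  exact ⟨c', h₁, r₁, hP.2, by omega, by omega⟩

/-- Register 41 holds `0`, so `jumpLt 41 40` tests positivity. Two steps follow the evaluation of
the term, but the simulation is asserted for one more: a loop that ends makes its exit jump in the
same unit of time. -/
lemma Cmd.sim_test {κ M off : ℕ} {s : St} {x : Config × ℕ} {e : Tm} {l : ℕ} {rest : List Instr}
    (hSW : 8 * S < W) (h1 : 1 < W) (h : Sim W κ s off x)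
    (hP : CodeAt P off (e.comp 0 ++ ([.const 41 0, .jumpLt 41 40 l] ++ rest)))
    (hs : e.Safe I S W s) (hk : e.len + 3 ≤ κ) (hM : s.time + 1 - s.last ≤ M) :
    ∃ c', Reach P I (8 * S) W (κ * M + 1) x (c', x.2 + e.len + 2) ∧
      (∀ g ≤ x.2 + e.len + 3,
        Sim W κ s.tick (if 0 < e.eval I s then l else off + e.len + 2) (c', g)) ∧
      CodeAt P (off + e.len + 2) rest ∧ x.2 + e.len + 3 < κ * M + 1 := by
  obtain ⟨c₁, h₁, r₁, hP₁, g₁, g₂⟩ := reach_term hSW h1 h hP hs hk hM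
  simp only [List.cons_append, List.nil_append, codeAt_cons] at hP₁
  have p₁ : c₁.pc = off + e.len := by rw [r₁.pc, h.pc]
  have h₂ := reach_assign (I := I) (S := 8 * S) (D := κ * M + 1) (c := c₁) (g := x.2 + e.len)
    (by rw [p₁]; exact hP₁.1) r₁.words (by omega) (by simp [Instr.address]) rfl (by simp)
  have r₂ := r₁.step_succ (y := 0) (by omega)
  have e₂ : (c₁.assign (40 + (0 + 1)) 0).reg 41 = 0 := by simp [Config.assign]
  generalize hc₂ : c₁.assign (40 + (0 + 1)) 0 = c₂ at *
  have p₂ : c₂.pc = off + e.len + 1 := by rw [r₂.pc, h.pc]; omega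
  have h₃ := reach_one (I := I) (S := 8 * S) (D := κ * M + 1) (c := c₂) (g := x.2 + e.len + 1)
    (by rw [p₂]; exact hP₁.2.1) r₂.words (by omega) (by simp [Instr.address])
  rw [if_neg (by simp)] at h₃
  refine ⟨_, (h₁.trans h₂).trans h₃, fun g hg => ?_, hP₁.2.2, by omega⟩
  refine ⟨?_, ?_, r₂.words, r₂.cur.trans h.cur, r₂.out.trans h.out, ?_, ?_⟩
  · simp only [Instr.exec, e₂, p₂]
    rw [show c₂.reg 40 = _ from r₂.reg]
  · exact ⟨(r₂.rel h.rel).reg, (r₂.rel h.rel).mem⟩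
  · simp only [St.tick]; have := h.last; omega
  · simp only [St.tick]
    have := h.last; omega

lemma sim_jump {κ M pc l : ℕ} {s : St} {x : Config × ℕ} (h : Sim W κ s pc x)
    (hP : P[pc]? = some (.jump l)) (hk : 1 ≤ κ) (hM : s.time + 1 - s.last ≤ M) :
    ∃ x', Reach P I (8 * S) W (κ * M + 1) x x' ∧ Sim W κ s.tick l x' := by
  have hg := h.gap_add hk hM
  have h₁ := reach_one (I := I) (S := 8 * S) (D := κ * M + 1) (c := x.1) (g := x.2)
    (by rw [h.pc]; exact hP) h.words (by omega) (by simp [Instr.address])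
  rw [if_neg (by simp)] at h₁
  refine ⟨_, h₁, ?_⟩
  refine ⟨rfl, ⟨h.rel.reg, h.rel.mem⟩, h.words, h.cur, h.out, ?_, ?_⟩
  · simp only [St.tick]; have := h.last; omega
  · simp only [St.tick]; omega

/-- The induction is on the execution, so that in the loop case the remaining rounds come with an
induction hypothesis. Only the final gap is bounded; `Exec.maxGap_mono` passes the bound to the
parts. -/
theorem Cmd.comp_correct {κ M : ℕ} (hSW : 8 * S < W) (h1 : 1 < W) {c : Cmd} {s s' : St}
    (hE : Exec I S W c s s') : ∀ {off : ℕ} {x : Config × ℕ}, CodeAt P off (c.comp off) →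
    c.cost ≤ κ → Sim W κ s off x → s'.maxGap ≤ M →
    ∃ x', Reach P I (8 * S) W (κ * M + 1) x x' ∧ Sim W κ s' (off + c.len) x' := by
  induction hE with
  | skip => exact fun {_ x} _ _ hS _ => ⟨x, Relation.ReflTransGen.refl, hS⟩
  | @assign y e s he =>
    intro off x hP hκ hS hM
    simp only [Cmd.cost, comp] at hκ hP
    simp only [St.maxGap, St.set] at hM
    obtain ⟨c₁, h₁, r₁, hP₁, g₁, g₂⟩ := reach_term hSW h1 hS hP he hκ (M := M) (by omega)
    have h₂ := reach_assign (I := I) (S := 8 * S) (D := κ * M + 1) (c := c₁) (g := x.2 + e.len)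
      (by rw [r₁.pc, hS.pc]; exact (codeAt_cons.mp hP₁).1) r₁.words (by omega)
      (by simp [Instr.address]) rfl (by simp)
    rw [show c₁.reg 40 = _ from r₁.reg] at h₂
    refine ⟨_, h₁.trans h₂, ?_, (r₁.rel hS.rel).assign_var y _ _,
      r₁.words.assign _ (hS.rel.eval_lt hS.words h1 he), r₁.cur.trans hS.cur,
      r₁.out.trans hS.out, ?_, ?_⟩
    · simp [Config.assign, r₁.pc, hS.pc, len]; omega
    · simp only [St.set]; have := hS.last; omega
    · simp only [St.set]; omega
  | @store a i e s hi he hS' =>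
    intro off x hP hκ hS hM
    simp only [Cmd.cost, comp] at hκ hP
    simp only [St.maxGap, St.put] at hM
    obtain ⟨c₁, h₁, r₁, hP₁, g₁, g₂⟩ := reach_term (k := 4 + (e.comp 1).length + 1)
      hSW h1 hS hP hi (by simp only [Tm.len]; omega) (M := M) (by omega)
    obtain ⟨c₂, h₂, r₂, hP₂⟩ := reach_address (I := I) (D := κ * M + 1)
      (g := x.2 + i.len) r₁ hSW hS' (by omega) (by rw [r₁.pc, hS.pc]; exact hP₁)
    rw [codeAt_append] at hP₂
    obtain ⟨c₃, h₃, r₃⟩ := Tm.comp_correct (g := x.2 + i.len + 4) (D := κ * M + 1) hSW h1 e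
      hP₂.1 (r₂.rel hS.rel) r₂.words he (by omega)
    have a₃ : c₃.reg 40 = 8 * i.eval I s + a.idx := by
      rw [r₃.frame _ (by omega)]; exact r₂.reg
    have b₃ : c₃.reg 41 = e.eval I s := r₃.reg
    have h₄ := reach_one (I := I) (S := 8 * S) (D := κ * M + 1) (c := c₃)
      (g := x.2 + i.len + 4 + (e.comp 1).length)
      (by rw [r₃.pc]; exact (codeAt_cons.mp hP₂.2).1) r₃.words (by omega)
      (by have := a.idx_lt
          simp only [Instr.address, a₃, Option.mem_def, Option.some.injEq, forall_eq']; omega)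
    rw [if_neg (by simp)] at h₄
    simp only [Instr.exec, a₃, b₃] at h₄
    have hev := hS.rel.eval_lt hS.words h1 he
    refine ⟨_, ((h₁.trans h₂).trans h₃).trans h₄, ?_,
      (r₃.rel (r₂.rel hS.rel)).store a _ _ _, ?_, (r₃.cur.trans r₂.cur).trans hS.cur,
      (r₃.out.trans r₂.out).trans hS.out, ?_, ?_⟩
    · have : (i.comp 0).length = i.len := rfl
      simp [r₃.pc, r₂.pc, hS.pc, len]; omega
    · intro k
      refine ⟨(r₃.words k).1, ?_⟩
      simp only [Function.update_apply]
      split_ifs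
      · exact hev
      · exact (r₃.words k).2
    · simp only [St.put]; have := hS.last; omega
    · simp only [St.put]; omega
  | @write e s he =>
    intro off x hP hκ hS hM
    simp only [Cmd.cost, comp] at hκ hP
    simp only [St.maxGap, St.append] at hM
    obtain ⟨c₁, h₁, r₁, hP₁, g₁, g₂⟩ := reach_term hSW h1 hS hP he hκ (M := M) (by omega)
    have h₂ := reach_one (I := I) (S := 8 * S) (D := κ * M + 1) (c := c₁) (g := x.2 + e.len)
      (by rw [r₁.pc, hS.pc]; exact (codeAt_cons.mp hP₁).1) r₁.words (by omega)
      (by simp [Instr.address])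
    rw [if_neg (by simp)] at h₂
    simp only [Instr.exec, show c₁.reg 40 = _ from r₁.reg] at h₂
    refine ⟨_, h₁.trans h₂, ?_, ⟨(r₁.rel hS.rel).reg, (r₁.rel hS.rel).mem⟩,
      r₁.words, ?_, r₁.out.trans hS.out, ?_, ?_⟩
    · simp [r₁.pc, hS.pc, len]; omega
    · simp [St.append, r₁.cur, hS.cur]
    · simp only [St.append]; have := hS.last; omega
    · simp only [St.append]; omega
  | @emit s =>
    intro off x hP hκ hS hM
    simp only [St.maxGap, St.emit] at hM
    have hg := hS.gap_add hκ (M := M) (by omega)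
    have h₁ := reach_one (I := I) (S := 8 * S) (D := κ * M + 1) (c := x.1) (g := x.2)
      (by rw [hS.pc]; exact (codeAt_cons.mp hP).1) hS.words (by omega) (by simp [Instr.address])
    rw [if_pos rfl] at h₁
    refine ⟨_, h₁, ?_, ⟨hS.rel.reg, hS.rel.mem⟩, hS.words, rfl, ?_, ?_, ?_⟩
    · simp [Instr.exec, hS.pc, len]
    · simp [Instr.exec, St.emit, hS.out, hS.cur]
    · simp [St.emit]
    · simp
  | @seq c d s s₁ s₂ h₁ h₂ ih₁ ih₂ =>
    intro off x hP hκ hS hM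
    simp only [Cmd.cost, comp, codeAt_append, Cmd.length_comp] at hκ hP
    have m₁ := h₁.maxGap_mono hS.last
    have m₂ := h₂.maxGap_mono m₁.1
    obtain ⟨x₁, r₁, S₁⟩ := ih₁ hP.1 (by omega) hS (by omega)
    obtain ⟨x₂, r₂, S₂⟩ := ih₂ hP.2 (by omega) S₁ hM
    exact ⟨x₂, r₁.trans r₂, by rw [len, ← add_assoc]; exact S₂⟩
  | @iteTrue e c d s s' hs he hc ih =>
    intro off x hP hκ hS hM
    simp only [Cmd.cost] at hκ
    have m₁ := hc.maxGap_mono (by simp only [St.tick]; have := hS.last; omega)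
    have m₂ : s'.maxGap ≤ M := by simp only [St.maxGap, St.tick] at *; omega
    obtain ⟨c₁, r₁, S₁, hP₁, _⟩ := Cmd.sim_test (M := M) hSW h1 hS hP hs (by omega)
      (by have := m₁.2; simp only [St.maxGap, St.tick] at *; omega)
    simp only [codeAt_append, Cmd.length_comp, List.length_cons, List.length_nil] at hP₁
    have S₁' := S₁ _ (by omega : x.2 + e.len + 2 ≤ _)
    rw [if_pos he] at S₁'
    obtain ⟨x₂, r₂, S₂⟩ := ih hP₁.2.2 (by omega) S₁' m₂
    refine ⟨x₂, r₁.trans r₂, ?_⟩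
    -- The positive branch stands last and needs no closing jump; its final tick only loosens the
    -- bound on the counter.
    have := S₂.gap_add (k := 0) (by omega) (M := s'.time + 1 - s'.last) le_rfl
    refine ⟨?_, S₂.rel.tick, S₂.words, S₂.cur, S₂.out, ?_, ?_⟩
    · rw [S₂.pc, len]; omega
    · simp only [St.tick]; have := S₂.last; omega
    · simp only [St.tick]; omega
  | @iteFalse e c d s s' hs he hc ih =>
    intro off x hP hκ hS hM
    simp only [Cmd.cost] at hκ
    have m₁ := hc.maxGap_mono (by simp only [St.tick]; have := hS.last; omega)
    have m₂ : s'.maxGap ≤ M := by simp only [St.maxGap, St.tick] at *; omega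
    obtain ⟨c₁, r₁, S₁, hP₁, _⟩ := Cmd.sim_test (M := M) hSW h1 hS hP hs (by omega)
      (by have := m₁.2; simp only [St.maxGap, St.tick] at *; omega)
    simp only [codeAt_append, Cmd.length_comp, List.length_cons, List.length_nil, codeAt_cons]
      at hP₁
    have S₁' := S₁ _ (by omega : x.2 + e.len + 2 ≤ _)
    rw [if_neg (by omega)] at S₁'
    obtain ⟨x₂, r₂, S₂⟩ := ih hP₁.1 (by omega) S₁' m₂
    obtain ⟨x₃, r₃, S₃⟩ := sim_jump (I := I) (S := S) (M := M) S₂ hP₁.2.1.1 (by omega)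
      (by simp only [St.maxGap, St.tick] at *; omega)
    refine ⟨x₃, (r₁.trans r₂).trans r₃, ?_⟩
    rw [show off + len (.ite e c d) = off + e.len + 2 + d.len + 1 + c.len by rw [len]; omega]
    exact S₃
  | @loopTrue e c s s' s'' hs he hc hl ih₁ ih₂ =>
    intro off x hP hκ hS hM
    have hP' := hP
    have hκ' := hκ
    simp only [Cmd.cost] at hκ
    have m₁ := hc.maxGap_mono (by simp only [St.tick]; have := hS.last; omega)
    have m₂ := hl.maxGap_mono (by simp only [St.tick]; have := m₁.1; omega)
    have m₃ : s'.maxGap ≤ M := by simp only [St.maxGap, St.tick] at *; omega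
    obtain ⟨c₁, r₁, S₁, hP₁, _⟩ := Cmd.sim_test (M := M) (rest := [.jump _] ++
      (c.comp (off + e.len + 3) ++ [.jump off])) hSW h1 hS hP hs (by omega)
      (by have := m₁.2; simp only [St.maxGap, St.tick] at *; omega)
    simp only [codeAt_append, Cmd.length_comp, List.length_cons, List.length_nil, codeAt_cons]
      at hP₁
    have S₁' := S₁ _ (by omega : x.2 + e.len + 2 ≤ _)
    rw [if_pos he] at S₁'
    obtain ⟨x₂, r₂, S₂⟩ := ih₁ hP₁.2.1 (by omega) S₁' m₃
    obtain ⟨x₃, r₃, S₃⟩ := sim_jump (I := I) (S := S) (M := M) S₂ hP₁.2.2.1 (by omega)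
      (by have := m₂.2; simp only [St.maxGap, St.tick] at *; omega)
    obtain ⟨x₄, r₄, S₄⟩ := ih₂ hP' hκ' S₃ hM
    exact ⟨x₄, ((r₁.trans r₂).trans r₃).trans r₄, S₄⟩
  | @loopFalse e c s hs he =>
    intro off x hP hκ hS hM
    simp only [Cmd.cost] at hκ
    obtain ⟨c₁, r₁, S₁, hP₁, hg⟩ := Cmd.sim_test (M := M) (rest := [.jump _] ++
      (c.comp (off + e.len + 3) ++ [.jump off])) hSW h1 hS hP hs (by omega)
      (by simp only [St.maxGap, St.tick] at *; omega)
    simp only [codeAt_append, Cmd.length_comp, List.length_cons, List.length_nil, codeAt_cons]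
      at hP₁
    -- The counter value after the exit jump, which is charged to the tick of the test.
    have S₁' := S₁ _ (le_refl _)
    have S₁₁ := S₁ (x.2 + e.len + 2) (by omega)
    rw [if_neg (by omega)] at S₁' S₁₁
    have h₂ := reach_one (I := I) (S := 8 * S) (D := κ * M + 1) (c := c₁) (g := x.2 + e.len + 2)
      (by rw [show c₁.pc = _ from S₁'.pc]; exact hP₁.1.1) S₁'.words (by omega)
      (by simp [Instr.address])
    rw [if_neg (by simp)] at h₂
    refine ⟨_, r₁.trans h₂, ?_, ⟨S₁'.rel.reg, S₁'.rel.mem⟩, S₁'.words, S₁'.cur, S₁'.out,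
      S₁'.last, S₁'.gap⟩
    simp [Instr.exec, len]; omega

/-! ### From reachability to the number of steps -/

lemma gapStep_iterate_fst (x : Config × ℕ) (t : ℕ) :
    ((gapStep P I)^[t] x).1 = (step P I)^[t] x.1 := by
  induction t generalizing x with
  | zero => rfl
  | succ t ih => rw [Function.iterate_succ_apply, Function.iterate_succ_apply, ih]; rfl

lemma Reach.iterate {x y : Config × ℕ} (h : Reach P I S W D x y) :
    ∃ T, (gapStep P I)^[T] x = y ∧ ∀ t < T, Good P S W D ((gapStep P I)^[t] x) := by
  induction h with
  | refl => exact ⟨0, rfl, by simp⟩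
  | @tail y z _ h ih =>
    obtain ⟨T, hT, hg⟩ := ih
    refine ⟨T + 1, by rw [Function.iterate_succ_apply', hT, h.2], fun t ht => ?_⟩
    rcases Nat.lt_succ_iff_lt_or_eq.mp ht with ht | rfl
    · exact hg t ht
    · rw [hT]; exact h.1

lemma out_length_step (c : Config) : c.out.length ≤ (step P I c).out.length := by
  unfold step
  split
  · rename_i i _
    cases i <;> simp [Instr.exec, Config.assign]
  · exact le_rfl

lemma out_length_mono (x : Config × ℕ) (t : ℕ) :
    x.1.out.length ≤ ((gapStep P I)^[t] x).1.out.length := by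
  induction t generalizing x with
  | zero => exact le_rfl
  | succ t ih =>
    rw [Function.iterate_succ_apply]
    exact (out_length_step (P := P) (I := I) x.1).trans (ih (gapStep P I x))

/-- The counter is reset only by `emit`, which lengthens the output. -/
lemma gap_or_out (x : Config × ℕ) (t : ℕ) :
    x.1.out.length < ((gapStep P I)^[t] x).1.out.length ∨ t ≤ ((gapStep P I)^[t] x).2 := by
  induction t with
  | zero => right; simp
  | succ t ih =>
    rw [Function.iterate_succ_apply']
    rcases ih with ih | ih
    · left
      exact ih.trans_le (out_length_step _)
    · by_cases h : P[((gapStep P I)^[t] x).1.pc]? = some .emit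
      · left
        have h0 := out_length_mono (P := P) (I := I) x t
        simp only [gapStep, step, h, Instr.exec]
        rw [List.length_append]
        exact Nat.lt_succ_of_le h0
      · right
        simp only [gapStep, if_neg h]
        omega

/-- The initial state of a program. -/
def St.init : St := ⟨fun _ => 0, fun _ _ => 0, [], [], 0, 0, 0⟩

/-- A terminating execution of a command gives a terminating run of its code. -/
theorem Exec.run_comp {M : ℕ} {c : Cmd} {s' : St} (hSW : 8 * S < W) (h1 : 1 < W)
    (hE : Exec I S W c St.init s') (hM : s'.maxGap ≤ M) :
    ∃ T : ℕ, (∀ t < T, (run (c.comp 0) I t).pc < (c.comp 0).length) ∧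
      (c.comp 0).length ≤ (run (c.comp 0) I T).pc ∧
      (run (c.comp 0) I T).out = s'.out ∧
      (∀ D, c.cost * M + 1 ≤ D → ∀ t, t + D ≤ T →
        (run (c.comp 0) I t).out.length < (run (c.comp 0) I (t + D)).out.length) ∧
      (∀ t < T, ∀ i ∈ (c.comp 0)[(run (c.comp 0) I t).pc]?,
        ∀ a ∈ i.address (run (c.comp 0) I t), a < 8 * S) ∧
      (∀ t ≤ T, ∀ j, (run (c.comp 0) I t).reg j < W ∧ (run (c.comp 0) I t).mem j < W) := by
  obtain ⟨x', hr, hS⟩ := Cmd.comp_correct (P := c.comp 0) (κ := c.cost) (M := M) (off := 0)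
    (x := (WordRAM.init, 0)) hSW h1 hE (fun i _ => by simp) le_rfl
    ⟨rfl, ⟨fun _ => rfl, fun _ _ => rfl⟩, fun j => ⟨by simp [WordRAM.init]; omega,
      by simp [WordRAM.init]; omega⟩, rfl, rfl, by simp [St.init], by simp⟩ hM
  obtain ⟨T, hT, hg⟩ := hr.iterate
  have hrun : ∀ t, run (c.comp 0) I t = ((gapStep (c.comp 0) I)^[t] (WordRAM.init, 0)).1 :=
    fun t => (gapStep_iterate_fst (P := c.comp 0) (I := I) (WordRAM.init, 0) t).symm
  refine ⟨T, ?_, ?_, ?_, ?_, ?_, ?_⟩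
  · intro t ht; rw [hrun]; exact (hg t ht).pc
  · rw [hrun, hT, hS.pc, Cmd.length_comp]; omega
  · rw [hrun, hT, hS.out]
  · intro D hD t ht
    have key : (run (c.comp 0) I t).out.length <
        (run (c.comp 0) I (t + (c.cost * M + 1))).out.length := by
      rw [hrun, hrun, add_comm t, Function.iterate_add_apply]
      rcases gap_or_out (P := c.comp 0) (I := I) ((gapStep (c.comp 0) I)^[t] (WordRAM.init, 0))
        (c.cost * M + 1) with h | h
      · exact h
      -- With no output in `κ * M + 1` steps the counter would pass the bound of a good state or, at
      -- time `T`, that of the final state.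
      · exfalso
        rw [← Function.iterate_add_apply, add_comm _ t] at h
        rcases Nat.lt_or_ge (t + (c.cost * M + 1)) T with h' | h'
        · have := (hg _ h').gap
          omega
        · have e : t + (c.cost * M + 1) = T := by omega
          rw [e, hT] at h
          have h2 := hS.gap
          have h3 : s'.time - s'.last ≤ M := le_trans (le_max_right _ _) hM
          have := Nat.mul_le_mul_left c.cost h3
          omega
    refine key.trans_le ?_
    rw [hrun, hrun, show t + D = (D - (c.cost * M + 1)) + (t + (c.cost * M + 1)) by omega,
      Function.iterate_add_apply _ (D - (c.cost * M + 1))]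
    exact out_length_mono _ _
  · intro t ht; rw [hrun]; exact (hg t ht).space
  · intro t ht
    rw [hrun]
    rcases ht.lt_or_eq with h | rfl
    · exact (hg t h).word
    · rw [hT]; exact hS.words

end Machine

end RamWhile

/-! ### Greedy construction of maximal bc-cliques -/

/-- A finite graph with black edges `B` among its edges `E`, on the vertices `0, …, n - 1`. -/
structure ColGraph where
  n : ℕ
  B : ℕ → ℕ → Prop
  E : ℕ → ℕ → Prop
  B_symm : ∀ u w, B u w → B w u
  E_symm : ∀ u w, E u w → E w u
  E_irrefl : ∀ u, ¬ E u u

namespace ColGraph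

variable (G : ColGraph)

/-- A clique whose black graph has no cut. -/
structure IsBC (S : Finset ℕ) : Prop where
  lt : ∀ x ∈ S, x < G.n
  clique : ∀ x ∈ S, ∀ y ∈ S, x ≠ y → G.E x y
  cut : ∀ X ⊆ S, X.Nonempty → X ≠ S → ∃ x ∈ X, ∃ y ∈ S, y ∉ X ∧ G.B x y

lemma isBC_empty : G.IsBC ∅ :=
  ⟨by simp, by simp, fun X hX hne => by simp [Finset.subset_empty.mp hX] at hne⟩

variable {G}

/-- A cut of the larger set either restricts to a proper nonempty cut of `S`, or it separates `u`
from `S` and is crossed by a black edge at `u`. -/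
lemma IsBC.insert {S : Finset ℕ} (h : G.IsBC S) {u : ℕ} (hu : u < G.n) (hE : ∀ x ∈ S, G.E u x)
    (hB : S = ∅ ∨ ∃ x ∈ S, G.B u x) : G.IsBC (insert u S) := by
  have huS : u ∉ S := fun hh => G.E_irrefl u (hE u hh)
  refine ⟨?_, ?_, ?_⟩
  · intro x hx
    rcases Finset.mem_insert.mp hx with rfl | hx
    · exact hu
    · exact h.lt x hx
  · intro x hx y hy hxy
    rcases Finset.mem_insert.mp hx with hx | hx <;> rcases Finset.mem_insert.mp hy with hy | hy
    · exact absurd (hx.trans hy.symm) hxy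
    · exact hx ▸ hE y hy
    · exact hy ▸ G.E_symm _ _ (hE x hx)
    · exact h.clique x hx y hy hxy
  · intro X hX hne hXS
    by_cases hSX : S ⊆ X
    · have huX : u ∉ X := fun hh => hXS (Finset.Subset.antisymm hX
        (Finset.insert_subset hh hSX))
      rcases hB with rfl | ⟨x, hx, hB⟩
      · obtain ⟨x, hx⟩ := hne
        have := hX hx
        simp only [insert_empty_eq, Finset.mem_singleton] at this
        exact absurd (this ▸ hx) huX
      · exact ⟨x, hSX hx, u, Finset.mem_insert_self _ _, huX, G.B_symm _ _ hB⟩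
    · by_cases hXS' : (X ∩ S).Nonempty
      · obtain ⟨x, hx, y, hy, hyX, hB⟩ := h.cut (X ∩ S) Finset.inter_subset_right hXS'
          fun hh => hSX (hh ▸ Finset.inter_subset_left)
        exact ⟨x, (Finset.mem_inter.mp hx).1, y, Finset.mem_insert_of_mem hy,
          fun hh => hyX (Finset.mem_inter.mpr ⟨hh, hy⟩), hB⟩
      · have hXu : ∀ x ∈ X, x = u := fun x hx => by
          rcases Finset.mem_insert.mp (hX hx) with hh | hh
          · exact hh
          · exact absurd ⟨x, Finset.mem_inter.mpr ⟨hx, hh⟩⟩ hXS'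
        obtain ⟨x, hx⟩ := hne
        obtain rfl := hXu x hx
        rcases hB with rfl | ⟨y, hy, hB⟩
        · exact absurd (Finset.empty_subset _) hSX
        · exact ⟨x, hx, y, Finset.mem_insert_of_mem hy, fun hh => huS (hXu y hh ▸ hy), hB⟩

/-- Connectivity of `Y` gives a black edge that leaves `X` inside `Y`. Thus a bc-clique contained in
a larger one can be extended by a single vertex of the latter, and maximality means that no single
vertex can be appended. -/
lemma IsBC.exists_extend {X Y : Finset ℕ} (hY : G.IsBC Y) (hXY : X ⊆ Y) (hne : X ≠ Y) :
    ∃ y ∈ Y, y ∉ X ∧ (∀ x ∈ X, G.E y x) ∧ (X = ∅ ∨ ∃ x ∈ X, G.B y x) := by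
  have hE : ∀ y ∈ Y, y ∉ X → ∀ x ∈ X, G.E y x := fun y hy hyX x hx =>
    hY.clique y hy x (hXY hx) fun hh => hyX (hh ▸ hx)
  rcases X.eq_empty_or_nonempty with rfl | hX
  · obtain ⟨y, hy⟩ := Finset.nonempty_iff_ne_empty.mpr hne.symm
    exact ⟨y, hy, by simp, by simp, Or.inl rfl⟩
  · obtain ⟨x, hx, y, hy, hyX, hB⟩ := hY.cut X hXY hX hne
    exact ⟨y, hy, hyX, hE y hy hyX, Or.inr ⟨x, hx, G.B_symm _ _ hB⟩⟩

/-! ### Levels and the greedy step -/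

/-- The vertices of a list of vertices with levels. -/
def vs (L : List (ℕ × ℕ)) : Finset ℕ := (L.map Prod.fst).toFinset

@[simp] lemma mem_vs {L : List (ℕ × ℕ)} {x : ℕ} : x ∈ vs L ↔ ∃ l, (x, l) ∈ L := by
  simp [vs]

lemma vs_append (L L' : List (ℕ × ℕ)) : vs (L ++ L') = vs L ∪ vs L' := by
  ext; simp [exists_or]

lemma vs_eq_empty {L : List (ℕ × ℕ)} : vs L = ∅ ↔ L = [] := by
  simp [vs]

lemma vs_mono {L L' : List (ℕ × ℕ)} (h : L <+: L') : vs L ⊆ vs L' := by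
  intro x hx
  simp only [mem_vs] at hx ⊢
  exact hx.imp fun l hl => h.subset hl

variable (G)

open Classical in
/-- The update of the level of `u` by a list entry. -/
noncomputable def lvlStep (u a : ℕ) (p : ℕ × ℕ) : ℕ :=
  if G.B u p.1 ∧ (a = 0 ∨ p.2 + 1 < a) then p.2 + 1 else a

/-- The level that `u` gets when it is appended to a list: one more than the smallest level of a
black neighbour, `0` if there is none, and `1` if the list is empty. -/
noncomputable def lvl (L : List (ℕ × ℕ)) (u : ℕ) : ℕ :=
  L.foldl (G.lvlStep u) (if L = [] then 1 else 0)

/-- The vertex `u` may be appended to a list. -/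
def Addable (L : List (ℕ × ℕ)) (u : ℕ) : Prop :=
  u < G.n ∧ (∀ p ∈ L, G.E u p.1) ∧ 0 < G.lvl L u

open Classical in
/-- The level and the name of the best vertex below a bound that is in `U` and may be appended. -/
noncomputable def best (U : Set ℕ) (L : List (ℕ × ℕ)) : ℕ → ℕ × ℕ
  | 0 => (0, 0)
  | m + 1 => if m ∈ U ∧ G.Addable L m ∧ ((best U L m).1 = 0 ∨ G.lvl L m < (best U L m).1) then
      (G.lvl L m, m) else best U L m

/-- Append the best vertex of `U` to a list, if there is one. -/
noncomputable def step (U : Set ℕ) (L : List (ℕ × ℕ)) : List (ℕ × ℕ) :=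
  if 0 < (G.best U L G.n).1 then L ++ [((G.best U L G.n).2, (G.best U L G.n).1)] else L

/-- Append vertices of `U` as long as possible. -/
noncomputable def greedy (U : Set ℕ) (L : List (ℕ × ℕ)) : List (ℕ × ℕ) := (G.step U)^[G.n] L

variable {G}

@[simp] lemma lvl_nil (u : ℕ) : G.lvl [] u = 1 := rfl

lemma lvl_singleton_pos {p : ℕ × ℕ} {u : ℕ} (h : 0 < G.lvl [p] u) :
    G.B u p.1 ∧ G.lvl [p] u = p.2 + 1 := by
  simp only [lvl, lvlStep, List.foldl_cons, List.foldl_nil] at h ⊢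
  by_cases hB : G.B u p.1 <;> simp_all

lemma lvl_append {L : List (ℕ × ℕ)} (hL : L ≠ []) (p : ℕ × ℕ) (u : ℕ) :
    G.lvl (L ++ [p]) u = G.lvlStep u (G.lvl L u) p := by
  simp [lvl, hL]

lemma lvl_pos_append {L : List (ℕ × ℕ)} (hL : L ≠ []) (p : ℕ × ℕ) {u : ℕ} (h : 0 < G.lvl L u) :
    0 < G.lvl (L ++ [p]) u ∧ G.lvl (L ++ [p]) u ≤ G.lvl L u := by
  rw [lvl_append hL, lvlStep]
  split_ifs <;> omega

lemma lvl_pos_append_iff {L : List (ℕ × ℕ)} (hL : L ≠ []) (p : ℕ × ℕ) {u : ℕ} :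
    0 < G.lvl (L ++ [p]) u ↔ 0 < G.lvl L u ∨ G.B u p.1 := by
  rw [lvl_append hL, lvlStep]
  by_cases hB : G.B u p.1
  · simp only [hB, true_and, or_true, iff_true]; split_ifs <;> omega
  · simp [hB]

lemma lvl_pos_iff {L : List (ℕ × ℕ)} {u : ℕ} :
    0 < G.lvl L u ↔ L = [] ∨ ∃ p ∈ L, G.B u p.1 := by
  induction L using List.reverseRecOn with
  | nil => simp
  | append_singleton L p ih =>
    by_cases hL : L = []
    · subst hL
      by_cases hB : G.B u p.1 <;> simp [lvl, lvlStep, hB]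
    · rw [lvl_pos_append_iff hL, ih]
      simp [hL, or_and_right, exists_or]

/-- Further entries can only lower a positive level. The empty list is excluded because it gives
level 1 to every vertex, with black neighbours or not. -/
lemma lvl_prefix {L L' : List (ℕ × ℕ)} (hL : L ≠ []) (h : L <+: L') {u : ℕ} (hu : 0 < G.lvl L u) :
    0 < G.lvl L' u ∧ G.lvl L' u ≤ G.lvl L u := by
  obtain ⟨R, rfl⟩ := h
  induction R using List.reverseRecOn with
  | nil => simpa using hu
  | append_singleton R p ih =>
    rw [← List.append_assoc]
    have := lvl_pos_append (L := L ++ R) (by simp [hL]) p ih.1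
    exact ⟨this.1, this.2.trans ih.2⟩

lemma lvl_le_of_forall {L : List (ℕ × ℕ)} {u b : ℕ} (hb : 1 ≤ b) (h : ∀ p ∈ L, p.2 + 1 ≤ b) :
    G.lvl L u ≤ b := by
  induction L using List.reverseRecOn with
  | nil => simpa
  | append_singleton L p ih =>
    have hp := h p (by simp)
    by_cases hL : L = []
    · subst hL
      simp only [lvl, lvlStep, List.nil_append, List.foldl_cons, List.foldl_nil,
        List.cons_ne_self, if_false]
      split_ifs <;> omega
    · rw [lvl_append hL, lvlStep]
      have := ih fun q hq => h q (by simp [hq])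
      split_ifs <;> omega

lemma Addable.lt {L : List (ℕ × ℕ)} {u : ℕ} (h : G.Addable L u) : u < G.n := h.1

lemma Addable.adj {L : List (ℕ × ℕ)} {u x : ℕ} (h : G.Addable L u) (hx : x ∈ vs L) :
    G.E u x := by
  obtain ⟨l, hl⟩ := mem_vs.mp hx
  exact h.2.1 _ hl

lemma Addable.notMem {L : List (ℕ × ℕ)} {u : ℕ} (h : G.Addable L u) : u ∉ vs L :=
  fun hu => G.E_irrefl u (h.adj hu)

/-- Levels influence only the order of choice; whether a vertex may be appended depends on the set
alone. -/
lemma addable_iff {L : List (ℕ × ℕ)} {u : ℕ} : G.Addable L u ↔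
    u < G.n ∧ (∀ x ∈ vs L, G.E u x) ∧ (vs L = ∅ ∨ ∃ x ∈ vs L, G.B u x) := by
  rw [Addable, lvl_pos_iff, vs_eq_empty]
  simp

/-- The order in which entries (a vertex and its level) are appended: by level, then by vertex. -/
def KLt (p q : ℕ × ℕ) : Prop := p.2 < q.2 ∨ p.2 = q.2 ∧ p.1 < q.1

lemma KLt.trans {p q s : ℕ × ℕ} (h : KLt p q) (h' : KLt q s) : KLt p s := by
  unfold KLt at *; omega

lemma KLt.irrefl (p : ℕ × ℕ) : ¬ KLt p p := by simp [KLt]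

/-- The scan goes upwards through the names and gives up its candidate only for a strictly smaller
level, so ties go to the smaller name and the result is `KLt`-least. Level `0` signals that nothing
was found. -/
lemma best_spec (U : Set ℕ) (L : List (ℕ × ℕ)) (m : ℕ) :
    ((G.best U L m).1 = 0 → ∀ w < m, w ∈ U → ¬ G.Addable L w) ∧
    (0 < (G.best U L m).1 → (G.best U L m).2 < m ∧ (G.best U L m).2 ∈ U ∧
      G.Addable L (G.best U L m).2 ∧ (G.best U L m).1 = G.lvl L (G.best U L m).2 ∧
      ∀ w < m, w ∈ U → G.Addable L w → ¬ KLt (w, G.lvl L w) ((G.best U L m).2,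
        (G.best U L m).1)) := by
  induction m with
  | zero => simp [best]
  | succ m ih =>
    rw [best]
    split_ifs with h
    · obtain ⟨hU, hA, hb⟩ := h
      refine ⟨fun h0 => absurd hA.2.2 (by simp only at h0; omega), fun _ => ⟨by simp, hU, hA, rfl,
        fun w hw hwU hwA => ?_⟩⟩
      simp only [KLt]
      rcases Nat.lt_succ_iff_lt_or_eq.mp hw with hw | rfl
      · rcases hb with hb | hb
        · exact absurd hwA (ih.1 hb w hw hwU)
        · have := (ih.2 (by omega)).2.2.2.2 w hw hwU hwA
          simp only [KLt] at this
          omega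
      · omega
    · refine ⟨fun h0 w hw hwU hwA => ?_, fun h0 => ?_⟩
      · rcases Nat.lt_succ_iff_lt_or_eq.mp hw with hw | rfl
        · exact ih.1 h0 w hw hwU hwA
        · exact h ⟨hwU, hwA, Or.inl h0⟩
      · obtain ⟨h1, h2, h3, h4, h5⟩ := ih.2 h0
        refine ⟨by omega, h2, h3, h4, fun w hw hwU hwA => ?_⟩
        rcases Nat.lt_succ_iff_lt_or_eq.mp hw with hw | rfl
        · exact h5 w hw hwU hwA
        · have : ¬ (G.lvl L w < (G.best U L w).1) := fun hh => h ⟨hwU, hwA, Or.inr hh⟩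
          simp only [KLt]
          omega

lemma step_cases (U : Set ℕ) (L : List (ℕ × ℕ)) :
    (G.step U L = L ∧ ∀ w ∈ U, ¬ G.Addable L w) ∨
    ∃ u ∈ U, G.Addable L u ∧ G.step U L = L ++ [(u, G.lvl L u)] ∧
      ∀ w ∈ U, G.Addable L w → ¬ KLt (w, G.lvl L w) (u, G.lvl L u) := by
  have h := best_spec (G := G) U L G.n
  by_cases h0 : 0 < (G.best U L G.n).1
  · obtain ⟨h1, h2, h3, h4, h5⟩ := h.2 h0
    refine Or.inr ⟨_, h2, h3, ?_, fun w hw hwA => ?_⟩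
    · rw [step, if_pos h0, ← h4]
    · rw [← h4]; exact h5 w hwA.lt hw hwA
  · exact Or.inl ⟨by rw [step, if_neg h0], fun w hw hwA => h.1 (by omega) w hwA.lt hw hwA⟩

lemma exists_step {U : Set ℕ} {L : List (ℕ × ℕ)} {w : ℕ} (hw : w ∈ U) (h : G.Addable L w) :
    ∃ u ∈ U, G.Addable L u ∧ G.step U L = L ++ [(u, G.lvl L u)] ∧
      ∀ w ∈ U, G.Addable L w → ¬ KLt (w, G.lvl L w) (u, G.lvl L u) := by
  rcases step_cases (G := G) U L with h' | h'
  · exact absurd h (h'.2 w hw)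
  · exact h'

variable (G) in
/-- A list of distinct vertices that form a bc-clique, with bounded levels. -/
structure OkList (L : List (ℕ × ℕ)) : Prop where
  bc : G.IsBC (vs L)
  nodup : (L.map Prod.fst).Nodup
  lev : ∀ i p, L[i]? = some p → p.2 ≤ i + 1

lemma okList_nil : G.OkList [] := ⟨G.isBC_empty, by simp, by simp⟩

lemma OkList.lvl_le {L : List (ℕ × ℕ)} (h : G.OkList L) (u : ℕ) : G.lvl L u ≤ L.length + 1 := by
  refine lvl_le_of_forall (by omega) fun p hp => ?_
  obtain ⟨i, hi, rfl⟩ := List.mem_iff_getElem.mp hp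
  have := h.lev i _ (List.getElem?_eq_getElem hi)
  omega

lemma OkList.append {L : List (ℕ × ℕ)} (h : G.OkList L) {u : ℕ} (hu : G.Addable L u) :
    G.OkList (L ++ [(u, G.lvl L u)]) := by
  have hu' := addable_iff.mp hu
  refine ⟨?_, ?_, ?_⟩
  · rw [vs_append, Finset.union_comm]
    exact h.bc.insert hu'.1 hu'.2.1 hu'.2.2
  · rw [List.map_append, List.nodup_append]
    refine ⟨h.nodup, by simp, ?_⟩
    rintro a ha b hb rfl
    simp only [List.map_cons, List.map_nil, List.mem_singleton] at hb
    subst hb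
    exact hu.notMem (by simpa [vs] using ha)
  · intro i p hp
    rcases lt_trichotomy i L.length with hi | rfl | hi
    · rw [List.getElem?_append_left hi] at hp
      exact h.lev i p hp
    · obtain rfl : (u, G.lvl L u) = p := by simpa using hp
      exact h.lvl_le u
    · rw [List.getElem?_eq_none (by simp; omega)] at hp
      cases hp

lemma okList_singleton {r : ℕ} (hr : r < G.n) : G.OkList [(r, 1)] :=
  okList_nil.append (u := r) ⟨hr, by simp, by simp⟩

lemma OkList.step {L : List (ℕ × ℕ)} (h : G.OkList L) (U : Set ℕ) : G.OkList (G.step U L) := by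
  rcases step_cases (G := G) U L with h' | ⟨u, -, hA, hs, -⟩
  · rwa [h'.1]
  · rw [hs]; exact h.append hA

lemma OkList.iterate {L : List (ℕ × ℕ)} (h : G.OkList L) (U : Set ℕ) (t : ℕ) :
    G.OkList ((G.step U)^[t] L) := by
  induction t with
  | zero => exact h
  | succ t ih => rw [Function.iterate_succ_apply']; exact ih.step U

lemma OkList.greedy {L : List (ℕ × ℕ)} (h : G.OkList L) (U : Set ℕ) : G.OkList (G.greedy U L) :=
  h.iterate U _

lemma OkList.card_vs {L : List (ℕ × ℕ)} (h : G.OkList L) : (vs L).card = L.length := by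
  rw [vs, List.toFinset_card_of_nodup h.nodup, List.length_map]

lemma IsBC.card_le {S : Finset ℕ} (h : G.IsBC S) : S.card ≤ G.n := by
  have : S ⊆ Finset.range G.n := fun x hx => Finset.mem_range.mpr (h.lt x hx)
  simpa using Finset.card_le_card this

lemma OkList.length_le {L : List (ℕ × ℕ)} (h : G.OkList L) : L.length ≤ G.n :=
  h.card_vs ▸ h.bc.card_le

lemma prefix_step (U : Set ℕ) (L : List (ℕ × ℕ)) : L <+: G.step U L := by
  rcases step_cases (G := G) U L with h | ⟨u, -, -, hs, -⟩
  · rw [h.1]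
  · rw [hs]; exact List.prefix_append _ _

lemma prefix_iterate (U : Set ℕ) (L : List (ℕ × ℕ)) (t : ℕ) : L <+: (G.step U)^[t] L := by
  induction t with
  | zero => exact List.prefix_rfl
  | succ t ih => rw [Function.iterate_succ_apply']; exact ih.trans (prefix_step U _)

lemma prefix_greedy (U : Set ℕ) (L : List (ℕ × ℕ)) : L <+: G.greedy U L := prefix_iterate U L _

lemma iterate_of_fixed {U : Set ℕ} {L : List (ℕ × ℕ)} (h : G.step U L = L) (t : ℕ) :
    (G.step U)^[t] L = L := Function.iterate_fixed h t

/-- Each step appends a vertex or has reached a fixed point. As a bc-clique has at most `G.n`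
vertices, `G.n` steps are enough. -/
lemma iterate_dichotomy (U : Set ℕ) (L : List (ℕ × ℕ)) (t : ℕ) :
    (G.step U ((G.step U)^[t] L) = (G.step U)^[t] L ∧
      ((G.step U)^[t] L).length ≤ L.length + t) ∨
    ((G.step U)^[t] L).length = L.length + t := by
  induction t with
  | zero => right; simp
  | succ t ih =>
    rw [Function.iterate_succ_apply']
    rcases ih with ih | ih
    · left; rw [ih.1]; exact ⟨ih.1, by omega⟩
    · rcases step_cases (G := G) U ((G.step U)^[t] L) with h | ⟨u, -, -, hs, -⟩
      · left; rw [h.1]; exact ⟨h.1, by omega⟩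
      · right; rw [hs, List.length_append, ih]; simp; omega

lemma OkList.step_greedy {L : List (ℕ × ℕ)} (h : G.OkList L) (U : Set ℕ) :
    G.step U (G.greedy U L) = G.greedy U L := by
  have h' := h.greedy U
  rcases iterate_dichotomy (G := G) U L G.n with hd | hd
  · exact hd.1
  · rcases step_cases (G := G) U (G.greedy U L) with hs | ⟨u, -, -, hs, -⟩
    · exact hs.1
    · have h1 := (h'.step U).length_le
      have h2 : (G.greedy U L).length = L.length + G.n := hd
      rw [hs, List.length_append, h2] at h1
      simp only [List.length_cons] at h1
      omega

lemma OkList.greedy_of_fixed {L : List (ℕ × ℕ)} (h : G.OkList L) {U : Set ℕ} {t : ℕ}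
    (ht : G.step U ((G.step U)^[t] L) = (G.step U)^[t] L) : G.greedy U L = (G.step U)^[t] L := by
  have hg := h.step_greedy U
  unfold ColGraph.greedy at *
  rcases le_total t G.n with hle | hle
  · rw [show G.n = (G.n - t) + t by omega, Function.iterate_add_apply, iterate_of_fixed ht]
  · rw [show t = (t - G.n) + G.n by omega, Function.iterate_add_apply, iterate_of_fixed hg]

lemma OkList.greedy_step {L : List (ℕ × ℕ)} (h : G.OkList L) (U : Set ℕ) :
    G.greedy U (G.step U L) = G.greedy U L := by
  have hg := h.step_greedy U
  unfold ColGraph.greedy at *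
  rw [← Function.iterate_succ_apply, Function.iterate_succ_apply', hg]

lemma OkList.greedy_not_addable {L : List (ℕ × ℕ)} (h : G.OkList L) {U : Set ℕ} {w : ℕ}
    (hw : w ∈ U) : ¬ G.Addable (G.greedy U L) w := by
  rcases step_cases (G := G) U (G.greedy U L) with hs | ⟨u, -, -, hs, -⟩
  · exact hs.2 w hw
  · rw [h.step_greedy] at hs
    simp at hs

lemma OkList.iterate_prefix_greedy {L : List (ℕ × ℕ)} (h : G.OkList L) (U : Set ℕ) (t : ℕ) :
    (G.step U)^[t] L <+: G.greedy U L := by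
  rcases le_total t G.n with hle | hle
  · rw [ColGraph.greedy, show G.n = (G.n - t) + t by omega, Function.iterate_add_apply]
    exact prefix_iterate U _ _
  · rw [show t = (t - G.n) + G.n by omega, Function.iterate_add_apply]
    exact (iterate_of_fixed (h.step_greedy U) _).symm ▸ List.prefix_rfl

/-- Steps only append, so every intermediate list is a prefix of the last; if the process stopped
earlier, both sides are the whole list. -/
lemma OkList.take_greedy {L : List (ℕ × ℕ)} (h : G.OkList L) (U : Set ℕ) (t : ℕ) :
    (G.greedy U L).take (L.length + t) = (G.step U)^[t] L := by
  rcases iterate_dichotomy (G := G) U L t with hd | hd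
  · rw [h.greedy_of_fixed hd.1, List.take_of_length_le hd.2]
  · have := List.prefix_iff_eq_take.mp (h.iterate_prefix_greedy U t)
    rw [hd] at this
    exact this.symm

lemma vs_step_subset {U : Set ℕ} {L : List (ℕ × ℕ)} (h : ∀ x ∈ vs L, x ∈ U) :
    ∀ x ∈ vs (G.step U L), x ∈ U := by
  rcases step_cases (G := G) U L with hs | ⟨u, hu, -, hs, -⟩
  · rwa [hs.1]
  · rw [hs, vs_append]
    intro x hx
    rcases Finset.mem_union.mp hx with hx | hx
    · exact h x hx
    · simp only [vs, List.map_cons, List.map_nil, List.toFinset_cons, List.toFinset_nil,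
        insert_empty_eq, Finset.mem_singleton] at hx
      exact hx ▸ hu

lemma vs_greedy_subset {U : Set ℕ} {L : List (ℕ × ℕ)} (h : ∀ x ∈ vs L, x ∈ U) :
    ∀ x ∈ vs (G.greedy U L), x ∈ U := by
  unfold greedy
  induction G.n with
  | zero => exact h
  | succ t ih => rw [Function.iterate_succ_apply']; exact vs_step_subset ih

/-! ### The canonical order and completion -/

variable (G) in
/-- The members of a bc-clique in the order in which they are found from the smallest one. -/
noncomputable def ord (Y : Finset ℕ) : List (ℕ × ℕ) := G.greedy (Y : Set ℕ) []

lemma okList_ord (Y : Finset ℕ) : G.OkList (G.ord Y) := okList_nil.greedy _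

lemma take_ord (Y : Finset ℕ) (t : ℕ) : (G.ord Y).take t = (G.step (Y : Set ℕ))^[t] [] := by
  have := okList_nil.take_greedy (G := G) (Y : Set ℕ) t
  rwa [List.length_nil, zero_add] at this

lemma take_ord_succ (Y : Finset ℕ) (t : ℕ) :
    (G.ord Y).take (t + 1) = G.step (Y : Set ℕ) ((G.ord Y).take t) := by
  rw [take_ord, take_ord, Function.iterate_succ_apply']

lemma okList_take_ord (Y : Finset ℕ) (t : ℕ) : G.OkList ((G.ord Y).take t) := by
  rw [take_ord]; exact okList_nil.iterate _ _

/-- By `IsBC.exists_extend`, the process inside `Y` cannot stop before `Y` is exhausted. -/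
lemma IsBC.vs_ord {Y : Finset ℕ} (h : G.IsBC Y) : vs (G.ord Y) = Y := by
  have hsub : vs (G.ord Y) ⊆ Y := vs_greedy_subset (U := (Y : Set ℕ)) (by simp [vs])
  by_contra hne
  obtain ⟨y, hy, -, hE, hB⟩ := h.exists_extend hsub hne
  exact okList_nil.greedy_not_addable (U := (Y : Set ℕ)) hy
    (addable_iff.mpr ⟨h.lt y hy, hE, hB⟩)

/-- The next entry of the order. -/
lemma ord_get {Y : Finset ℕ} {t : ℕ} {p : ℕ × ℕ} (h : (G.ord Y)[t]? = some p) :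
    p.1 ∈ Y ∧ G.Addable ((G.ord Y).take t) p.1 ∧ p.2 = G.lvl ((G.ord Y).take t) p.1 ∧
      (G.ord Y).take (t + 1) = (G.ord Y).take t ++ [p] ∧
      ∀ w ∈ Y, G.Addable ((G.ord Y).take t) w →
        ¬ KLt (w, G.lvl ((G.ord Y).take t) w) p := by
  have h1 : (G.ord Y).take (t + 1) = (G.ord Y).take t ++ [p] := by
    rw [List.take_add_one, h]; rfl
  have h2 := h1
  rw [take_ord_succ] at h2
  rcases step_cases (G := G) (Y : Set ℕ) ((G.ord Y).take t) with hs | ⟨u, hu, hA, hs, hm⟩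
  · rw [hs.1] at h2; simp at h2
  · rw [h2] at hs
    obtain rfl : p = (u, G.lvl ((G.ord Y).take t) u) := by simpa using hs
    exact ⟨hu, hA, rfl, h1, hm⟩

lemma ord_get_of_step {Y : Finset ℕ} {t : ℕ} {p : ℕ × ℕ}
    (h : G.step (Y : Set ℕ) ((G.ord Y).take t) = (G.ord Y).take t ++ [p]) :
    (G.ord Y)[t]? = some p := by
  rw [← take_ord_succ, List.take_add_one] at h
  have := List.append_cancel_left h
  cases hh : (G.ord Y)[t]? <;> simp_all

/-- Later entries of the order have larger keys. -/
lemma ord_increasing (Y : Finset ℕ) (t : ℕ) : ∀ w ∈ Y, G.Addable ((G.ord Y).take t) w →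
    ∀ p ∈ (G.ord Y).take t, KLt p (w, G.lvl ((G.ord Y).take t) w) := by
  induction t with
  | zero => simp
  | succ t ih =>
    intro w hw hA
    rcases hp : (G.ord Y)[t]? with _ | p
    · have : (G.ord Y).take (t + 1) = (G.ord Y).take t := by rw [List.take_add_one, hp]; simp
      rw [this] at hA ⊢
      exact ih w hw hA
    obtain ⟨hpY, hpA, hpl, hs, hm⟩ := ord_get hp
    rw [hs] at hA ⊢
    have hwp : w ≠ p.1 := fun hh => hA.notMem (by
      simp only [mem_vs]; exact ⟨p.2, by simp [hh]⟩)
    have hmin : G.Addable ((G.ord Y).take t) w → KLt p (w, G.lvl ((G.ord Y).take t) w) :=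
      fun hA' => by
        have := hm w hw hA'
        simp only [KLt] at this ⊢
        omega
    have hold : ∀ q ∈ (G.ord Y).take t, KLt q p := fun q hq => by
      have := ih p.1 hpY hpA q hq
      rwa [← hpl] at this
    -- If `p` changed the level of `w`, the new level is `p.2 + 1`. Otherwise `w` was already
    -- eligible with the same level, and `p` was preferred to it.
    have key : KLt p (w, G.lvl ((G.ord Y).take t ++ [p]) w) := by
      by_cases hL : (G.ord Y).take t = []
      · rw [hL] at hA ⊢
        have := lvl_singleton_pos (by simpa using hA.2.2)
        left
        simp [this.2]
      · rw [lvl_append hL, lvlStep]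
        split_ifs with hc
        · left; simp
        · apply hmin
          refine ⟨hA.1, fun q hq => hA.2.1 q (by simp [hq]), ?_⟩
          have := hA.2.2
          rwa [lvl_append hL, lvlStep, if_neg hc] at this
    intro q hq
    rcases List.mem_append.mp hq with hq | hq
    · exact (hold q hq).trans key
    · obtain rfl : q = p := by simpa using hq
      exact key

variable (G) in
/-- Extend a list to a maximal bc-clique. -/
noncomputable def complete (L : List (ℕ × ℕ)) : List (ℕ × ℕ) := G.greedy Set.univ L

variable (G) in
/-- The inclusion-maximal bc-cliques. -/
def MaxBC (Y : Finset ℕ) : Prop := G.IsBC Y ∧ ∀ Z, G.IsBC Z → Y ⊆ Z → Y = Z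

lemma OkList.complete {L : List (ℕ × ℕ)} (h : G.OkList L) : G.OkList (G.complete L) := h.greedy _

lemma OkList.maxBC_complete {L : List (ℕ × ℕ)} (h : G.OkList L) : G.MaxBC (vs (G.complete L)) := by
  refine ⟨(h.greedy _).bc, fun Z hZ hsub => ?_⟩
  by_contra hne
  obtain ⟨y, hy, -, hE, hB⟩ := hZ.exists_extend hsub hne
  exact h.greedy_not_addable (Set.mem_univ y) (addable_iff.mpr ⟨hZ.lt y hy, hE, hB⟩)

lemma vs_subset_complete (L : List (ℕ × ℕ)) : vs L ⊆ vs (G.complete L) :=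
  vs_mono (prefix_greedy _ _)

lemma OkList.complete_step {L : List (ℕ × ℕ)} (h : G.OkList L) :
    G.complete (G.step Set.univ L) = G.complete L := h.greedy_step _

/-! ### Parents and children -/

variable (G)

/-- The length of the shortest prefix of the order of `Y` that is completed to `Y`. -/
noncomputable def parLen (Y : Finset ℕ) : ℕ :=
  sInf {j | vs (G.complete ((G.ord Y).take j)) = Y}

/-- The parent of a maximal bc-clique. -/
noncomputable def parent (Y : Finset ℕ) : Finset ℕ :=
  vs (G.complete ((G.ord Y).take (G.parLen Y - 1)))

/-- The vertex by which the parent is left for `Y`. -/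
noncomputable def parVertex (Y : Finset ℕ) : ℕ :=
  ((G.ord Y).map Prod.fst).getD (G.parLen Y - 1) 0

/-- The first vertex in the order of `Y`. -/
noncomputable def parRoot (Y : Finset ℕ) : ℕ := ((G.ord Y).map Prod.fst).getD 0 0

/-- The list from which a candidate for a child of `X` is built. -/
noncomputable def candList (X : Finset ℕ) (v r : ℕ) : List (ℕ × ℕ) :=
  G.greedy ({x | x ∈ X ∧ G.E v x} ∪ {v}) [(r, 1)]

/-- The candidate for a child of `X`. -/
noncomputable def cand (X : Finset ℕ) (v r : ℕ) : Finset ℕ :=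
  vs (G.complete ((G.candList X v r).take (((G.candList X v r).map Prod.fst).idxOf v + 1)))

/-- The test whether the candidate is a child. -/
def IsChild (X : Finset ℕ) (v r : ℕ) : Prop :=
  (r ∈ X ∨ r = v) ∧ v ∈ vs (G.candList X v r) ∧ G.parLen (G.cand X v r) ≠ 0 ∧
    G.parVertex (G.cand X v r) = v ∧ G.parRoot (G.cand X v r) = r ∧ G.parent (G.cand X v r) = X

variable {G}

lemma MaxBC.complete_ord {Y : Finset ℕ} (h : G.MaxBC Y) : vs (G.complete (G.ord Y)) = Y :=
  (h.2 _ (okList_ord Y).maxBC_complete.1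
    (by have := vs_subset_complete (G := G) (G.ord Y); rwa [h.1.vs_ord] at this)).symm

lemma MaxBC.parLen_mem {Y : Finset ℕ} (h : G.MaxBC Y) :
    vs (G.complete ((G.ord Y).take (G.parLen Y))) = Y :=
  Nat.sInf_mem (s := {j | vs (G.complete ((G.ord Y).take j)) = Y})
    ⟨(G.ord Y).length, by simpa using h.complete_ord⟩

lemma MaxBC.parLen_le {Y : Finset ℕ} (h : G.MaxBC Y) : G.parLen Y ≤ (G.ord Y).length :=
  Nat.sInf_le (by simpa using h.complete_ord)

lemma ne_of_lt_parLen {Y : Finset ℕ} {j : ℕ} (h : j < G.parLen Y) :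
    vs (G.complete ((G.ord Y).take j)) ≠ Y :=
  Nat.notMem_of_lt_sInf h

lemma maxBC_parent (Y : Finset ℕ) : G.MaxBC (G.parent Y) :=
  (okList_take_ord Y _).maxBC_complete

lemma MaxBC.parLen_eq_zero {Y : Finset ℕ} (h : G.MaxBC Y) :
    G.parLen Y = 0 ↔ Y = vs (G.complete []) := by
  constructor
  · intro h0
    have := h.parLen_mem
    rw [h0] at this
    simpa using this.symm
  · intro hY
    exact Nat.eq_zero_of_le_zero (Nat.sInf_le (by simpa using hY.symm))

/-- The vertex at which the parent is left. -/
lemma MaxBC.exists_parVertex {Y : Finset ℕ} (h : G.MaxBC Y) (h0 : G.parLen Y ≠ 0) :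
    ∃ l, (G.ord Y)[G.parLen Y - 1]? = some (G.parVertex Y, l) := by
  have hlt : G.parLen Y - 1 < (G.ord Y).length := by have := h.parLen_le; omega
  refine ⟨((G.ord Y)[G.parLen Y - 1]).2, ?_⟩
  rw [parVertex, List.getD_eq_getElem?_getD, List.getElem?_map, List.getElem?_eq_getElem hlt]
  simp

lemma MaxBC.ord_zero {Y : Finset ℕ} (h : G.MaxBC Y) (h0 : G.parLen Y ≠ 0) :
    (G.ord Y)[0]? = some (G.parRoot Y, 1) := by
  have hlt : 0 < (G.ord Y).length := by have := h.parLen_le; omega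
  have h1 := List.getElem?_eq_getElem hlt
  have h2 := (ord_get h1).2.2.1
  rw [parRoot, List.getD_eq_getElem?_getD, List.getElem?_map, h1]
  simp only [List.take_zero, lvl_nil] at h2
  simp [← h2]

lemma MaxBC.parVertex_mem {Y : Finset ℕ} (h : G.MaxBC Y) (h0 : G.parLen Y ≠ 0) :
    G.parVertex Y ∈ Y := by
  obtain ⟨l, hl⟩ := h.exists_parVertex h0
  exact (ord_get hl).1

lemma MaxBC.parRoot_mem {Y : Finset ℕ} (h : G.MaxBC Y) (h0 : G.parLen Y ≠ 0) :
    G.parRoot Y ∈ Y :=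
  (ord_get (h.ord_zero h0)).1

/-- The completion of the prefix that gives the parent starts with an earlier vertex. -/
lemma MaxBC.exists_first {Y : Finset ℕ} (h : G.MaxBC Y) {i : ℕ} (hi : i + 1 = G.parLen Y)
    {p : ℕ × ℕ} (hp : (G.ord Y)[i]? = some p) :
    ∃ u ∈ G.parent Y, G.Addable ((G.ord Y).take i) u ∧
      KLt (u, G.lvl ((G.ord Y).take i) u) p := by
  obtain ⟨hpY, hpA, hpl, hs, hm⟩ := ord_get hp
  obtain ⟨u, -, hA, hst, hmin⟩ := exists_step (Set.mem_univ p.1) hpA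
  have hpar : G.parent Y = vs (G.complete ((G.ord Y).take i)) := by
    rw [parent, ← hi]; rfl
  refine ⟨u, ?_, hA, ?_⟩
  · rw [hpar, ← (okList_take_ord Y i).complete_step, hst]
    exact vs_subset_complete _ (by simp)
  · have h1 := hmin p.1 (Set.mem_univ _) hpA
    rw [← hpl] at h1
    -- Otherwise the completion begins with `p` itself, so the prefix of length `i` already
    -- completes to `Y`, against the choice of `parLen`.
    by_contra h2
    have : p = (u, G.lvl ((G.ord Y).take i) u) := by
      simp only [KLt] at h1 h2
      ext <;> simp only <;> omega
    rw [← this, ← hs, hi] at hst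
    apply ne_of_lt_parLen (G := G) (Y := Y) (j := i) (by omega)
    rw [← (okList_take_ord Y i).complete_step, hst]
    exact h.parLen_mem

/-! ### Parents come earlier, and children can be reconstructed -/

/-- Lexicographic comparison of the orders of two sets. -/
def Before (G : ColGraph) (X Y : Finset ℕ) : Prop :=
  ∃ l p q, (G.ord X).take l = (G.ord Y).take l ∧ (G.ord X)[l]? = some p ∧
    (G.ord Y)[l]? = some q ∧ KLt p q

lemma Before.irrefl (X : Finset ℕ) : ¬ G.Before X X := by
  rintro ⟨l, p, q, -, hp, hq, h⟩
  rw [hp] at hq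
  obtain rfl : p = q := by simpa using hq
  exact KLt.irrefl p h

lemma Before.trans {X Y Z : Finset ℕ} (h : G.Before X Y) (h' : G.Before Y Z) : G.Before X Z := by
  obtain ⟨l, p, q, ht, hp, hq, hk⟩ := h
  obtain ⟨l', p', q', ht', hp', hq', hk'⟩ := h'
  have restrict : ∀ {A B : List (ℕ × ℕ)} {a b : ℕ}, A.take a = B.take a → b ≤ a →
      A.take b = B.take b := fun {A B a b} hh hba => by
    have := congrArg (List.take b) hh
    rwa [List.take_take, List.take_take, min_eq_left hba] at this
  have entry : ∀ {A B : List (ℕ × ℕ)} {a b : ℕ}, A.take a = B.take a → b < a →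
      A[b]? = B[b]? := fun {A B a b} hh hba => by
    have := congrArg (fun l => l[b]?) hh
    simpa [List.getElem?_take, hba] using this
  rcases lt_trichotomy l l' with hll | rfl | hll
  · exact ⟨l, p, q, ht.trans (restrict ht' hll.le), hp, by rw [← entry ht' hll, hq], hk⟩
  · rw [hp'] at hq
    obtain rfl : p' = q := by simpa using hq
    exact ⟨l, p, q', ht.trans ht', hp, hq', hk.trans hk'⟩
  · exact ⟨l', p', q', (restrict ht hll.le).trans ht', by rw [entry ht hll, hp'], hq', hk'⟩

/-- The parent contains the first `i` vertices of the order of `Y`, so its own order can deviate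
there only to a smaller key. If it does not deviate, the next entry is smaller: by
`MaxBC.exists_first` the parent has an eligible vertex that beats `parVertex Y`. -/
lemma MaxBC.parent_before {Y : Finset ℕ} (h : G.MaxBC Y) (h0 : G.parLen Y ≠ 0) :
    G.Before (G.parent Y) Y := by
  obtain ⟨i, hi⟩ : ∃ i, i + 1 = G.parLen Y := ⟨G.parLen Y - 1, by omega⟩
  obtain ⟨lv, hv⟩ := h.exists_parVertex h0
  rw [show G.parLen Y - 1 = i by omega] at hv
  have hsub : vs ((G.ord Y).take i) ⊆ G.parent Y := by
    rw [parent, show G.parLen Y - 1 = i by omega]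
    exact vs_subset_complete _
  have key : ∀ l ≤ i, G.Before (G.parent Y) Y ∨
      (G.ord (G.parent Y)).take l = (G.ord Y).take l := by
    intro l
    induction l with
    | zero => intro _; right; simp
    | succ l ih =>
      intro hl
      rcases ih (by omega) with hb | heq
      · exact Or.inl hb
      have hlt : l < (G.ord Y).length := by
        have := (List.getElem?_eq_some_iff.mp hv).1
        omega
      obtain ⟨hyY, hyA, hyl, hs, hm⟩ := ord_get (List.getElem?_eq_getElem hlt)
      have hyX : ((G.ord Y)[l]).1 ∈ G.parent Y := by
        apply hsub
        rw [mem_vs]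
        exact ⟨((G.ord Y)[l]).2, List.mem_take_iff_getElem.mpr ⟨l, by omega, rfl⟩⟩
      rw [← heq] at hyA
      obtain ⟨u, huX, huA, hst, hmin⟩ := exists_step (U := (G.parent Y : Set ℕ)) hyX hyA
      have hx := ord_get_of_step hst
      by_cases hk : KLt (u, G.lvl ((G.ord (G.parent Y)).take l) u) ((G.ord Y)[l])
      · exact Or.inl ⟨l, _, _, heq, hx, List.getElem?_eq_getElem hlt, hk⟩
      · right
        have h1 := hmin _ hyX hyA
        rw [heq, ← hyl] at h1
        rw [heq] at hk hst hx
        have : (G.ord Y)[l] = (u, G.lvl ((G.ord Y).take l) u) := by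
          simp only [KLt] at h1 hk
          ext <;> simp only <;> omega
        rw [hs, take_ord_succ, heq, hst, this]
  rcases key i le_rfl with hb | heq
  · exact hb
  obtain ⟨u, huX, huA, huk⟩ := h.exists_first hi hv
  rw [← heq] at huA huk
  obtain ⟨u', hu'X, hu'A, hst, hmin⟩ := exists_step (U := (G.parent Y : Set ℕ)) huX huA
  refine ⟨i, _, _, heq, ord_get_of_step hst, hv, ?_⟩
  have h1 := hmin u huX huA
  simp only [KLt] at h1 huk ⊢
  omega

/-- The candidate list starts with the prefix of the order of a child. -/
lemma MaxBC.take_candList {Y : Finset ℕ} (h : G.MaxBC Y) (h0 : G.parLen Y ≠ 0) :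
    (G.candList (G.parent Y) (G.parVertex Y) (G.parRoot Y)).take (G.parLen Y) =
      (G.ord Y).take (G.parLen Y) := by
  obtain ⟨i, hi⟩ : ∃ i, i + 1 = G.parLen Y := ⟨G.parLen Y - 1, by omega⟩
  obtain ⟨lv, hv⟩ := h.exists_parVertex h0
  have hr := h.ord_zero h0
  have hrY := ord_get hr
  have hmem := h.parLen_mem
  rw [show G.parLen Y - 1 = i by omega] at hv
  rw [← hi] at hmem ⊢
  obtain ⟨hvY, hvA, hvl, hvs, -⟩ := ord_get hv
  have hsub : vs ((G.ord Y).take i) ⊆ G.parent Y := by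
    rw [parent, show G.parLen Y - 1 = i by omega]
    exact vs_subset_complete _
  have hX := (maxBC_parent (G := G) Y).1
  set v := G.parVertex Y
  set U : Set ℕ := {x | x ∈ G.parent Y ∧ G.E v x} ∪ {v} with hU
  have hok : G.OkList [(G.parRoot Y, 1)] := okList_singleton hrY.2.1.lt
  -- The next entry of the order lies in `U`, so the greedy search in `U` can differ only by
  -- choosing something with a smaller key.
  have key : ∀ l ≤ i, (G.step U)^[l] [(G.parRoot Y, 1)] = (G.ord Y).take (l + 1) := by
    intro l
    induction l with
    | zero => intro _; rw [hrY.2.2.2.1]; simp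
    | succ l ih =>
      intro hl
      have hlt : l + 1 < (G.ord Y).length := by
        have := (List.getElem?_eq_some_iff.mp hv).1
        omega
      have hy := List.getElem?_eq_getElem hlt
      generalize (G.ord Y)[l + 1] = y at hy
      obtain ⟨hyY, hyA, hyl, hs, hm⟩ := ord_get hy
      have hyle : y = (v, lv) ∨ KLt y (v, lv) := by
        rcases hl.lt_or_eq with hl | hl
        · right
          rw [show lv = _ from hvl]
          exact ord_increasing Y i v hvY hvA y (List.mem_of_getElem? (i := l + 1)
            (by rw [List.getElem?_take, if_pos hl, hy]))
        · left; rw [← hl, hy] at hv; simpa using hv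
      have hyU : y.1 ∈ U := by
        rcases hl.lt_or_eq with hl | hl
        · left
          have : y.1 ∈ vs ((G.ord Y).take i) := mem_vs.mpr ⟨y.2, List.mem_of_getElem?
            (i := l + 1) (by rw [List.getElem?_take, if_pos hl, hy])⟩
          exact ⟨hsub this, hvA.adj this⟩
        · right; rw [← hl, hy] at hv
          obtain rfl : y = (v, lv) := by simpa using hv
          rfl
      rw [Function.iterate_succ_apply', ih (by omega), hs]
      obtain ⟨w, hwU, hwA, hst, hmin⟩ := exists_step hyU hyA
      rw [hst]
      have h1 := hmin _ hyU hyA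
      rw [← hyl] at h1
      by_cases hk : KLt (w, G.lvl ((G.ord Y).take (l + 1)) w) y
      swap
      · congr 2
        simp only [KLt] at h1 hk
        ext <;> simp only <;> omega
      -- Such a `w` is outside `Y`, hence in the parent and adjacent to `v`, so it could be appended
      -- also after `v`, at no higher level. Then the completion of the prefix ending with `v`,
      -- which is `Y`, would begin with a vertex `a` of key below that of `v`; but keys increase
      -- along the order of `Y`.
      exfalso
      have hwY : w ∉ Y := fun hh => hm w hh hwA hk
      have hwv : w ≠ v := fun hh => hwY (hh ▸ hvY)
      obtain ⟨hwX, hEw⟩ : w ∈ G.parent Y ∧ G.E v w := by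
        rcases hwU with hh | hh
        · exact hh
        · exact absurd hh hwv
      have hne : (G.ord Y).take (l + 1) ≠ [] := by
        rw [← List.length_pos_iff, List.length_take]; omega
      have hpre : (G.ord Y).take (l + 1) <+: (G.ord Y).take (i + 1) :=
        List.take_prefix_take_left (by omega)
      have hl' := lvl_prefix hne hpre hwA.2.2
      have hwA' : G.Addable ((G.ord Y).take (i + 1)) w := by
        refine ⟨hwA.1, fun p hp => ?_, hl'.1⟩
        rw [hvs] at hp
        rcases List.mem_append.mp hp with hp | hp
        · have hpi : p.1 ∈ vs ((G.ord Y).take i) := mem_vs.mpr ⟨p.2, hp⟩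
          refine hX.clique w hwX p.1 (hsub hpi) fun hh => hwY ?_
          rw [hh, ← h.1.vs_ord]
          exact vs_mono (List.take_prefix _ _) hpi
        · obtain rfl : p = (v, lv) := by simpa using hp
          exact G.E_symm _ _ hEw
      obtain ⟨a, -, haA, hast, hamin⟩ := exists_step (Set.mem_univ w) hwA'
      have haY : a ∈ Y := by
        rw [← hmem, ← (okList_take_ord Y (i + 1)).complete_step, hast]
        exact vs_subset_complete _ (by simp)
      have h2 := ord_increasing Y (i + 1) a haY haA (v, lv) (by rw [hvs]; simp)
      have h3 := hamin w (Set.mem_univ w) hwA'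
      simp only [KLt] at h2 h3 hk
      rcases hyle with rfl | hyle
      · simp only at hk; omega
      · simp only [KLt] at hyle; omega
  have := hok.take_greedy U i
  rw [key i le_rfl] at this
  rw [candList, ← hU, ← this, List.length_singleton, add_comm]

lemma idxOf_take {L : List (ℕ × ℕ)} (hn : (L.map Prod.fst).Nodup) {i v l : ℕ}
    (h : L[i]? = some (v, l)) : (L.map Prod.fst).idxOf v = i := by
  have hlt := (List.getElem?_eq_some_iff.mp h).1
  have h1 : (L.map Prod.fst)[i]'(by simpa) = v := by
    have := (List.getElem?_eq_some_iff.mp h).2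
    simp [this]
  rw [← h1]
  exact hn.idxOf_getElem i _

lemma MaxBC.isChild {Y : Finset ℕ} (h : G.MaxBC Y) (h0 : G.parLen Y ≠ 0) :
    G.IsChild (G.parent Y) (G.parVertex Y) (G.parRoot Y) ∧
      G.cand (G.parent Y) (G.parVertex Y) (G.parRoot Y) = Y := by
  have ht := h.take_candList h0
  obtain ⟨i, hi⟩ : ∃ i, i + 1 = G.parLen Y := ⟨G.parLen Y - 1, by omega⟩
  obtain ⟨lv, hv⟩ := h.exists_parVertex h0
  have hr := h.ord_zero h0
  have hmem := h.parLen_mem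
  rw [show G.parLen Y - 1 = i by omega] at hv
  have hok : G.OkList (G.candList (G.parent Y) (G.parVertex Y) (G.parRoot Y)) :=
    (okList_singleton (h.1.lt _ (h.parRoot_mem h0))).greedy _
  have hv' : (G.candList (G.parent Y) (G.parVertex Y) (G.parRoot Y))[i]? =
      some (G.parVertex Y, lv) := by
    have := congrArg (fun l => l[i]?) ht
    simpa [List.getElem?_take, show i < G.parLen Y by omega, hv] using this
  have hcand : G.cand (G.parent Y) (G.parVertex Y) (G.parRoot Y) = Y := by
    rw [cand, idxOf_take hok.nodup hv', hi, ht, hmem]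
  refine ⟨⟨?_, mem_vs.mpr ⟨lv, List.mem_of_getElem? hv'⟩, ?_⟩, hcand⟩
  -- If the prefix is a single vertex, it is both the root and `v`; this is why candidates with `r =
  -- v` are admitted. Otherwise the root belongs to the prefix that was completed to the parent.
  · rcases Nat.eq_zero_or_pos i with rfl | hpos
    · right; rw [hv] at hr; simpa using (congrArg (fun o => o.map Prod.fst) hr).symm
    · left
      rw [parent, show G.parLen Y - 1 = i by omega]
      refine vs_subset_complete _ (mem_vs.mpr ⟨1, List.mem_of_getElem? (i := 0) ?_⟩)
      rw [List.getElem?_take, if_pos hpos, hr]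
  · rw [hcand]
    exact ⟨h0, rfl, rfl, rfl⟩

end ColGraph

/-! ### Reasoning about commands -/

namespace RamWhile

open WordRAM

section Logic

variable {I : Input} {S W : ℕ}

/-- The command terminates from `s`, in a state with property `Q`. -/
def Wp (I : Input) (S W : ℕ) (c : Cmd) (Q : St → Prop) (s : St) : Prop :=
  ∃ s', Exec I S W c s s' ∧ Q s'

lemma Wp.mono {c : Cmd} {Q R : St → Prop} {s : St} (h : Wp I S W c Q s) (hQ : ∀ s', Q s' → R s') :
    Wp I S W c R s :=
  h.imp fun s' hs => ⟨hs.1, hQ s' hs.2⟩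

lemma Wp.seq {c d : Cmd} {Q R : St → Prop} {s : St} (h : Wp I S W c R s)
    (h' : ∀ s', R s' → Wp I S W d Q s') : Wp I S W (.seq c d) Q s := by
  obtain ⟨s', hs, hR⟩ := h
  obtain ⟨s'', hs', hQ⟩ := h' s' hR
  exact ⟨s'', .seq hs hs', hQ⟩

lemma Wp.ite {e : Tm} {c d : Cmd} {Q : St → Prop} {s : St} (h : e.Safe I S W s)
    (hc : 0 < e.eval I s → Wp I S W c (fun s' => Q s'.tick) s.tick)
    (hd : e.eval I s = 0 → Wp I S W d (fun s' => Q s'.tick) s.tick) :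
    Wp I S W (.ite e c d) Q s := by
  rcases Nat.eq_zero_or_pos (e.eval I s) with he | he
  · obtain ⟨s', hs, hQ⟩ := hd he
    exact ⟨_, .iteFalse h he hs, hQ⟩
  · obtain ⟨s', hs, hQ⟩ := hc he
    exact ⟨_, .iteTrue h he hs, hQ⟩

/-- Loops with a variant. -/
lemma Wp.loop {e : Tm} {c : Cmd} {s : St} (Inv : St → Prop) (f : St → ℕ) (h0 : Inv s)
    (hs : ∀ s, Inv s → e.Safe I S W s)
    (hc : ∀ s, Inv s → 0 < e.eval I s →
      Wp I S W c (fun s' => Inv s'.tick ∧ f s'.tick < f s) s.tick) :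
    Wp I S W (.loop e c) (fun s' => ∃ s₀, Inv s₀ ∧ e.eval I s₀ = 0 ∧ s' = s₀.tick) s := by
  induction hf : f s using Nat.strong_induction_on generalizing s with
  | _ k ih =>
    rcases Nat.eq_zero_or_pos (e.eval I s) with he | he
    · exact ⟨_, .loopFalse (hs s h0) he, s, h0, he, rfl⟩
    · obtain ⟨s', h1, h2, h3⟩ := hc s h0 he
      obtain ⟨s'', h4, h5⟩ := ih _ (hf ▸ h3) h2 rfl
      exact ⟨s'', .loopTrue (hs s h0) he h1 h4, h5⟩

@[simp] lemma St.tick_reg (s : St) : s.tick.reg = s.reg := rfl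
@[simp] lemma St.tick_arr (s : St) : s.tick.arr = s.arr := rfl
@[simp] lemma St.set_arr (s : St) (x : Var) (a : ℕ) : (s.set x a).arr = s.arr := rfl

@[simp] lemma St.set_reg_self (s : St) (x : Var) (a : ℕ) : (s.set x a).reg x = a := by
  simp [St.set]

@[simp] lemma St.set_reg_ne (s : St) {x y : Var} (a : ℕ) (h : y ≠ x) :
    (s.set x a).reg y = s.reg y := by
  simp [St.set, h]

/-- Only the given variables and arrays change, and no output is produced, in bounded time. -/
structure Frame (xs : List Var) (as : List Arr) (τ : ℕ) (s s' : St) : Prop where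
  reg : ∀ x, x ∉ xs → s'.reg x = s.reg x
  arr : ∀ a, a ∉ as → s'.arr a = s.arr a
  cur : s'.cur = s.cur
  out : s'.out = s.out
  last : s'.last = s.last
  gap : s'.gap = s.gap
  le : s.time ≤ s'.time
  time : s'.time ≤ s.time + τ

lemma Frame.refl (xs : List Var) (as : List Arr) (s : St) : Frame xs as 0 s s :=
  ⟨fun _ _ => rfl, fun _ _ => rfl, rfl, rfl, rfl, rfl, le_rfl, le_rfl⟩

lemma Frame.trans {xs : List Var} {as : List Arr} {τ τ' : ℕ} {s s' s'' : St}
    (h : Frame xs as τ s s') (h' : Frame xs as τ' s' s'') : Frame xs as (τ + τ') s s'' :=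
  ⟨fun x hx => (h'.reg x hx).trans (h.reg x hx), fun a ha => (h'.arr a ha).trans (h.arr a ha),
    h'.cur.trans h.cur, h'.out.trans h.out, h'.last.trans h.last, h'.gap.trans h.gap,
    h.le.trans h'.le, by have := h.time; have := h'.time; omega⟩

lemma Frame.mono {xs ys : List Var} {as bs : List Arr} {τ τ' : ℕ} {s s' : St}
    (h : Frame xs as τ s s') (hx : xs ⊆ ys) (ha : as ⊆ bs) (hτ : τ ≤ τ') :
    Frame ys bs τ' s s' :=
  ⟨fun x hh => h.reg x fun h' => hh (hx h'), fun a hh => h.arr a fun h' => hh (ha h'),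
    h.cur, h.out, h.last, h.gap, h.le, by have := h.time; omega⟩

lemma Frame.tick {xs : List Var} {as : List Arr} {τ : ℕ} {s s' : St}
    (h : Frame xs as τ s s') : Frame xs as (τ + 1) s s'.tick :=
  ⟨h.reg, h.arr, h.cur, h.out, h.last, h.gap, by have := h.le; simp only [St.tick]; omega,
    by have := h.time; simp only [St.tick]; omega⟩

lemma Frame.tick_left {xs : List Var} {as : List Arr} {τ : ℕ} {s s' : St}
    (h : Frame xs as τ s.tick s') : Frame xs as (τ + 1) s s' :=
  ⟨h.reg, h.arr, h.cur, h.out, h.last, h.gap, by have := h.le; simp only [St.tick] at this; omega,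
    by have := h.time; simp only [St.tick] at this; omega⟩

lemma Frame.set {xs : List Var} {as : List Arr} {τ : ℕ} {s s' : St}
    (h : Frame xs as τ s s') {x : Var} (hx : x ∈ xs) (a : ℕ) :
    Frame xs as (τ + 1) s (s'.set x a) :=
  ⟨fun y hy => by rw [St.set_reg_ne _ _ (by rintro rfl; exact hy hx), h.reg y hy], h.arr, h.cur, h.out,
    h.last, h.gap, by have := h.le; simp only [St.set]; omega,
    by have := h.time; simp only [St.set]; omega⟩

lemma Wp.skip {Q : St → Prop} {s : St} (h : Q s) : Wp I S W .skip Q s := ⟨s, .skip, h⟩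

lemma Wp.assign {x : Var} {e : Tm} {Q : St → Prop} {s : St} (h : e.Safe I S W s)
    (hQ : Q (s.set x (e.eval I s))) : Wp I S W (.assign x e) Q s :=
  ⟨_, .assign h, hQ⟩

lemma wp_assign {x : Var} {e : Tm} {s : St} (h : e.Safe I S W s) :
    Wp I S W (.assign x e) (fun s' => Frame [x] [] 1 s s' ∧ s'.reg x = e.eval I s) s :=
  .assign h ⟨(Frame.refl _ _ _).set (by simp) _, by simp⟩

lemma wp_store {a : Arr} {i e : Tm} {s : St} (hi : i.Safe I S W s) (he : e.Safe I S W s)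
    (hS : i.eval I s < S) :
    Wp I S W (.store a i e) (fun s' => Frame [] [a] 1 s s' ∧
      ∀ k, s'.arr a k = if k = i.eval I s then e.eval I s else s.arr a k) s := by
  refine ⟨_, .store hi he hS, ⟨fun _ _ => rfl, fun b hb => ?_, rfl, rfl, rfl, rfl, ?_, ?_⟩, ?_⟩
  · simp only [List.mem_singleton] at hb
    simp [St.put, hb]
  · simp [St.put]
  · simp [St.put]
  · intro k
    simp [St.put, Function.update_apply]

/-! ### Derived terms -/

open Classical in
/-- `1` or `0` as `p` holds or not. -/
noncomputable def truth (p : Prop) : ℕ := if p then 1 else 0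

@[simp] lemma truth_pos {p : Prop} : 0 < truth p ↔ p := by
  unfold truth; split_ifs <;> simp_all

@[simp] lemma truth_eq_zero {p : Prop} : truth p = 0 ↔ ¬ p := by
  unfold truth; split_ifs <;> simp_all

lemma truth_le_one (p : Prop) : truth p ≤ 1 := by
  unfold truth; split_ifs <;> simp

lemma truth_mul (p q : Prop) : truth p * truth q = truth (p ∧ q) := by
  unfold truth; split_ifs <;> simp_all

/-- `1` if `a` is zero, else `0`. -/
def Tm.not (a : Tm) : Tm := .sub (.const 1) a

/-- `1` or `0` as `a < b` or not. -/
def Tm.lt (a b : Tm) : Tm := .not (.not (.sub b a))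

/-- `1` or `0` as `a` and `b` are both nonzero or not. -/
def Tm.and (a b : Tm) : Tm := .mul (.not (.not a)) (.not (.not b))

/-- `1` or `0` as `a` or `b` is nonzero or not. -/
def Tm.or (a b : Tm) : Tm := .not (.mul (.not a) (.not b))

/-- `1` or `0` as `a = b` or not. -/
def Tm.eq (a b : Tm) : Tm := .and (.not (.sub a b)) (.not (.sub b a))

@[simp] lemma Tm.eval_const (s : St) (c : ℕ) : (Tm.const c).eval I s = c := rfl
@[simp] lemma Tm.eval_var (s : St) (x : Var) : (Tm.var x).eval I s = s.reg x := rfl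
@[simp] lemma Tm.eval_add (s : St) (a b : Tm) : (a.add b).eval I s = a.eval I s + b.eval I s := rfl
@[simp] lemma Tm.eval_sub (s : St) (a b : Tm) : (a.sub b).eval I s = a.eval I s - b.eval I s := rfl
@[simp] lemma Tm.eval_mul (s : St) (a b : Tm) : (a.mul b).eval I s = a.eval I s * b.eval I s := rfl
@[simp] lemma Tm.eval_div (s : St) (a b : Tm) : (a.div b).eval I s = a.eval I s / b.eval I s := rfl
@[simp] lemma Tm.eval_get (s : St) (a : Arr) (i : Tm) :
    (Tm.get a i).eval I s = s.arr a (i.eval I s) := rfl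

@[simp] lemma Tm.eval_not (s : St) (a : Tm) :
    (a.not).eval I s = truth (a.eval I s = 0) := by
  simp only [Tm.not, eval_sub, eval_const, truth]; split_ifs <;> omega

@[simp] lemma Tm.eval_lt (s : St) (a b : Tm) :
    (a.lt b).eval I s = truth (a.eval I s < b.eval I s) := by
  simp only [Tm.lt, eval_not, eval_sub, truth_eq_zero, Nat.sub_eq_zero_iff_le, not_le]

@[simp] lemma Tm.eval_and (s : St) (a b : Tm) :
    (a.and b).eval I s = truth (0 < a.eval I s ∧ 0 < b.eval I s) := by
  simp only [Tm.and, eval_mul, eval_not, truth_eq_zero, truth_mul, Nat.pos_iff_ne_zero, ne_eq]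

@[simp] lemma Tm.eval_or (s : St) (a b : Tm) :
    (a.or b).eval I s = truth (0 < a.eval I s ∨ 0 < b.eval I s) := by
  simp only [Tm.or, eval_mul, eval_not, truth_eq_zero, truth_mul, Nat.pos_iff_ne_zero, ne_eq,
    not_and_or]

@[simp] lemma Tm.eval_eq (s : St) (a b : Tm) :
    (a.eq b).eval I s = truth (a.eval I s = b.eval I s) := by
  simp only [Tm.eq, eval_and, eval_not, eval_sub, truth_pos]
  congr 1
  exact propext (by omega)

@[simp] lemma Tm.safe_const (s : St) (c : ℕ) : (Tm.const c).Safe I S W s ↔ c < W := Iff.rfl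
@[simp] lemma Tm.safe_var (s : St) (x : Var) : (Tm.var x).Safe I S W s := trivial
@[simp] lemma Tm.safe_add (s : St) (a b : Tm) : (a.add b).Safe I S W s ↔
    a.Safe I S W s ∧ b.Safe I S W s ∧ a.eval I s + b.eval I s < W := Iff.rfl
@[simp] lemma Tm.safe_mul (s : St) (a b : Tm) : (a.mul b).Safe I S W s ↔
    a.Safe I S W s ∧ b.Safe I S W s ∧ a.eval I s * b.eval I s < W := Iff.rfl
@[simp] lemma Tm.safe_sub (s : St) (a b : Tm) : (a.sub b).Safe I S W s ↔
    a.Safe I S W s ∧ b.Safe I S W s := Iff.rfl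
@[simp] lemma Tm.safe_div (s : St) (a b : Tm) : (a.div b).Safe I S W s ↔
    a.Safe I S W s ∧ b.Safe I S W s := Iff.rfl
@[simp] lemma Tm.safe_get (s : St) (a : Arr) (i : Tm) : (Tm.get a i).Safe I S W s ↔
    i.Safe I S W s ∧ i.eval I s < S := Iff.rfl

lemma Tm.safe_not (h1 : 1 < W) (s : St) (a : Tm) : (a.not).Safe I S W s ↔ a.Safe I S W s := by
  simp [Tm.not, h1]

lemma Tm.safe_lt (h1 : 1 < W) (s : St) (a b : Tm) :
    (a.lt b).Safe I S W s ↔ b.Safe I S W s ∧ a.Safe I S W s := by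
  simp [Tm.lt, safe_not h1]

/-- The operands are reduced to `0` or `1` before they are multiplied, so the product needs no bound
of its own. -/
lemma Tm.safe_and (h1 : 1 < W) (s : St) (a b : Tm) :
    (a.and b).Safe I S W s ↔ a.Safe I S W s ∧ b.Safe I S W s := by
  simp only [Tm.and, safe_mul, safe_not h1, eval_not, truth_mul]
  exact ⟨fun h => ⟨h.1, h.2.1⟩, fun h => ⟨h.1, h.2, (truth_le_one _).trans_lt h1⟩⟩

lemma Tm.safe_or (h1 : 1 < W) (s : St) (a b : Tm) :
    (a.or b).Safe I S W s ↔ a.Safe I S W s ∧ b.Safe I S W s := by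
  simp only [Tm.or, safe_mul, safe_not h1, eval_not, truth_mul]
  exact ⟨fun h => ⟨h.1, h.2.1⟩, fun h => ⟨h.1, h.2, (truth_le_one _).trans_lt h1⟩⟩

lemma Tm.safe_eq (h1 : 1 < W) (s : St) (a b : Tm) :
    (a.eq b).Safe I S W s ↔ a.Safe I S W s ∧ b.Safe I S W s := by
  simp [Tm.eq, safe_and h1, safe_not h1]; tauto

/-- Execute a command under a condition. -/
def Cmd.when (e : Tm) (c : Cmd) : Cmd := .ite e c .skip

/-- Let `y` run through the numbers below the value of `x`. -/
def Cmd.for (y x : Var) (c : Cmd) : Cmd :=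
  .seq (.assign y (.const 0)) (.loop (.lt (.var y) (.var x))
    (.seq c (.assign y (.add (.var y) (.const 1)))))

/-- The rule for bounded loops. The property `P k` holds before the `k`-th execution of the body. -/
lemma Wp.for {y x : Var} {c : Cmd} {s : St} (h1 : 1 < W) (xs ys : List Var) (as : List Arr)
    (τ : ℕ) (P : ℕ → St → Prop) (hi : y ∈ xs) (hys : ys ⊆ xs) (hiy : y ∉ ys) (hx : x ∉ xs)
    (hW : s.reg x < W) (h0 : P 0 (s.set y 0))
    (hc : ∀ k < s.reg x, ∀ s', (∃ τ', Frame xs as τ' s s') → s'.reg y = k → P k s' →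
      Wp I S W c (fun s'' => Frame ys as τ s' s'' ∧ P (k + 1) (s''.set y (k + 1)).tick) s')
    (ht : ∀ k s', P k s' → P k s'.tick) :
    Wp I S W (.for y x c) (fun s' => Frame xs as (s.reg x * (τ + 3) + 2) s s' ∧ P (s.reg x) s')
      s := by
  have hxi : x ≠ y := fun hh => hx (hh ▸ hi)
  refine (Wp.assign (by simp; omega) (Q := fun s' => s' = s.set y 0) rfl).seq ?_
  rintro _ rfl
  have hloop := Wp.loop (I := I) (S := S) (W := W) (s := s.set y 0) (e := .lt (.var y) (.var x))
    (c := .seq c (.assign y (.add (.var y) (.const 1))))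
    (fun s' => ∃ k ≤ s.reg x, s'.reg y = k ∧ P k s' ∧ Frame xs as (k * (τ + 3) + 1) s s')
    (fun s' => s.reg x - s'.reg y)
    ⟨0, Nat.zero_le _, by simp, h0, by simpa using (Frame.refl xs as s).set hi 0⟩
    (fun s' _ => by simp [Tm.safe_lt h1])
    (fun s' hs' hpos => by
      obtain ⟨k, hk, hik, hP, hF⟩ := hs'
      simp only [Tm.eval_lt, Tm.eval_var, truth_pos, hF.reg x hx] at hpos
      refine (hc k (by omega) s'.tick ⟨_, hF.tick⟩ hik (ht _ _ hP)).seq ?_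
      rintro s'' ⟨hF', hP'⟩
      have hi'' : s''.reg y = k := (hF'.reg y hiy).trans hik
      refine Wp.assign (by
        simp [hi'', h1]; omega) ?_
      simp only [Tm.eval_add, Tm.eval_var, Tm.eval_const, hi'', St.tick_reg, St.set_reg_self]
      refine ⟨⟨k + 1, by omega, rfl, hP', ?_⟩, by omega⟩
      -- A round costs the body, the increment and two ticks of the loop, hence `τ + 3`. The
      -- additional `2` in the rule is the first assignment and the last test.
      have := (((hF.tick.trans (hF'.mono hys (List.Subset.refl _) le_rfl)).set hi (k + 1)).tick)
      refine this.mono (List.Subset.refl _) (List.Subset.refl _) ?_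
      rw [Nat.add_mul]; omega)
  refine hloop.mono ?_
  rintro s' ⟨s₀, ⟨k, hk, hik, hP, hF⟩, he, rfl⟩
  simp only [Tm.eval_lt, Tm.eval_var, truth_eq_zero, hF.reg x hx] at he
  obtain rfl : k = s.reg x := by omega
  exact ⟨hF.tick, ht _ _ hP⟩

end Logic

end RamWhile

/-! ### The greedy procedure -/

namespace RamWhile

open WordRAM ColGraph

/-- The program accesses the colored graph `G` by the given terms and writes its vertices by the
given command; `S` and `W` are large enough. -/
structure Access (I : Input) (S W : ℕ) (G : ColGraph) (nT : Tm) (bT eT : Tm → Tm → Tm)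
    (wC : Tm → Cmd) (enc : ℕ → List ℕ) : Prop where
  card_lt : ∀ Z, G.IsBC Z → Z.card < S
  S_lt : 8 * S < W
  n_lt : (G.n + 2) * (G.n + 2) < W
  n_safe : ∀ s, nT.Safe I S W s
  n_eval : ∀ s, nT.eval I s = G.n
  b_safe : ∀ s a b, a.Safe I S W s → b.Safe I S W s → a.eval I s < G.n → b.eval I s < G.n →
    (bT a b).Safe I S W s
  b_eval : ∀ s a b, a.eval I s < G.n → b.eval I s < G.n →
    (bT a b).eval I s = truth (G.B (a.eval I s) (b.eval I s))
  e_safe : ∀ s a b, a.Safe I S W s → b.Safe I S W s → a.eval I s < G.n → b.eval I s < G.n →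
    (eT a b).Safe I S W s
  e_eval : ∀ s a b, a.eval I s < G.n → b.eval I s < G.n →
    (eT a b).eval I s = truth (G.E (a.eval I s) (b.eval I s))
  w_exec : ∀ s e, e.Safe I S W s → e.eval I s < G.n → ∃ t ≤ 2, Exec I S W (wC e) s
    { s with cur := s.cur ++ enc (e.eval I s), time := s.time + t }

/-- An array starts with the given list. -/
def Lists (f : ℕ → ℕ) (l : List ℕ) : Prop := ∀ i y, l[i]? = some y → f i = y

lemma Lists.getElem {f : ℕ → ℕ} {l : List ℕ} (h : Lists f l) {i : ℕ} (hi : i < l.length) :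
    f i = l[i] := h i _ (List.getElem?_eq_getElem hi)

/-- The arrays `A` and `L` hold a list of vertices and levels. -/
structure Rep (s : St) (L : List (ℕ × ℕ)) : Prop where
  m : s.reg .m = L.length
  A : Lists (s.arr .A) (L.map Prod.fst)
  L : Lists (s.arr .L) (L.map Prod.snd)

lemma Rep.congr {s s' : St} {L : List (ℕ × ℕ)} (h : Rep s L) (hm : s'.reg .m = s.reg .m)
    (hA : s'.arr .A = s.arr .A) (hL : s'.arr .L = s.arr .L) : Rep s' L :=
  ⟨hm.trans h.m, hA ▸ h.A, hL ▸ h.L⟩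

lemma Rep.A_eq {s : St} {L : List (ℕ × ℕ)} (h : Rep s L) {i : ℕ} (hi : i < L.length) :
    s.arr .A i = L[i].1 := by
  rw [h.A.getElem (i := i) (by simpa), List.getElem_map]

lemma Rep.L_eq {s : St} {L : List (ℕ × ℕ)} (h : Rep s L) {i : ℕ} (hi : i < L.length) :
    s.arr .L i = L[i].2 := by
  rw [h.L.getElem (i := i) (by simpa), List.getElem_map]

section Procedures

variable {I : Input} {S W : ℕ} {G : ColGraph} {nT : Tm} {bT eT : Tm → Tm → Tm} {wC : Tm → Cmd}
  {enc : ℕ → List ℕ}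

/-- Is `u` in the array `b` of length `y`? The answer is yes if `all` is set. -/
def memC (b : Arr) (y : Var) : Cmd :=
  .seq (.assign .mem (.var .all))
    (.for .i y (.when (.eq (.get b (.var .i)) (.var .u)) (.assign .mem (.const 1))))

lemma wp_when {e : Tm} {c : Cmd} {Q : St → Prop} {s : St} (h : e.Safe I S W s)
    (hc : 0 < e.eval I s → Wp I S W c (fun s' => Q s'.tick) s.tick)
    (hd : e.eval I s = 0 → Q s.tick.tick) : Wp I S W (.when e c) Q s :=
  Wp.ite h hc fun he => Wp.skip (hd he)

lemma mem_take_succ {α : Type*} {l : List α} {k : ℕ} (hk : k < l.length) {P : α → Prop} :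
    (∀ p ∈ l.take (k + 1), P p) ↔ (∀ p ∈ l.take k, P p) ∧ P l[k] := by
  rw [← List.take_append_getElem hk]
  simp only [List.mem_append, List.mem_singleton, or_imp, forall_and, forall_eq]

lemma exists_take_succ {l : List ℕ} {k x : ℕ} (hk : k < l.length) :
    x ∈ l.take (k + 1) ↔ x ∈ l.take k ∨ l[k] = x := by
  rw [← List.take_append_getElem hk]
  simp only [List.mem_append, List.mem_singleton, eq_comm]

/-- Because `mem` starts with the value of `all`, one routine serves the greedy search in a given
set, the search in the whole graph, and the test `r ∈ X ∨ r = v` of a candidate. -/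
lemma wp_memC (h1 : 1 < W) {b : Arr} {y : Var} {s : St} {l : List ℕ} (hy : y ∉ [Var.mem, .i])
    (hl : s.reg y = l.length) (hb : Lists (s.arr b) l) (hS : l.length ≤ S) (hSW : S < W) :
    Wp I S W (memC b y) (fun s' => Frame [.mem, .i] [] (6 * S + 3) s s' ∧
      (0 < s'.reg .mem ↔ 0 < s.reg .all ∨ s.reg .u ∈ l)) s := by
  have hym : y ≠ .mem := fun h => hy (by simp [h])
  have hyi : y ≠ .i := fun h => hy (by simp [h])
  refine (wp_assign (x := .mem) (e := .var .all) trivial).seq fun s₁ ⟨F₁, h₁⟩ => ?_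
  have hl₁ : s₁.reg y = l.length := (F₁.reg y (by simpa using hym)).trans hl
  refine (Wp.for (s := s₁) h1 [.mem, .i] [.mem] [] 3
    (fun k s' => 0 < s'.reg .mem ↔ 0 < s.reg .all ∨ s.reg .u ∈ l.take k)
    (by simp) (by simp) (by simp) hy (by omega) (by simp [h₁]) ?_ (fun k s' h => h)).mono ?_
  · rintro k hk s' ⟨τ', F⟩ hik hP
    have hk' : k < l.length := by omega
    have e1 : s'.arr b k = l[k] := by
      rw [F.arr b (by simp), F₁.arr b (by simp)]; exact hb.getElem hk'
    have e2 : s'.reg .u = s.reg .u := by rw [F.reg _ (by simp), F₁.reg _ (by simp)]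
    refine wp_when (by simp [Tm.safe_eq h1, hik]; omega) (fun he => ?_) (fun he => ?_)
    · simp only [Tm.eval_eq, Tm.eval_get, Tm.eval_var, hik, e1, e2, truth_pos] at he
      refine Wp.assign (by simp [h1]) ⟨?_, ?_⟩
      · exact (((Frame.refl _ _ s').tick).set (by simp) _).tick
      · simp [exists_take_succ hk', he]
    · simp only [Tm.eval_eq, Tm.eval_get, Tm.eval_var, hik, e1, e2, truth_eq_zero] at he
      refine ⟨(((Frame.refl _ _ s').tick).tick).mono (List.Subset.refl _)
        (List.Subset.refl _) (by omega), ?_⟩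
      simp [exists_take_succ hk', he, hP]
  · rintro s' ⟨F, hP⟩
    refine ⟨((F₁.mono (by simp) (by simp) le_rfl).trans F).mono (by simp) (by simp) ?_, ?_⟩
    · rw [hl₁]; omega
    · rwa [hl₁, List.take_length] at hP

/-- Compute the level `lv` of `u` with respect to the working list, and whether `u` is adjacent to
all its vertices. -/
def levC (bT eT : Tm → Tm → Tm) : Cmd :=
  .seq (.assign .ok (.const 1)) (.seq (.assign .lv (.eq (.var .m) (.const 0)))
    (.for .i .m (.seq
      (.when (.and (bT (.var .u) (.get .A (.var .i))) (.or (.eq (.var .lv) (.const 0))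
        (.lt (.add (.get .L (.var .i)) (.const 1)) (.var .lv))))
        (.assign .lv (.add (.get .L (.var .i)) (.const 1))))
      (.assign .ok (.and (.var .ok) (eT (.var .u) (.get .A (.var .i))))))))

variable (hA : Access I S W G nT bT eT wC enc)

include hA

lemma Access.one_lt : 1 < W := by
  have := hA.n_lt
  nlinarith

lemma Access.S_le : S < W := by have := hA.S_lt; omega

lemma Access.n_lt' : G.n < W := by
  have := hA.n_lt
  nlinarith

lemma Access.length_lt {L : List (ℕ × ℕ)} (h : G.OkList L) : L.length < S :=
  h.card_vs ▸ hA.card_lt _ h.bc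

/-- The loop is the fold that defines `lvl`, run together with the adjacency test. The bound on
levels in `OkList` keeps them below the word size. -/
lemma wp_levC {s : St} {L : List (ℕ × ℕ)} (hR : Rep s L) (hL : G.OkList L)
    (hu : s.reg .u < G.n) :
    Wp I S W (levC bT eT) (fun s' => Frame [.ok, .lv, .i] [] (7 * S + 4) s s' ∧
      s'.reg .lv = G.lvl L (s.reg .u) ∧ (0 < s'.reg .ok ↔ ∀ p ∈ L, G.E (s.reg .u) p.1)) s := by
  have h1 := hA.one_lt
  have hSW := hA.S_lt
  have hlen := hA.length_lt hL
  refine (wp_assign (x := .ok) (e := .const 1) h1).seq fun s₁ ⟨F₁, h₁⟩ => ?_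
  refine (wp_assign (x := .lv) (e := .eq (.var .m) (.const 0))
    (by simp [Tm.safe_eq h1]; omega)).seq fun s₂ ⟨F₂, h₂⟩ => ?_
  have F₁₂ := (F₁.mono (ys := [.ok, .lv, .i]) (by simp) (List.Subset.refl _) le_rfl).trans
    (F₂.mono (by simp) (List.Subset.refl _) le_rfl)
  have hm₂ : s₂.reg .m = L.length := (F₁₂.reg _ (by simp)).trans hR.m
  have h₂' : s₂.reg .lv = if L = [] then 1 else 0 := by
    rw [h₂]
    simp only [Tm.eval_eq, Tm.eval_var, Tm.eval_const, F₁.reg .m (by simp), hR.m, truth,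
      List.length_eq_zero_iff]
  refine (Wp.for (s := s₂) h1 [.ok, .lv, .i] [.ok, .lv] [] 4
    (fun k s' => s'.reg .lv = (L.take k).foldl (G.lvlStep (s.reg .u)) (if L = [] then 1 else 0) ∧
      (0 < s'.reg .ok ↔ ∀ p ∈ L.take k, G.E (s.reg .u) p.1))
    (by simp) (by simp) (by simp) (by simp) (by omega) ?_ ?_ (fun k s' h => h)).mono ?_
  · simp [h₂', F₂.reg .ok, h₁]
  · rintro k hk s' ⟨τ', F⟩ hik ⟨hlv, hok⟩
    have hk' : k < L.length := by omega
    have F' := F₁₂.trans F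
    have hR' := hR.congr (F'.reg _ (by simp)) (F'.arr _ (by simp)) (F'.arr _ (by simp))
    have e1 := hR'.A_eq hk'
    have e2 := hR'.L_eq hk'
    have e3 : s'.reg .u = s.reg .u := F'.reg _ (by simp)
    have hlt : L[k].1 < G.n := hL.bc.lt _ (mem_vs.mpr ⟨L[k].2, List.getElem_mem hk'⟩)
    have hle := hL.lev k _ (List.getElem?_eq_getElem hk')
    have hkS : k < S := by omega
    have hlvW : L[k].2 + 1 < W := by omega
    have hb : (bT (.var .u) (.get .A (.var .i))).eval I s' = truth (G.B (s.reg .u) L[k].1) := by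
      rw [hA.b_eval] <;> simp [hik, e1, e3, hlt, hu]
    have hbs : (bT (.var .u) (.get .A (.var .i))).Safe I S W s' := by
      apply hA.b_safe <;> simp [hik, e1, e3, hlt, hu, hkS]
    have hfold : (L.take (k + 1)).foldl (G.lvlStep (s.reg .u)) (if L = [] then 1 else 0) =
        G.lvlStep (s.reg .u) (s'.reg .lv) L[k] := by
      rw [hlv, List.take_add_one, List.getElem?_eq_getElem hk', List.foldl_append]
      rfl
    refine Wp.seq (R := fun s'' => Frame [.ok, .lv] [] 3 s' s'' ∧ s''.reg .ok = s'.reg .ok ∧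
      s''.reg .lv = (L.take (k + 1)).foldl (G.lvlStep (s.reg .u)) (if L = [] then 1 else 0)) ?_ ?_
    · rw [hfold, lvlStep]
      refine wp_when ?_ (fun he => ?_) (fun he => ?_)
      · simp [Tm.safe_and h1, Tm.safe_or h1, Tm.safe_lt h1, Tm.safe_eq h1, hbs, hik, hkS, h1, e2,
          hlvW]
        omega
      · simp only [Tm.eval_and, Tm.eval_or, Tm.eval_eq, Tm.eval_lt, Tm.eval_add, Tm.eval_get,
          Tm.eval_var, Tm.eval_const, hik, e2, truth_pos, hb] at he
        rw [if_pos he]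
        refine Wp.assign (by simp [hik, e2, hkS, h1, hlvW]) ⟨?_, by simp, ?_⟩
        · exact (((Frame.refl _ _ s').tick).set (by simp) _).tick
        · simp [hik, e2]
      · simp only [Tm.eval_and, Tm.eval_or, Tm.eval_eq, Tm.eval_lt, Tm.eval_add, Tm.eval_get,
          Tm.eval_var, Tm.eval_const, hik, e2, truth_pos, truth_eq_zero, hb] at he
        rw [if_neg he]
        exact ⟨(((Frame.refl _ _ s').tick).tick).mono (List.Subset.refl _)
        (List.Subset.refl _) (by omega), rfl, rfl⟩
    · rintro s'' ⟨F'', hok'', hlv''⟩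
      have g1 : s''.arr .A = s'.arr .A := F''.arr _ (by simp)
      have g2 : s''.reg .i = k := (F''.reg _ (by simp)).trans hik
      have g3 : s''.reg .u = s.reg .u := (F''.reg _ (by simp)).trans e3
      have he : (eT (.var .u) (.get .A (.var .i))).eval I s'' =
          truth (G.E (s.reg .u) L[k].1) := by
        rw [hA.e_eval] <;> simp [g1, g2, e1, g3, hlt, hu]
      have hes : (eT (.var .u) (.get .A (.var .i))).Safe I S W s'' := by
        apply hA.e_safe <;> simp [g1, g2, e1, g3, hlt, hu, hkS]
      refine Wp.assign (by simp [Tm.safe_and h1, hes]) ⟨F''.set (by simp) _, ?_, ?_⟩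
      · simp [hlv'']
      · simp only [Tm.eval_and, Tm.eval_var, he, truth_pos, hok'', hok, mem_take_succ hk']
        simp
  · rintro s' ⟨F, hlv, hok⟩
    rw [hm₂, List.take_length] at hlv hok
    refine ⟨(F₁₂.trans F).mono (by simp) (by simp) ?_, hlv, hok⟩
    rw [hm₂]; omega

/-- Find the best vertex that may be appended to the working list. -/
def scanC (bT eT : Tm → Tm → Tm) : Cmd :=
  .seq (.assign .bl (.const 0)) (.seq (.assign .bu (.const 0))
    (.for .u .n (.seq (levC bT eT) (.seq (memC .U .um)
      (.when (.and (.var .mem) (.and (.and (.var .ok) (.var .lv)) (.or (.eq (.var .bl) (.const 0))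
        (.lt (.var .lv) (.var .bl)))))
        (.seq (.assign .bl (.var .lv)) (.assign .bu (.var .u))))))))

/-- The set in which the greedy procedure works. -/
def Univ (s : St) (ul : List ℕ) : Set ℕ := {x | 0 < s.reg .all ∨ x ∈ ul}

/-- A time bound for one scan. -/
def scanTime (n S : ℕ) : ℕ := n * (13 * S + 14) + 4

/-- Before the `k`-th round `bl` and `bu` hold `best` for the bound `k`. Membership in `U` is a
linear search, so a scan takes time `O(n S)` without any table indexed by vertices. -/
lemma wp_scanC {s : St} {L : List (ℕ × ℕ)} {ul : List ℕ} (hR : Rep s L) (hL : G.OkList L)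
    (hn : s.reg .n = G.n) (hum : s.reg .um = ul.length) (hU : Lists (s.arr .U) ul)
    (hS : ul.length ≤ S) :
    Wp I S W (scanC bT eT) (fun s' => Frame [.u, .ok, .lv, .i, .mem, .bl, .bu] []
      (scanTime G.n S) s s' ∧ s'.reg .bl = (G.best (Univ s ul) L G.n).1 ∧
      s'.reg .bu = (G.best (Univ s ul) L G.n).2) s := by
  have h1 := hA.one_lt
  have hSW := hA.S_le
  refine (wp_assign (x := .bl) (e := .const 0) (by simp; omega)).seq fun s₁ ⟨F₁, h₁⟩ => ?_
  refine (wp_assign (x := .bu) (e := .const 0) (by simp; omega)).seq fun s₂ ⟨F₂, h₂⟩ => ?_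
  have F₁₂ := (F₁.mono (ys := [.u, .ok, .lv, .i, .mem, .bl, .bu]) (by simp)
    (List.Subset.refl _) le_rfl).trans (F₂.mono (by simp) (List.Subset.refl _) le_rfl)
  have hn₂ : s₂.reg .n = G.n := (F₁₂.reg _ (by simp)).trans hn
  refine (Wp.for (s := s₂) h1 [.u, .ok, .lv, .i, .mem, .bl, .bu] [.ok, .lv, .i, .mem, .bl, .bu] []
    (13 * S + 11) (fun k s' => s'.reg .bl = (G.best (Univ s ul) L k).1 ∧
      s'.reg .bu = (G.best (Univ s ul) L k).2)
    (by simp) (by simp) (by simp) (by simp) (by rw [hn₂]; exact hA.n_lt') ?_ ?_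
    (fun k s' h => h)).mono ?_
  · simp [best, F₂.reg .bl, h₁, h₂]
  · rintro k hk s' ⟨τ', F⟩ huk ⟨hbl, hbu⟩
    have hkn : k < G.n := by omega
    have F' := F₁₂.trans F
    have hR' := hR.congr (F'.reg _ (by simp)) (F'.arr _ (by simp)) (F'.arr _ (by simp))
    refine (wp_levC hA hR' hL (by omega)).seq fun s₃ ⟨F₃, hlv, hok⟩ => ?_
    have F₃' := F'.trans (F₃.mono (by simp) (List.Subset.refl _) le_rfl)
    refine (wp_memC (l := ul) h1 (by simp) ((F₃'.reg _ (by simp)).trans hum)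
      (by rw [F₃'.arr _ (by simp)]; exact hU) hS hSW).seq fun s₄ ⟨F₄, hmem⟩ => ?_
    have hu₃ : s₃.reg .u = k := (F₃.reg _ (by simp)).trans huk
    have hu₄ : s₄.reg .u = k := (F₄.reg _ (by simp)).trans hu₃
    rw [F₃'.reg .all (by simp), hu₃] at hmem
    rw [huk] at hlv hok
    have hok₄ : 0 < s₄.reg .ok ↔ ∀ p ∈ L, G.E k p.1 := by rw [F₄.reg _ (by simp)]; exact hok
    have hlv₄ : s₄.reg .lv = G.lvl L k := (F₄.reg _ (by simp)).trans hlv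
    have hbl₄ : s₄.reg .bl = (G.best (Univ s ul) L k).1 := by
      rw [F₄.reg _ (by simp), F₃.reg _ (by simp), hbl]
    have hbu₄ : s₄.reg .bu = (G.best (Univ s ul) L k).2 := by
      rw [F₄.reg _ (by simp), F₃.reg _ (by simp), hbu]
    have F₃₄ := (F₃.mono (ys := [.ok, .lv, .i, .mem, .bl, .bu]) (by simp)
      (List.Subset.refl _) le_rfl).trans (F₄.mono (by simp) (List.Subset.refl _) le_rfl)
    have hcond : (0 < s₄.reg .mem ∧ (0 < s₄.reg .ok ∧ 0 < s₄.reg .lv) ∧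
        (s₄.reg .bl = 0 ∨ s₄.reg .lv < s₄.reg .bl)) ↔ (k ∈ Univ s ul ∧ G.Addable L k ∧
        ((G.best (Univ s ul) L k).1 = 0 ∨ G.lvl L k < (G.best (Univ s ul) L k).1)) := by
      rw [hmem, hok₄, hlv₄, hbl₄]
      exact ⟨fun ⟨a, ⟨b, c⟩, d⟩ => ⟨a, ⟨hkn, b, c⟩, d⟩, fun ⟨a, ⟨_, b, c⟩, d⟩ => ⟨a, ⟨b, c⟩, d⟩⟩
    refine wp_when ?_ (fun he => ?_) (fun he => ?_)
    · simp [Tm.safe_and h1, Tm.safe_or h1, Tm.safe_lt h1, Tm.safe_eq h1]; omega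
    · simp only [Tm.eval_and, Tm.eval_or, Tm.eval_eq, Tm.eval_lt, Tm.eval_var, Tm.eval_const,
        truth_pos, hcond] at he
      refine Wp.seq (Wp.assign (Q := fun s' => s' = s₄.tick.set .bl (s₄.reg .lv)) trivial rfl) ?_
      rintro _ rfl
      refine Wp.assign trivial ⟨?_, ?_⟩
      · refine ((((F₃₄.tick).set (x := .bl) (by simp) _).set (x := .bu) (by simp) _).tick).mono
          (List.Subset.refl _) (List.Subset.refl _) (by omega)
      · simp only [best, if_pos he]
        simp [hlv₄, hu₄]
    · simp only [Tm.eval_and, Tm.eval_or, Tm.eval_eq, Tm.eval_lt, Tm.eval_var, Tm.eval_const,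
        truth_pos, truth_eq_zero, hcond] at he
      refine ⟨F₃₄.tick.tick.mono (List.Subset.refl _) (List.Subset.refl _) (by omega), ?_⟩
      simp only [best, if_neg he]
      simp [hbl₄, hbu₄]
  · rintro s' ⟨F, hP⟩
    rw [hn₂] at hP
    refine ⟨(F₁₂.trans F).mono (by simp) (by simp) ?_, hP⟩
    rw [hn₂, scanTime]; ring_nf; omega

/-- Extend the working list greedily within the array `U`, or within all vertices. -/
def greedyC (bT eT : Tm → Tm → Tm) : Cmd :=
  .seq (.assign .go (.const 1)) (.loop (.var .go) (.seq (scanC bT eT)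
    (.ite (.lt (.const 0) (.var .bl))
      (.seq (.store .A (.var .m) (.var .bu)) (.seq (.store .L (.var .m) (.var .bl))
        (.assign .m (.add (.var .m) (.const 1)))))
      (.assign .go (.const 0)))))

/-- The variables that the greedy procedure changes. -/
abbrev greedyVars : List Var := [.m, .go, .u, .ok, .lv, .i, .mem, .bl, .bu]

/-- A time bound for the greedy procedure. -/
def greedyTime (n S : ℕ) : ℕ := (S + 1) * (scanTime n S + 7) + 2

omit hA in
lemma Lists.append {f g : ℕ → ℕ} {l : List ℕ} (h : Lists f l) {x : ℕ}
    (hg : ∀ k, g k = if k = l.length then x else f k) : Lists g (l ++ [x]) := by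
  intro i y hy
  rw [hg]
  rcases lt_trichotomy i l.length with hi | rfl | hi
  · rw [List.getElem?_append_left hi] at hy
    rw [if_neg (by omega), h i y hy]
  · simpa using hy
  · rw [List.getElem?_eq_none (by simp; omega)] at hy
    cases hy

/-- The program stops at the first scan that finds nothing. The list stays shorter than `S`, so
fewer than `S` scans append a vertex and one more fails; the variant `S - m + go` drops in both
cases. -/
lemma wp_greedyC {s : St} {L : List (ℕ × ℕ)} {ul : List ℕ} (hR : Rep s L) (hL : G.OkList L)
    (hn : s.reg .n = G.n) (hum : s.reg .um = ul.length) (hU : Lists (s.arr .U) ul)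
    (hS : ul.length ≤ S) :
    Wp I S W (greedyC bT eT) (fun s' => Frame greedyVars [.A, .L] (greedyTime G.n S) s s' ∧
      Rep s' (G.greedy (Univ s ul) L)) s := by
  have h1 := hA.one_lt
  have hSW := hA.S_le
  refine (wp_assign (x := .go) (e := .const 1) h1).seq fun s₁ ⟨F₁, h₁⟩ => ?_
  set τ := scanTime G.n S + 7 with hτ
  have hloop := Wp.loop (I := I) (S := S) (W := W) (s := s₁) (e := .var .go)
    (c := .seq (scanC bT eT) (.ite (.lt (.const 0) (.var .bl))
      (.seq (.store .A (.var .m) (.var .bu)) (.seq (.store .L (.var .m) (.var .bl))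
        (.assign .m (.add (.var .m) (.const 1)))))
      (.assign .go (.const 0))))
    (fun s' => ∃ t, Rep s' ((G.step (Univ s ul))^[t] L) ∧ s'.reg .go ≤ 1 ∧
      ((G.step (Univ s ul))^[t] L).length = L.length + t ∧
      (s'.reg .go = 0 → G.step (Univ s ul) ((G.step (Univ s ul))^[t] L) =
        (G.step (Univ s ul))^[t] L) ∧
      Frame greedyVars [.A, .L] ((t + (1 - s'.reg .go)) * τ + 1) s s')
    (fun s' => S - s'.reg .m + s'.reg .go) ?_ (fun _ _ => trivial) ?_
  · refine hloop.mono ?_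
    rintro s' ⟨s₀, ⟨t, hR', -, hlen, hfix, F⟩, he, rfl⟩
    rw [hL.greedy_of_fixed (hfix he)]
    have hlt := hA.length_lt (hL.iterate (Univ s ul) t)
    refine ⟨F.tick.mono (List.Subset.refl _) (List.Subset.refl _) ?_, hR'.congr rfl rfl rfl⟩
    rw [greedyTime, ← hτ]
    have : (t + (1 - s₀.reg .go)) * τ ≤ (S + 1) * τ := Nat.mul_le_mul_right _ (by omega)
    omega
  · refine ⟨0, hR.congr (F₁.reg _ (by simp)) (F₁.arr _ (by simp)) (F₁.arr _ (by simp)),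
      by simp [h₁], by simp, by simp [h₁], ?_⟩
    exact F₁.mono (by simp) (by simp) (by omega)
  · rintro s' ⟨t, hR', hgo, hlen, -, F⟩ he
    simp only [Tm.eval_var] at he
    have hgo1 : s'.reg .go = 1 := by omega
    set Lt := (G.step (Univ s ul))^[t] L with hLt
    have hLtok : G.OkList Lt := hL.iterate _ t
    have hlt := hA.length_lt hLtok
    have hUniv : Univ s'.tick ul = Univ s ul := by
      simp only [Univ, St.tick_reg, F.reg .all (by simp)]
    refine (wp_scanC hA (s := s'.tick) (ul := ul) (hR'.congr rfl rfl rfl) hLtok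
      ((F.reg _ (by simp)).trans hn) ((F.reg _ (by simp)).trans hum)
      (by rw [St.tick_arr, F.arr _ (by simp)]; exact hU) hS).seq ?_
    rintro s₂ ⟨F₂, hbl, hbu⟩
    rw [hUniv] at hbl hbu
    have F₂' := F₂.tick_left.mono (ys := greedyVars) (bs := [.A, .L]) (by simp) (by simp) le_rfl
    have hR₂ : Rep s₂ Lt := hR'.congr (F₂.reg _ (by simp)) (F₂.arr _ (by simp))
      (F₂.arr _ (by simp))
    have hgo₂ : s₂.reg .go = 1 := (F₂.reg _ (by simp)).trans hgo1
    refine Wp.ite (by simp [Tm.safe_lt h1]; omega) (fun hb => ?_) (fun hb => ?_)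
    · simp only [Tm.eval_lt, Tm.eval_const, Tm.eval_var, truth_pos, hbl] at hb
      have hstep : (G.step (Univ s ul))^[t + 1] L =
          Lt ++ [((G.best (Univ s ul) Lt G.n).2, (G.best (Univ s ul) Lt G.n).1)] := by
        rw [Function.iterate_succ_apply', ← hLt, ColGraph.step, if_pos hb]
      have hm₂ := hR₂.m
      refine (wp_store (Tm.safe_var _ _) (Tm.safe_var _ _) (by simp [hm₂, hlt])).seq fun s₃ ⟨F₃, h₃⟩ => ?_
      refine (wp_store (Tm.safe_var _ _) (Tm.safe_var _ _) (by simp [F₃.reg, hm₂, hlt])).seq fun s₄ ⟨F₄, h₄⟩ => ?_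
      simp only [Tm.eval_var, St.tick_reg, St.tick_arr, hm₂, hbu] at h₃
      simp only [Tm.eval_var, F₃.reg _ (List.not_mem_nil), St.tick_reg, hm₂, hbl,
        F₃.arr .L (by simp), St.tick_arr] at h₄
      have hm₄ : s₄.reg .m = Lt.length := by
        rw [F₄.reg _ (by simp), F₃.reg _ (by simp)]; exact hm₂
      refine Wp.assign (by simp [hm₄, h1]; omega) ?_
      have F₅ := (((F.trans F₂').tick.trans ((F₃.mono (by simp) (by simp) le_rfl).trans
        (F₄.mono (by simp) (by simp) le_rfl))).set (x := .m) (by simp)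
        ((Tm.add (.var .m) (.const 1)).eval I s₄)).tick.tick
      have hgo₅ : s₄.reg .go = 1 := by
        rw [F₄.reg _ (by simp), F₃.reg _ (by simp)]; exact hgo₂
      refine ⟨⟨t + 1, ?_, ?_, ?_, ?_, ?_⟩, ?_⟩
      · rw [hstep]
        refine ⟨by simp [hm₄], ?_, ?_⟩
        · simp only [List.map_append, List.map_cons, List.map_nil, St.tick_arr, St.set_arr,
            F₄.arr .A (by simp)]
          exact hR₂.A.append (by simpa using h₃)
        · simp only [List.map_append, List.map_cons, List.map_nil, St.tick_arr, St.set_arr]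
          exact hR₂.L.append (by simpa using h₄)
      · simp [hgo₅]
      · rw [hstep, List.length_append, hlen]; simp; omega
      · simp [hgo₅]
      · refine F₅.mono (List.Subset.refl _) (List.Subset.refl _) ?_
        simp only [hgo1, St.tick_reg, St.set_reg_ne _ _ (show Var.go ≠ .m by simp), hgo₅]
        simp only [Nat.sub_self, add_zero, Nat.add_mul, hτ]
        omega
      · simp only [St.tick_reg, St.set_reg_self, St.set_reg_ne _ _ (show Var.go ≠ .m by simp), hgo₅,
          Tm.eval_add, Tm.eval_var, Tm.eval_const, hm₄, hR'.m, hgo1]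
        omega
    · simp only [Tm.eval_lt, Tm.eval_const, Tm.eval_var, truth_eq_zero, hbl] at hb
      refine Wp.assign (by simp; omega) ?_
      refine ⟨⟨t, hR₂.congr (by simp) rfl rfl, by simp, hlen, fun _ => ?_, ?_⟩, ?_⟩
      · rw [ColGraph.step, if_neg hb]
      · refine (((F.trans F₂').tick.set (x := .go) (by simp) 0).tick.tick).mono
          (List.Subset.refl _) (List.Subset.refl _) ?_
        simp only [hgo1, St.tick_reg, St.set_reg_self, Nat.sub_self, add_zero, Nat.sub_zero,
          Tm.eval_const, Nat.add_mul, hτ]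
        omega
      · simp [hR₂.m, hR'.m, hgo1]

end Procedures

end RamWhile

/-! ### The procedure that computes the parent -/

namespace RamWhile

open WordRAM ColGraph

section Procedures

variable {I : Input} {S W : ℕ} {G : ColGraph} {nT : Tm} {bT eT : Tm → Tm → Tm} {wC : Tm → Cmd}
  {enc : ℕ → List ℕ}

/-- Copy the first `x` entries of the array `a` to the array `b`. -/
def copyC (a b : Arr) (x : Var) : Cmd := .for .i x (.store b (.var .i) (.get a (.var .i)))

lemma Lists.take {f : ℕ → ℕ} {l : List ℕ} (h : Lists f l) (k : ℕ) : Lists f (l.take k) := by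
  intro i y hy
  rw [List.getElem?_take] at hy
  split_ifs at hy
  exact h i y hy

lemma wp_copyC (h1 : 1 < W) {a b : Arr} {x : Var} {s : St} {l : List ℕ} {k : ℕ} (hx : x ≠ .i)
    (hab : a ≠ b) (hk : s.reg x = k) (ha : Lists (s.arr a) l) (hl : k ≤ l.length) (hS : k ≤ S)
    (hSW : S < W) :
    Wp I S W (copyC a b x) (fun s' => Frame [.i] [b] (4 * S + 2) s s' ∧
      Lists (s'.arr b) (l.take k)) s := by
  refine (Wp.for (s := s) h1 [.i] [] [b] 1 (fun k s' => Lists (s'.arr b) (l.take k))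
    (by simp) (by simp) (by simp) (by simpa using hx) (by omega) ?_ ?_ (fun k s' h => h)).mono ?_
  · intro i y hy; simp at hy
  · rintro i hi s' ⟨τ', F⟩ hik hP
    have hil : i < l.length := by omega
    have e1 : s'.arr a i = l[i] := by
      rw [F.arr a (by simpa using hab)]; exact ha.getElem hil
    refine (wp_store (Tm.safe_var _ _) (by simp [hik]; omega) (by simp [hik]; omega)).mono ?_
    rintro s'' ⟨F', h'⟩
    simp only [Tm.eval_var, Tm.eval_get, hik, e1] at h'
    refine ⟨F', ?_⟩
    have := hP.append (x := l[i]) (g := s''.arr b) (by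
      intro k; rw [h', List.length_take, min_eq_left (by omega)])
    rwa [List.take_append_getElem hil] at this
  · rintro s' ⟨F, hP⟩
    rw [hk] at hP F
    exact ⟨F.mono (List.Subset.refl _) (List.Subset.refl _) (by omega), hP⟩

/-- Is the array `a` of length `x` contained in the array `b` of length `y`? -/
def subsetC (a : Arr) (x : Var) (b : Arr) (y : Var) : Cmd :=
  .seq (.assign .all (.const 0)) (.seq (.assign .sub (.const 1))
    (.for .i2 x (.seq (.assign .u (.get a (.var .i2))) (.seq (memC b y)
      (.when (.eq (.var .mem) (.const 0)) (.assign .sub (.const 0)))))))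

lemma wp_subsetC (h1 : 1 < W) {a b : Arr} {x y : Var} {s : St} {l l' : List ℕ}
    (hx : x ∉ [Var.all, .sub, .i2, .u, .mem, .i]) (hy : y ∉ [Var.all, .sub, .i2, .u, .mem, .i])
    (hxl : s.reg x = l.length) (hyl : s.reg y = l'.length) (ha : Lists (s.arr a) l)
    (hb : Lists (s.arr b) l') (hS : l.length ≤ S) (hS' : l'.length ≤ S) (hSW : S < W) :
    Wp I S W (subsetC a x b y) (fun s' => Frame [.all, .sub, .i2, .u, .mem, .i] []
      (S * (6 * S + 10) + 4) s s' ∧ (0 < s'.reg .sub ↔ ∀ z ∈ l, z ∈ l')) s := by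
  refine (wp_assign (x := .all) (e := .const 0) (by simp; omega)).seq fun s₁ ⟨F₁, h₁⟩ => ?_
  refine (wp_assign (x := .sub) (e := .const 1) h1).seq fun s₂ ⟨F₂, h₂⟩ => ?_
  have F₁₂ := (F₁.mono (ys := [.all, .sub, .i2, .u, .mem, .i]) (by simp)
    (List.Subset.refl _) le_rfl).trans (F₂.mono (by simp) (List.Subset.refl _) le_rfl)
  have hx₂ : s₂.reg x = l.length := (F₁₂.reg _ hx).trans hxl
  have hall : s₂.reg .all = 0 := (F₂.reg _ (by simp)).trans h₁
  refine (Wp.for (s := s₂) h1 [.sub, .i2, .u, .mem, .i] [.sub, .u, .mem, .i] []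
    (6 * S + 7) (fun k s' => 0 < s'.reg .sub ↔ ∀ z ∈ l.take k, z ∈ l')
    (by simp) (by simp) (by simp) (fun h => hx (List.mem_cons_of_mem _ h)) (by omega) ?_ ?_
    (fun k s' h => h)).mono ?_
  · simp [h₂]
  · rintro k hk s' ⟨τ', F⟩ hik hP
    have hkl : k < l.length := by omega
    have e1 : s'.arr a k = l[k] := by
      rw [F.arr a (by simp), F₁₂.arr a (by simp)]; exact ha.getElem hkl
    refine (wp_assign (x := .u) (by simp [hik]; omega)).seq fun s₃ ⟨F₃, h₃⟩ => ?_
    simp only [Tm.eval_get, Tm.eval_var, hik, e1] at h₃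
    have hy₃ : s₃.reg y = l'.length := by
      rw [F₃.reg _ (fun h => hy (by simp at h; simp [h])),
        F.reg _ (fun h => hy (List.mem_cons_of_mem _ h)), F₁₂.reg _ hy, hyl]
    have hall₃ : s₃.reg .all = 0 := by rw [F₃.reg _ (by simp), F.reg _ (by simp), hall]
    refine (wp_memC (l := l') h1 (fun h => hy (by simp at h; rcases h with h | h <;> simp [h])) hy₃
      (by rw [F₃.arr b (by simp), F.arr b (by simp), F₁₂.arr b (by simp)]; exact hb) hS'
      hSW).seq fun s₄ ⟨F₄, hmem⟩ => ?_
    rw [hall₃, h₃] at hmem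
    simp only [lt_irrefl, false_or] at hmem
    have F₃₄ := (F₃.mono (ys := [.sub, .u, .mem, .i]) (by simp) (List.Subset.refl _) le_rfl).trans
      (F₄.mono (by simp) (List.Subset.refl _) le_rfl)
    have hsub : s₄.reg .sub = s'.reg .sub := by rw [F₄.reg _ (by simp), F₃.reg _ (by simp)]
    refine wp_when (by simp [Tm.safe_eq h1]; omega) (fun he => ?_) (fun he => ?_)
    · simp only [Tm.eval_eq, Tm.eval_var, Tm.eval_const, truth_pos] at he
      have : l[k] ∉ l' := fun h => by have := hmem.mpr h; omega
      refine Wp.assign (by simp; omega) ⟨?_, ?_⟩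
      · exact ((F₃₄.tick.set (by simp) _).tick).mono (List.Subset.refl _) (List.Subset.refl _)
          (by omega)
      · simp [mem_take_succ hkl, this]
    · simp only [Tm.eval_eq, Tm.eval_var, Tm.eval_const, truth_eq_zero] at he
      have : l[k] ∈ l' := hmem.mp (Nat.pos_of_ne_zero he)
      refine ⟨F₃₄.tick.tick.mono (List.Subset.refl _) (List.Subset.refl _) (by omega), ?_⟩
      simp [mem_take_succ hkl, this, hsub, hP]
  · rintro s' ⟨F, hP⟩
    rw [hx₂, List.take_length] at hP
    refine ⟨(F₁₂.trans (F.mono (by simp) (List.Subset.refl _) le_rfl)).mono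
      (List.Subset.refl _) (List.Subset.refl _) ?_, hP⟩
    rw [hx₂]
    have : l.length * (6 * S + 7 + 3) ≤ S * (6 * S + 10) := Nat.mul_le_mul hS le_rfl
    omega

/-- Try whether the prefix of length `j` of the order is completed to the set in `U`; if not, store
its completion in `P` and go on. -/
def parentBody (bT eT : Tm → Tm → Tm) : Cmd :=
  .seq (copyC .O .A .j) (.seq (copyC .OL .L .j) (.seq (.assign .m (.var .j))
    (.seq (.assign .all (.const 1)) (.seq (greedyC bT eT) (.seq (subsetC .A .m .U .um)
      (.ite (.var .sub) (.assign .go2 (.const 0)) (.seq (copyC .A .P .m)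
        (.seq (.assign .pm (.var .m)) (.assign .j (.add (.var .j) (.const 1)))))))))))

/-- Compute the order and the parent of the set in the array `U`. -/
def parentC (bT eT : Tm → Tm → Tm) : Cmd :=
  .seq (.assign .all (.const 0)) (.seq (.assign .m (.const 0)) (.seq (greedyC bT eT)
    (.seq (.assign .om (.var .m)) (.seq (copyC .A .O .om) (.seq (copyC .L .OL .om)
      (.seq (.assign .j (.const 0)) (.seq (.assign .go2 (.const 1))
        (.loop (.var .go2) (parentBody bT eT)))))))))

/-- The variables that the computation of the parent changes. -/
abbrev parentVars : List Var :=
  [.m, .go, .u, .ok, .lv, .i, .mem, .bl, .bu, .all, .om, .j, .go2, .sub, .i2, .pm]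

/-- The arrays that the computation of the parent changes. -/
abbrev parentArrs : List Arr := [.A, .L, .O, .OL, .P]

/-- A time bound for one round of the computation of the parent. -/
def parentRound (n S : ℕ) : ℕ := greedyTime n S + S * (6 * S + 10) + 12 * S + 20

/-- A time bound for the computation of the parent. -/
def parentTime (n S : ℕ) : ℕ := greedyTime n S + 8 * S + 20 + (S + 1) * parentRound n S

lemma univ_all {s : St} (h : 0 < s.reg .all) (ul : List ℕ) : Univ s ul = Set.univ := by
  ext; simp [Univ, h]

lemma univ_list {s : St} (h : s.reg .all = 0) (ul : List ℕ) :
    Univ s ul = (ul.toFinset : Set ℕ) := by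
  ext; simp [Univ, h]

/-- The loop invariant of the computation of the parent of `Y`. -/
structure ParentInv (G : ColGraph) (Y : Finset ℕ) (s : St) : Prop where
  go2 : s.reg .go2 ≤ 1
  le : s.reg .j ≤ G.parLen Y
  done : s.reg .go2 = 0 → s.reg .j = G.parLen Y
  O : Lists (s.arr .O) ((G.ord Y).map Prod.fst)
  OL : Lists (s.arr .OL) ((G.ord Y).map Prod.snd)
  om : s.reg .om = (G.ord Y).length
  P : s.reg .j ≠ 0 → s.reg .pm = (G.complete ((G.ord Y).take (s.reg .j - 1))).length ∧
    Lists (s.arr .P) ((G.complete ((G.ord Y).take (s.reg .j - 1))).map Prod.fst)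

variable (hA : Access I S W G nT bT eT wC enc)

include hA

/-- Equality with `Y` is tested by inclusion alone, as both sets are maximal. The array `P` keeps
the completion of the prefix of length `j - 1`, which is the parent when the search ends. The last
conjunct says that `j` advances exactly if the loop goes on. -/
lemma wp_parentBody {s : St} {ul : List ℕ} (hn : s.reg .n = G.n) (hum : s.reg .um = ul.length)
    (hU : Lists (s.arr .U) ul) (hS : ul.length ≤ S) (hY : G.MaxBC ul.toFinset)
    (hI : ParentInv G ul.toFinset s) (hgo : s.reg .go2 = 1) :
    Wp I S W (parentBody bT eT) (fun s' => ParentInv G ul.toFinset s' ∧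
      Frame parentVars parentArrs (parentRound G.n S - 3) s s' ∧
      s'.reg .j + 1 = s.reg .j + 1 + s'.reg .go2) s := by
  have h1 := hA.one_lt
  have hSW := hA.S_le
  have hordS := hA.length_lt (okList_ord (G := G) ul.toFinset)
  set Y := ul.toFinset with hYdef
  set jj := s.reg .j with hjj
  have hjo : jj ≤ (G.ord Y).length := hI.le.trans hY.parLen_le
  refine (wp_copyC (k := jj) h1 (by simp) (by simp) hjj.symm hI.O (by simpa) (by omega) hSW).seq
    fun s₁ ⟨F₁, h₁⟩ => ?_
  refine (wp_copyC (k := jj) (l := (G.ord Y).map Prod.snd) h1 (by simp) (by simp)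
    (F₁.reg _ (by simp)) (by rw [F₁.arr _ (by simp)]; exact hI.OL) (by simpa) (by omega) hSW).seq
    fun s₂ ⟨F₂, h₂⟩ => ?_
  refine (wp_assign (x := .m) (e := .var .j) trivial).seq fun s₃ ⟨F₃, h₃⟩ => ?_
  refine (wp_assign (x := .all) (e := .const 1) h1).seq fun s₄ ⟨F₄, h₄⟩ => ?_
  have F₁₄ := (((F₁.mono (ys := parentVars) (bs := parentArrs) (by simp) (by simp) le_rfl).trans
    (F₂.mono (by simp) (by simp) le_rfl)).trans (F₃.mono (by simp) (by simp) le_rfl)).trans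
    (F₄.mono (by simp) (by simp) le_rfl)
  have hR : Rep s₄ ((G.ord Y).take jj) := by
    refine ⟨?_, ?_, ?_⟩
    · rw [F₄.reg _ (by simp), h₃, Tm.eval_var, F₂.reg _ (by simp), F₁.reg _ (by simp),
        List.length_take, min_eq_left hjo]
    · rw [F₄.arr _ (by simp), F₃.arr _ (by simp), F₂.arr _ (by simp), List.map_take]
      exact h₁
    · rw [F₄.arr _ (by simp), F₃.arr _ (by simp), List.map_take]
      exact h₂
  have hum₄ : s₄.reg .um = ul.length := (F₁₄.reg _ (by simp)).trans hum
  have hU₄ : Lists (s₄.arr .U) ul := by rw [F₁₄.arr _ (by simp)]; exact hU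
  have hok := okList_take_ord (G := G) Y jj
  refine (wp_greedyC hA hR hok ((F₁₄.reg _ (by simp)).trans hn) hum₄ hU₄ hS).seq
    fun s₅ ⟨F₅, hR₅⟩ => ?_
  rw [univ_all (by rw [h₄]; simp)] at hR₅
  change Rep s₅ (G.complete ((G.ord Y).take jj)) at hR₅
  have F₁₅ := F₁₄.trans (F₅.mono (ys := parentVars) (bs := parentArrs) (by simp) (by simp) le_rfl)
  have hlen := hA.length_lt hok.complete
  refine (wp_subsetC (l := (G.complete ((G.ord Y).take jj)).map Prod.fst) (l' := ul) h1 (by simp)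
    (by simp) (by rw [hR₅.m, List.length_map]) ((F₁₅.reg _ (by simp)).trans hum) hR₅.A
    (by rw [F₁₅.arr _ (by simp)]; exact hU) (by rw [List.length_map]; omega) hS hSW).seq
    fun s₆ ⟨F₆, h₆⟩ => ?_
  have F₁₆ := F₁₅.trans (F₆.mono (ys := parentVars) (bs := parentArrs) (by simp) (by simp) le_rfl)
  have hsub : (∀ z ∈ (G.complete ((G.ord Y).take jj)).map Prod.fst, z ∈ ul) ↔
      vs (G.complete ((G.ord Y).take jj)) = Y := by
    constructor
    · intro h
      exact hok.maxBC_complete.2 Y hY.1 fun z hz =>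
        List.mem_toFinset.mpr (h z (List.mem_toFinset.mp hz))
    · intro h z hz
      rw [← List.mem_toFinset, ← hYdef, ← h]
      exact List.mem_toFinset.mpr hz
  rw [hsub] at h₆
  have hO₆ : s₆.arr .O = s.arr .O := by
    rw [F₆.arr _ (by simp), F₅.arr _ (by simp), F₄.arr _ (by simp), F₃.arr _ (by simp),
      F₂.arr _ (by simp), F₁.arr _ (by simp)]
  have hOL₆ : s₆.arr .OL = s.arr .OL := by
    rw [F₆.arr _ (by simp), F₅.arr _ (by simp), F₄.arr _ (by simp), F₃.arr _ (by simp),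
      F₂.arr _ (by simp), F₁.arr _ (by simp)]
  have hP₆ : s₆.arr .P = s.arr .P := by
    rw [F₆.arr _ (by simp), F₅.arr _ (by simp), F₄.arr _ (by simp), F₃.arr _ (by simp),
      F₂.arr _ (by simp), F₁.arr _ (by simp)]
  have hreg₆ : ∀ x ∈ [Var.om, .j, .go2, .pm], s₆.reg x = s.reg x := by
    intro x hx
    rw [F₆.reg _ (fun h => by fin_cases h; all_goals simp at hx),
      F₅.reg _ (fun h => by fin_cases h; all_goals simp at hx),
      F₄.reg _ (fun h => by fin_cases h; all_goals simp at hx),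
      F₃.reg _ (fun h => by fin_cases h; all_goals simp at hx),
      F₂.reg _ (fun h => by fin_cases h; all_goals simp at hx),
      F₁.reg _ (fun h => by fin_cases h; all_goals simp at hx)]
  have hj₆ := hreg₆ .j (by simp)
  have hgo₆ := hreg₆ .go2 (by simp)
  have hom₆ := hreg₆ .om (by simp)
  have hpm₆ := hreg₆ .pm (by simp)
  refine Wp.ite trivial (fun he => ?_) (fun he => ?_)
  · have hj : jj = G.parLen Y := le_antisymm hI.le (Nat.sInf_le (h₆.mp he))
    refine Wp.assign (by simp; omega) ⟨⟨by simp, ?_, ?_, ?_, ?_, ?_, ?_⟩, ?_, ?_⟩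
    · simpa [hj₆] using hI.le
    · simpa [hj₆] using hj
    · simpa [hO₆] using hI.O
    · simpa [hOL₆] using hI.OL
    · simpa [hom₆] using hI.om
    · simpa [hj₆, hpm₆, hP₆] using hI.P
    · refine (((F₁₆.tick.set (x := .go2) (by simp) _).tick)).mono (List.Subset.refl _)
        (List.Subset.refl _) ?_
      rw [parentRound]; omega
    · simp [hj₆, hjj]
  · have hne : jj ≠ G.parLen Y := fun h => by
      have := h₆.mpr (h ▸ hY.parLen_mem)
      simp only [Tm.eval_var] at he
      omega
    have hlt : jj < G.parLen Y := lt_of_le_of_ne hI.le hne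
    have hm₆ : s₆.reg .m = (G.complete ((G.ord Y).take jj)).length :=
      (F₆.reg _ (by simp)).trans hR₅.m
    refine (wp_copyC (s := s₆.tick) (l := (G.complete ((G.ord Y).take jj)).map Prod.fst)
      (k := (G.complete ((G.ord Y).take jj)).length) h1 (by simp) (by simp) hm₆
      (by rw [St.tick_arr, F₆.arr _ (by simp)]; exact hR₅.A) (by simp) (by omega) hSW).seq
      fun s₇ ⟨F₇, h₇⟩ => ?_
    rw [List.take_of_length_le (by simp)] at h₇
    refine (wp_assign (x := .pm) (e := .var .m) trivial).seq fun s₈ ⟨F₈, h₈⟩ => ?_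
    simp only [Tm.eval_var, F₇.reg .m (by simp), St.tick_reg, hm₆] at h₈
    have hj₈ : s₈.reg .j = jj := by
      rw [F₈.reg _ (by simp), F₇.reg _ (by simp)]; exact hj₆
    have hgo₈ : s₈.reg .go2 = 1 := by
      rw [F₈.reg _ (by simp), F₇.reg _ (by simp)]; exact hgo₆.trans hgo
    have hom₈ : s₈.reg .om = s.reg .om := by
      rw [F₈.reg _ (by simp), F₇.reg _ (by simp)]; exact hom₆
    refine Wp.assign (by simp [h1, hj₈]; omega) ⟨⟨?_, ?_, ?_, ?_, ?_, ?_, ?_⟩, ?_, ?_⟩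
    · simp [hgo₈]
    · simpa [hj₈] using hlt
    · simp [hgo₈]
    · simp only [St.tick_arr, St.set_arr, F₈.arr .O (by simp), F₇.arr .O (by simp), hO₆]
      exact hI.O
    · simp only [St.tick_arr, St.set_arr, F₈.arr .OL (by simp), F₇.arr .OL (by simp), hOL₆]
      exact hI.OL
    · simp [hom₈, hI.om]
    · simp only [St.tick_arr, St.tick_reg, St.set_arr, St.set_reg_self, Tm.eval_add, Tm.eval_var,
        Tm.eval_const, hj₈, Nat.add_sub_cancel, F₈.arr .P (by simp)]
      intro _
      rw [St.set_reg_ne _ _ (by simp), h₈]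
      exact ⟨rfl, h₇⟩
    · refine ((((F₁₆.tick.trans (F₇.mono (by simp) (by simp) le_rfl)).trans
        (F₈.mono (by simp) (by simp) le_rfl)).set (x := .j) (by simp) _).tick).mono
        (List.Subset.refl _) (List.Subset.refl _) ?_
      rw [parentRound]; omega
    · simp [hj₈, hgo₈]

/-- Prefix lengths are tried from `0` upwards, so the first success is the infimum `parLen`; as the
order has fewer than `S` entries, at most `S` of them are tried. -/
lemma wp_parentC {s : St} {ul : List ℕ} (hn : s.reg .n = G.n) (hum : s.reg .um = ul.length)
    (hU : Lists (s.arr .U) ul) (hS : ul.length ≤ S) (hY : G.MaxBC ul.toFinset) :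
    Wp I S W (parentC bT eT) (fun s' => Frame parentVars parentArrs (parentTime G.n S) s s' ∧
      s'.reg .j = G.parLen ul.toFinset ∧
      Lists (s'.arr .O) ((G.ord ul.toFinset).map Prod.fst) ∧
      (G.parLen ul.toFinset ≠ 0 → ∃ pl : List ℕ, pl.Nodup ∧ pl.toFinset = G.parent ul.toFinset ∧
        s'.reg .pm = pl.length ∧ Lists (s'.arr .P) pl)) s := by
  have h1 := hA.one_lt
  have hSW := hA.S_le
  set Y := ul.toFinset with hYdef
  have hordS := hA.length_lt (okList_ord (G := G) Y)
  refine (wp_assign (x := .all) (e := .const 0) (by simp; omega)).seq fun s₁ ⟨F₁, h₁⟩ => ?_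
  refine (wp_assign (x := .m) (e := .const 0) (by simp; omega)).seq fun s₂ ⟨F₂, h₂⟩ => ?_
  have F₁₂ := (F₁.mono (ys := parentVars) (bs := parentArrs) (by simp) (by simp) le_rfl).trans
    (F₂.mono (by simp) (by simp) le_rfl)
  refine (wp_greedyC hA (s := s₂) (L := []) ⟨h₂, by intro i y hy; simp at hy,
    by intro i y hy; simp at hy⟩ okList_nil ((F₁₂.reg _ (by simp)).trans hn)
    ((F₁₂.reg _ (by simp)).trans hum) (by rw [F₁₂.arr _ (by simp)]; exact hU) hS).seq
    fun s₃ ⟨F₃, hR₃⟩ => ?_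
  rw [univ_list (by rw [F₂.reg _ (by simp), h₁]; rfl)] at hR₃
  change Rep s₃ (G.ord Y) at hR₃
  refine (wp_assign (x := .om) (e := .var .m) trivial).seq fun s₄ ⟨F₄, h₄⟩ => ?_
  simp only [Tm.eval_var, hR₃.m] at h₄
  refine (wp_copyC (k := (G.ord Y).length) (l := (G.ord Y).map Prod.fst) h1 (by simp) (by simp) h₄
    (by rw [F₄.arr _ (by simp)]; exact hR₃.A) (by simp) (by omega) hSW).seq fun s₅ ⟨F₅, h₅⟩ => ?_
  refine (wp_copyC (k := (G.ord Y).length) (l := (G.ord Y).map Prod.snd) h1 (by simp) (by simp)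
    ((F₅.reg _ (by simp)).trans h₄) (by rw [F₅.arr _ (by simp), F₄.arr _ (by simp)]; exact hR₃.L)
    (by simp) (by omega) hSW).seq fun s₆ ⟨F₆, h₆⟩ => ?_
  rw [List.take_of_length_le (by simp)] at h₅ h₆
  refine (wp_assign (x := .j) (e := .const 0) (by simp; omega)).seq fun s₇ ⟨F₇, h₇⟩ => ?_
  refine (wp_assign (x := .go2) (e := .const 1) h1).seq fun s₈ ⟨F₈, h₈⟩ => ?_
  have F₀₈ := (((((F₁₂.trans (F₃.mono (by simp) (by simp) le_rfl)).trans
    (F₄.mono (by simp) (by simp) le_rfl)).trans (F₅.mono (by simp) (by simp) le_rfl)).trans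
    (F₆.mono (by simp) (by simp) le_rfl)).trans (F₇.mono (by simp) (by simp) le_rfl)).trans
    (F₈.mono (by simp) (by simp) le_rfl)
  have hj₈ : s₈.reg .j = 0 := (F₈.reg _ (by simp)).trans h₇
  have hI₈ : ParentInv G Y s₈ := by
    refine ⟨h₈.le, by omega, fun h => by rw [h₈] at h; simp at h, ?_, ?_, ?_, fun h => absurd hj₈ h⟩
    · rw [F₈.arr _ (by simp), F₇.arr _ (by simp), F₆.arr _ (by simp)]; exact h₅
    · rw [F₈.arr _ (by simp), F₇.arr _ (by simp)]; exact h₆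
    · rw [F₈.reg _ (by simp), F₇.reg _ (by simp), F₆.reg _ (by simp), F₅.reg _ (by simp), h₄]
  have hloop := Wp.loop (I := I) (S := S) (W := W) (s := s₈) (e := .var .go2)
    (c := parentBody bT eT)
    (fun s' => ParentInv G Y s' ∧
      Frame parentVars parentArrs ((s'.reg .j + (1 - s'.reg .go2)) * parentRound G.n S) s₈ s')
    -- Either `j` comes closer to `parLen Y`, or `go2` falls to `0`.
    (fun s' => G.parLen Y - s'.reg .j + s'.reg .go2) ?_ (fun _ _ => trivial) ?_
  · refine hloop.mono ?_
    rintro s' ⟨s₀, ⟨hI, F⟩, he, rfl⟩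
    have hj := hI.done he
    have hle := hY.parLen_le
    refine ⟨(F₀₈.trans F.tick).mono (List.Subset.refl _) (List.Subset.refl _) ?_, hj, hI.O, ?_⟩
    · have : (s₀.reg .j + (1 - s₀.reg .go2)) * parentRound G.n S ≤ (S + 1) * parentRound G.n S :=
        Nat.mul_le_mul_right _ (by omega)
      rw [parentTime]; omega
    · intro h0
      have hP := hI.P (hj ▸ h0)
      rw [hj] at hP
      have hok := (okList_take_ord (G := G) Y (G.parLen Y - 1)).complete
      exact ⟨_, hok.nodup, rfl, by simpa using hP.1, hP.2⟩
  · refine ⟨hI₈, ?_⟩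
    exact (Frame.refl _ _ _).mono (List.Subset.refl _) (List.Subset.refl _) (by omega)
  · rintro s' ⟨hI, F⟩ he
    simp only [Tm.eval_var] at he
    have hgo : s'.reg .go2 = 1 := by have := hI.go2; omega
    have F' := F₀₈.trans F
    refine (wp_parentBody hA (s := s'.tick) (ul := ul) ((F'.reg _ (by simp)).trans hn)
      ((F'.reg _ (by simp)).trans hum) (by rw [St.tick_arr, F'.arr _ (by simp)]; exact hU) hS hY
      ⟨hI.go2, hI.le, hI.done, hI.O, hI.OL, hI.om, hI.P⟩ hgo).mono ?_
    rintro s'' ⟨hI'', F'', hj''⟩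
    simp only [St.tick_reg] at hj''
    have hle : s''.reg .j ≤ G.parLen Y := hI''.le
    have hgo'' := hI''.go2
    refine ⟨⟨⟨hI''.go2, hI''.le, hI''.done, hI''.O, hI''.OL, hI''.om, hI''.P⟩, ?_⟩, ?_⟩
    · refine (F.trans F''.tick_left).tick.mono (List.Subset.refl _) (List.Subset.refl _) ?_
      simp only [St.tick_reg]
      rw [show s''.reg .j + (1 - s''.reg .go2) = s'.reg .j + (1 - s'.reg .go2) + 1 by omega,
        Nat.add_mul _ 1, one_mul]
      have : 3 ≤ parentRound G.n S := by rw [parentRound]; omega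
      omega
    · simp only [St.tick_reg]
      rcases Nat.lt_or_ge 0 (s''.reg .go2) with h | h
      · omega
      · omega

end Procedures

end RamWhile

/-! ### The procedure that tests a candidate for a child -/

namespace RamWhile

open WordRAM ColGraph

section Procedures

variable {I : Input} {S W : ℕ} {G : ColGraph} {nT : Tm} {bT eT : Tm → Tm → Tm} {wC : Tm → Cmd}
  {enc : ℕ → List ℕ}

/-- The variables that the test of a candidate changes. -/
abbrev candVars : List Var :=
  [.m, .go, .u, .ok, .lv, .i, .mem, .bl, .bu, .all, .om, .j, .go2, .sub, .i2, .pm, .um, .v, .r,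
    .child, .pos]

/-- The arrays that the test of a candidate changes. -/
abbrev candArrs : List Arr := [.A, .L, .O, .OL, .P, .U]

/-- Collect `v` and its neighbours in the array `X` in the array `U`. -/
def neighC (eT : Tm → Tm → Tm) : Cmd :=
  .seq (.store .U (.const 0) (.var .v)) (.seq (.assign .um (.const 1))
    (.for .i2 .xm (.when (eT (.var .v) (.get .X (.var .i2)))
      (.seq (.store .U (.var .um) (.get .X (.var .i2)))
        (.assign .um (.add (.var .um) (.const 1)))))))

/-- Find the position of `v` in the array `A`, counted from `1`. -/
def posC : Cmd :=
  .seq (.assign .pos (.const 0)) (.for .i .m (.when (.eq (.get .A (.var .i)) (.var .v))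
    (.assign .pos (.add (.var .i) (.const 1)))))

/-- Test whether the set in `U`, whose order and parent are known, is a child of the set in `X` with
vertex `v` and root `r`. -/
def testC : Cmd :=
  .when (.lt (.const 0) (.var .j))
    (.when (.and (.eq (.get .O (.sub (.var .j) (.const 1))) (.var .v))
        (.eq (.get .O (.const 0)) (.var .r)))
      (.seq (subsetC .P .pm .X .xm) (.assign .child (.var .sub))))

/-- Build the candidate for a child of the set in `X` with vertex `v` and root `r`, and test it. -/
def heavyC (bT eT : Tm → Tm → Tm) : Cmd :=
  .seq (neighC eT) (.seq (.store .A (.const 0) (.var .r)) (.seq (.store .L (.const 0) (.const 1))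
    (.seq (.assign .m (.const 1)) (.seq (.assign .all (.const 0)) (.seq (greedyC bT eT)
      (.seq posC (.when (.var .pos) (.seq (.assign .m (.var .pos))
        (.seq (.assign .all (.const 1)) (.seq (greedyC bT eT) (.seq (.assign .um (.var .m))
          (.seq (copyC .A .U .m) (.seq (parentC bT eT) testC)))))))))))))

/-- Test the candidate with number `k` for a child of the set in `X`. -/
def candC (bT eT : Tm → Tm → Tm) : Cmd :=
  .seq (.assign .v (.div (.var .k) (.var .n)))
    (.seq (.assign .r (.sub (.var .k) (.mul (.var .v) (.var .n))))
      (.seq (.assign .u (.var .r)) (.seq (.assign .all (.eq (.var .r) (.var .v)))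
        (.seq (memC .X .xm) (.seq (.assign .child (.const 0))
          (.when (.var .mem) (heavyC bT eT)))))))

/-- A time bound for the test of a candidate whose root is neither in the set nor its vertex. -/
def lightTime (S : ℕ) : ℕ := 6 * S + 10

/-- A time bound for building and testing a candidate. -/
def heavyTime (n S : ℕ) : ℕ :=
  2 * greedyTime n S + parentTime n S + S * (6 * S + 10) + 20 * S + 50

lemma Lists.congr {f g : ℕ → ℕ} {l : List ℕ} (h : Lists f l) (hg : g = f) : Lists g l := hg ▸ h

/-- The list has no repetitions, so the last hit recorded by the loop is the only one. -/
lemma wp_posC (h1 : 1 < W) {s : St} {l : List ℕ} (hm : s.reg .m = l.length)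
    (hA : Lists (s.arr .A) l) (hS : l.length ≤ S) (hSW : S < W) (hn : l.Nodup) :
    Wp I S W posC (fun s' => Frame [.pos, .i] [] (6 * S + 3) s s' ∧
      s'.reg .pos = if s.reg .v ∈ l then l.idxOf (s.reg .v) + 1 else 0) s := by
  refine (wp_assign (x := .pos) (e := .const 0) (by simp; omega)).seq fun s₁ ⟨F₁, h₁⟩ => ?_
  have hm₁ : s₁.reg .m = l.length := (F₁.reg _ (by simp)).trans hm
  refine (Wp.for (s := s₁) h1 [.pos, .i] [.pos] [] 3
    (fun k s' => s'.reg .pos = if s.reg .v ∈ l.take k then l.idxOf (s.reg .v) + 1 else 0)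
    (by simp) (by simp) (by simp) (by simp) (by omega) (by simpa using h₁) ?_
    (fun k s' h => h)).mono ?_
  · rintro k hk s' ⟨τ', F⟩ hik hP
    have hk' : k < l.length := by omega
    have e1 : s'.arr .A k = l[k] := by
      rw [F.arr _ (by simp), F₁.arr _ (by simp)]; exact hA.getElem hk'
    have e2 : s'.reg .v = s.reg .v := by rw [F.reg _ (by simp), F₁.reg _ (by simp)]
    refine wp_when (by simp [Tm.safe_eq h1, hik]; omega) (fun he => ?_) (fun he => ?_)
    · simp only [Tm.eval_eq, Tm.eval_get, Tm.eval_var, hik, e1, e2, truth_pos] at he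
      refine Wp.assign (by simp [h1, hik]; omega) ⟨?_, ?_⟩
      · exact (((Frame.refl _ _ s').tick).set (by simp) _).tick
      · have hx : l.idxOf (s.reg .v) = k := by rw [← he, hn.idxOf_getElem]
        rw [if_pos ((exists_take_succ hk').mpr (Or.inr he)), hx]
        simp [hik]
    · simp only [Tm.eval_eq, Tm.eval_get, Tm.eval_var, hik, e1, e2, truth_eq_zero] at he
      refine ⟨(((Frame.refl _ _ s').tick).tick).mono (List.Subset.refl _)
        (List.Subset.refl _) (by omega), ?_⟩
      simp [exists_take_succ hk', he, hP]
  · rintro s' ⟨F, hP⟩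
    refine ⟨((F₁.mono (by simp) (by simp) le_rfl).trans F).mono (by simp) (by simp) ?_, ?_⟩
    · rw [hm₁]; omega
    · rwa [hm₁, List.take_length] at hP

variable (hA : Access I S W G nT bT eT wC enc)

include hA

/-- The vertex `v` occupies index `0`, and `X` has fewer than `S` elements, so the array still fits
into `S` cells. -/
lemma wp_neighC {s : St} {xl : List ℕ} (hxm : s.reg .xm = xl.length) (hX : Lists (s.arr .X) xl)
    (hxS : xl.length < S) (hxn : ∀ x ∈ xl, x < G.n) (hv : s.reg .v < G.n) :
    Wp I S W (neighC eT) (fun s' => Frame [.um, .i2] [.U] (7 * S + 4) s s' ∧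
      ∃ ul : List ℕ, s'.reg .um = ul.length ∧ Lists (s'.arr .U) ul ∧ ul.length ≤ S ∧
        ∀ x, x ∈ ul ↔ (x ∈ xl ∧ G.E (s.reg .v) x) ∨ x = s.reg .v) s := by
  classical
  have h1 := hA.one_lt
  have hSW := hA.S_le
  refine (wp_store (a := .U) (i := .const 0) (e := .var .v) (by simp; omega) trivial
    (by simp; omega)).seq fun s₁ ⟨F₁, h₁⟩ => ?_
  refine (wp_assign (x := .um) (e := .const 1) h1).seq fun s₂ ⟨F₂, h₂⟩ => ?_
  have F₁₂ := (F₁.mono (ys := [.um, .i2]) (bs := [.U]) (by simp) (by simp) le_rfl).trans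
    (F₂.mono (by simp) (by simp) le_rfl)
  have hxm₂ : s₂.reg .xm = xl.length := (F₁₂.reg _ (by simp)).trans hxm
  have hlen : ∀ k, ((xl.take k).filter (fun x => G.E (s.reg .v) x)).length ≤ k := fun k =>
    (List.length_filter_le _ _).trans (by simp)
  refine (Wp.for (s := s₂) h1 [.um, .i2] [.um] [.U] 4
    (fun k s' => s'.reg .um = ((xl.take k).filter (fun x => G.E (s.reg .v) x)).length + 1 ∧
      Lists (s'.arr .U) (s.reg .v :: (xl.take k).filter (fun x => G.E (s.reg .v) x)))
    (by simp) (by simp) (by simp) (by simp) (by omega) ?_ ?_ (fun k s' h => h)).mono ?_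
  · refine ⟨by simp [h₂], ?_⟩
    rw [St.set_arr, F₂.arr _ (by simp)]
    intro i y hy
    rcases i with _ | i
    · simp only [List.take_zero, List.filter_nil, List.length_cons, List.length_nil, zero_add,
        Nat.lt_one_iff, pos_of_gt, List.getElem?_eq_getElem, List.getElem_cons_zero,
        Option.some.injEq] at hy
      simp [h₁, hy]
    · simp at hy
  · rintro k hk s' ⟨τ', F⟩ hik ⟨hum, hU⟩
    have hk' : k < xl.length := by omega
    have F' := F₁₂.trans F
    have e1 : s'.arr .X k = xl[k] := by
      rw [F'.arr _ (by simp)]; exact hX.getElem hk'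
    have e2 : s'.reg .v = s.reg .v := F'.reg _ (by simp)
    have hlt : xl[k] < G.n := hxn _ (List.getElem_mem hk')
    have he' : (eT (.var .v) (.get .X (.var .i2))).eval I s' = truth (G.E (s.reg .v) xl[k]) := by
      rw [hA.e_eval] <;> simp [hik, e1, e2, hlt, hv]
    have hes : (eT (.var .v) (.get .X (.var .i2))).Safe I S W s' := by
      apply hA.e_safe <;> simp [hik, e1, e2, hlt, hv]
      omega
    have hl := hlen k
    have hfilt : (xl.take (k + 1)).filter (fun x => G.E (s.reg .v) x) =
        (xl.take k).filter (fun x => G.E (s.reg .v) x) ++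
          if G.E (s.reg .v) xl[k] then [xl[k]] else [] := by
      rw [← List.take_append_getElem hk', List.filter_append]
      congr 1
      by_cases h : G.E (s.reg .v) xl[k] <;> simp [h]
    refine wp_when hes (fun he => ?_) (fun he => ?_)
    · rw [he', truth_pos] at he
      rw [if_pos he] at hfilt
      refine (wp_store (Tm.safe_var _ _) (by simp [hik]; omega) (by simp [hum]; omega)).seq
        fun s₃ ⟨F₃, h₃⟩ => ?_
      simp only [Tm.eval_var, Tm.eval_get, St.tick_reg, St.tick_arr, hik, e1, hum] at h₃
      have hum₃ : s₃.reg .um = ((xl.take k).filter (fun x => G.E (s.reg .v) x)).length + 1 :=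
        (F₃.reg _ (by simp)).trans hum
      refine Wp.assign (by simp [h1, hum₃]; omega) ⟨?_, ?_, ?_⟩
      · exact ((((Frame.refl _ _ s').tick).trans (F₃.mono (by simp) (by simp) le_rfl)).set
          (by simp) _).tick
      · simp [hfilt, hum₃]
      · rw [hfilt, ← List.cons_append]
        exact hU.append (by simpa using h₃)
    · rw [he', truth_eq_zero] at he
      rw [if_neg he, List.append_nil] at hfilt
      refine ⟨(((Frame.refl _ _ s').tick).tick).mono (List.Subset.refl _)
        (List.Subset.refl _) (by omega), ?_⟩
      simpa [hfilt] using ⟨hum, hU⟩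
  · rintro s' ⟨F, hum, hU⟩
    rw [hxm₂, List.take_length] at hum hU
    have hl := hlen xl.length
    rw [List.take_length] at hl
    refine ⟨(F₁₂.trans F).mono (List.Subset.refl _) (List.Subset.refl _) ?_,
      _, by simp [hum], hU, by simp; omega, fun x => by simp [or_comm]⟩
    rw [hxm₂]; omega

/-- Inclusion of the computed parent in `X` suffices, both being maximal. Comparing `v` and `r` as
well makes sure that a child is accepted under one number only. -/
lemma wp_testC {s : St} {xl : List ℕ} {Y : Finset ℕ} (hxm : s.reg .xm = xl.length)
    (hX : Lists (s.arr .X) xl) (hM : G.MaxBC xl.toFinset) (hxS : xl.length ≤ S) (hY : G.MaxBC Y)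
    (hch : s.reg .child = 0) (hj : s.reg .j = G.parLen Y)
    (hO : Lists (s.arr .O) ((G.ord Y).map Prod.fst))
    (hP : G.parLen Y ≠ 0 → ∃ pl : List ℕ, pl.Nodup ∧ pl.toFinset = G.parent Y ∧
      s.reg .pm = pl.length ∧ Lists (s.arr .P) pl) :
    Wp I S W testC (fun s' => Frame [.all, .sub, .i2, .u, .mem, .i, .child] []
      (S * (6 * S + 10) + 9) s s' ∧ (0 < s'.reg .child ↔ G.parLen Y ≠ 0 ∧
        G.parVertex Y = s.reg .v ∧ G.parRoot Y = s.reg .r ∧ G.parent Y = xl.toFinset)) s := by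
  have h1 := hA.one_lt
  have hSW := hA.S_le
  refine wp_when (by simp [Tm.safe_lt h1]; omega) (fun he => ?_) (fun he => ?_)
  · simp only [Tm.eval_lt, Tm.eval_const, Tm.eval_var, truth_pos, hj] at he
    have h0 : G.parLen Y ≠ 0 := he.ne'
    obtain ⟨pl, hpn, hpY, hpm, hPl⟩ := hP h0
    have hlt : G.parLen Y ≤ (G.ord Y).length := hY.parLen_le
    have hS := hA.length_lt (okList_ord (G := G) Y)
    have hpS := hA.card_lt _ (maxBC_parent (G := G) Y).1
    rw [← hpY, List.toFinset_card_of_nodup hpn] at hpS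
    have eV : s.arr .O (G.parLen Y - 1) = G.parVertex Y := by
      obtain ⟨l, hl⟩ := hY.exists_parVertex h0
      exact hO _ _ (by rw [List.getElem?_map, hl]; rfl)
    have eR : s.arr .O 0 = G.parRoot Y :=
      hO _ _ (by rw [List.getElem?_map, hY.ord_zero h0]; rfl)
    refine wp_when ?_ (fun he' => ?_) (fun he' => ?_)
    · simp [Tm.safe_and h1, Tm.safe_eq h1, h1, hj]; omega
    · simp only [Tm.eval_and, Tm.eval_eq, Tm.eval_get, Tm.eval_sub, Tm.eval_const, Tm.eval_var,
        truth_pos, St.tick_reg, St.tick_arr, hj, eV, eR] at he'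
      refine (wp_subsetC (s := s.tick.tick) h1 (by simp) (by simp) hpm hxm hPl hX (by omega) hxS
        hSW).seq fun s₁ ⟨F₁, h₁⟩ => ?_
      refine Wp.assign trivial ⟨?_, ?_⟩
      · refine (((((Frame.refl _ _ s).tick.tick).trans (F₁.mono (by simp) (by simp) le_rfl)).set
          (x := .child) (by simp) _).tick.tick).mono (List.Subset.refl _) (List.Subset.refl _) ?_
        omega
      · simp only [St.tick_reg, St.set_reg_self, Tm.eval_var, h₁, he', h0, ne_eq,
          not_false_eq_true, true_and, ← hpY]
        constructor
        · intro h
          have hsub : pl.toFinset ⊆ xl.toFinset := fun z hz =>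
            List.mem_toFinset.mpr (h z (List.mem_toFinset.mp hz))
          exact (hpY ▸ maxBC_parent (G := G) Y).2 _ hM.1 hsub
        · intro h z hz
          rw [← List.mem_toFinset, ← h]
          exact List.mem_toFinset.mpr hz
    · simp only [Tm.eval_and, Tm.eval_eq, Tm.eval_get, Tm.eval_sub, Tm.eval_const, Tm.eval_var,
        truth_pos, truth_eq_zero, St.tick_reg, St.tick_arr, hj, eV, eR] at he'
      refine ⟨((Frame.refl [] [] s).tick.tick.tick.tick).mono (by simp) (by simp) (by omega), ?_⟩
      simp only [St.tick_reg, hch, lt_irrefl, false_iff]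
      tauto
  · simp only [Tm.eval_lt, Tm.eval_const, Tm.eval_var, truth_eq_zero, hj] at he
    refine ⟨((Frame.refl [] [] s).tick.tick).mono (by simp) (by simp) (by omega), ?_⟩
    simp only [St.tick_reg, hch, lt_irrefl, false_iff]
    omega

/-- The array `U` is used twice: as the ground set of the restricted greedy search, and then for the
candidate whose parent is computed. -/
lemma wp_heavyC {s : St} {xl : List ℕ} (hn : s.reg .n = G.n) (hxm : s.reg .xm = xl.length)
    (hX : Lists (s.arr .X) xl) (hM : G.MaxBC xl.toFinset) (hxS : xl.length < S)
    (hv : s.reg .v < G.n) (hr : s.reg .r < G.n) (hrX : s.reg .r ∈ xl ∨ s.reg .r = s.reg .v)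
    (hch : s.reg .child = 0) :
    Wp I S W (heavyC bT eT) (fun s' => Frame candVars candArrs (heavyTime G.n S) s s' ∧
      (0 < s'.reg .child ↔ G.IsChild xl.toFinset (s.reg .v) (s.reg .r)) ∧
      (0 < s'.reg .child → ∃ ul : List ℕ, ul.Nodup ∧
        ul.toFinset = G.cand xl.toFinset (s.reg .v) (s.reg .r) ∧ s'.reg .um = ul.length ∧
        Lists (s'.arr .U) ul)) s := by
  have h1 := hA.one_lt
  have hSW := hA.S_le
  have hrX' : s.reg .r ∈ xl.toFinset ∨ s.reg .r = s.reg .v := by rwa [List.mem_toFinset]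
  refine (wp_neighC hA hxm hX hxS (fun x hx => hM.1.lt x (List.mem_toFinset.mpr hx)) hv).seq
    fun s₁ ⟨F₁, nl, hnm, hnU, hnS, hnl⟩ => ?_
  refine (wp_store (a := .A) (i := .const 0) (e := .var .r) (by simp; omega) trivial
    (by simp; omega)).seq fun s₂ ⟨F₂, h₂⟩ => ?_
  refine (wp_store (a := .L) (i := .const 0) (e := .const 1) (by simp; omega) h1
    (by simp; omega)).seq fun s₃ ⟨F₃, h₃⟩ => ?_
  refine (wp_assign (x := .m) (e := .const 1) h1).seq fun s₄ ⟨F₄, h₄⟩ => ?_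
  refine (wp_assign (x := .all) (e := .const 0) (by simp; omega)).seq fun s₅ ⟨F₅, h₅⟩ => ?_
  have F₁₅ := ((((F₁.mono (ys := candVars) (bs := candArrs) (by simp) (by simp) le_rfl).trans
    (F₂.mono (by simp) (by simp) le_rfl)).trans (F₃.mono (by simp) (by simp) le_rfl)).trans
    (F₄.mono (by simp) (by simp) le_rfl)).trans (F₅.mono (by simp) (by simp) le_rfl)
  have hvr₅ : ∀ x ∈ [Var.v, .r, .child], s₅.reg x = s.reg x := by
    intro x hx
    rw [F₅.reg _ (fun h => by fin_cases h; all_goals simp at hx),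
      F₄.reg _ (fun h => by fin_cases h; all_goals simp at hx), F₃.reg _ (by simp),
      F₂.reg _ (by simp), F₁.reg _ (fun h => by fin_cases h; all_goals simp at hx)]
  have hum₅ : s₅.reg .um = nl.length := by
    rw [F₅.reg _ (by simp), F₄.reg _ (by simp), F₃.reg _ (by simp), F₂.reg _ (by simp), hnm]
  have hU₅ : Lists (s₅.arr .U) nl := hnU.congr <| by
    rw [F₅.arr _ (by simp), F₄.arr _ (by simp), F₃.arr _ (by simp), F₂.arr _ (by simp)]
  have hR₅ : Rep s₅ [(s.reg .r, 1)] := by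
    refine ⟨(F₅.reg _ (by simp)).trans h₄, ?_, ?_⟩
    · rw [F₅.arr _ (by simp), F₄.arr _ (by simp), F₃.arr _ (by simp)]
      intro i y hy
      rcases i with _ | i
      · simp at hy
        simp [h₂, F₁.reg, hy]
      · simp at hy
    · rw [F₅.arr _ (by simp), F₄.arr _ (by simp)]
      intro i y hy
      rcases i with _ | i
      · simp at hy
        simp [h₃, hy]
      · simp at hy
  have hUn : Univ s₅ nl = {x | x ∈ xl.toFinset ∧ G.E (s.reg .v) x} ∪ {s.reg .v} := by
    rw [univ_list h₅]
    ext x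
    simp [hnl, or_comm]
  have hok₀ := okList_singleton hr
  refine (wp_greedyC hA hR₅ hok₀ ((F₁₅.reg _ (by simp)).trans hn) hum₅ hU₅ hnS).seq
    fun s₆ ⟨F₆, hR₆⟩ => ?_
  rw [hUn] at hR₆
  change Rep s₆ (G.candList xl.toFinset (s.reg .v) (s.reg .r)) at hR₆
  have hok₆ : G.OkList (G.candList xl.toFinset (s.reg .v) (s.reg .r)) := hok₀.greedy _
  have hlen₆ := hA.length_lt hok₆
  refine (wp_posC (l := (G.candList xl.toFinset (s.reg .v) (s.reg .r)).map Prod.fst) h1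
    (by rw [hR₆.m, List.length_map]) hR₆.A (by rw [List.length_map]; omega) hSW hok₆.nodup).seq
    fun s₇ ⟨F₇, h₇⟩ => ?_
  have F₁₇ := (F₁₅.trans (F₆.mono (ys := candVars) (bs := candArrs) (by simp) (by simp)
    le_rfl)).trans (F₇.mono (by simp) (by simp) le_rfl)
  have hvr₇ : ∀ x ∈ [Var.v, .r, .child], s₇.reg x = s.reg x := by
    intro x hx
    rw [F₇.reg _ (fun h => by fin_cases h; all_goals simp at hx),
      F₆.reg _ (fun h => by fin_cases h; all_goals simp at hx), hvr₅ x hx]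
  have hv₆ : s₆.reg .v = s.reg .v := by rw [F₆.reg _ (by simp), hvr₅ _ (by simp)]
  rw [hv₆] at h₇
  set CL := G.candList xl.toFinset (s.reg .v) (s.reg .r) with hCL
  have hmem : s.reg .v ∈ CL.map Prod.fst ↔ s.reg .v ∈ vs CL := by rw [vs, List.mem_toFinset]
  refine wp_when trivial (fun he => ?_) (fun he => ?_)
  swap
  · simp only [Tm.eval_var, h₇] at he
    have hv' : s.reg .v ∉ CL.map Prod.fst := fun h => by simp [h] at he
    have hch₇ := hvr₇ .child (by simp)
    refine ⟨F₁₇.tick.tick.mono (List.Subset.refl _) (List.Subset.refl _) ?_, ?_, ?_⟩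
    · rw [heavyTime]; omega
    · simp only [St.tick_reg, hch₇, hch, lt_irrefl, false_iff]
      exact fun h => hv' (hmem.mpr h.2.1)
    · simp only [St.tick_reg, hch₇, hch, lt_irrefl, false_imp_iff]
  · simp only [Tm.eval_var, h₇] at he
    have hv' : s.reg .v ∈ CL.map Prod.fst := by by_contra h; simp [h] at he
    rw [if_pos hv'] at h₇
    set p := (CL.map Prod.fst).idxOf (s.reg .v) + 1 with hp
    have hpl : p ≤ CL.length := by
      have := List.idxOf_lt_length_of_mem hv'
      rw [List.length_map] at this
      omega
    -- The seed has length 1, so the entries up to `v` form the list after `idxOf v` steps, which is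
    -- again a bc-clique.
    have hok₈ : G.OkList (CL.take p) := by
      have := hok₀.take_greedy ({x | x ∈ xl.toFinset ∧ G.E (s.reg .v) x} ∪ {s.reg .v})
        ((CL.map Prod.fst).idxOf (s.reg .v))
      rw [List.length_singleton, add_comm] at this
      rw [hCL, candList, this]
      exact hok₀.iterate _ _
    refine (wp_assign (x := .m) (e := .var .pos) trivial).seq fun s₈ ⟨F₈, h₈⟩ => ?_
    simp only [Tm.eval_var, St.tick_reg, h₇] at h₈
    refine (wp_assign (x := .all) (e := .const 1) h1).seq fun s₉ ⟨F₉, h₉⟩ => ?_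
    have F₁₉ := (F₁₇.tick.trans (F₈.mono (ys := candVars) (bs := candArrs) (by simp) (by simp)
      le_rfl)).trans (F₉.mono (by simp) (by simp) le_rfl)
    have hR₉ : Rep s₉ (CL.take p) := by
      refine ⟨?_, ?_, ?_⟩
      · rw [F₉.reg _ (by simp), h₈, List.length_take, min_eq_left hpl]
      · rw [List.map_take]
        exact hR₆.A.take _ |>.congr (by
          rw [F₉.arr _ (by simp), F₈.arr _ (by simp), St.tick_arr, F₇.arr _ (by simp)])
      · rw [List.map_take]
        exact hR₆.L.take _ |>.congr (by
          rw [F₉.arr _ (by simp), F₈.arr _ (by simp), St.tick_arr, F₇.arr _ (by simp)])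
    have hum₉ : s₉.reg .um = nl.length := by
      rw [F₉.reg _ (by simp), F₈.reg _ (by simp), St.tick_reg, F₇.reg _ (by simp),
        F₆.reg _ (by simp), hum₅]
    have hU₉ : Lists (s₉.arr .U) nl := hU₅.congr <| by
      rw [F₉.arr _ (by simp), F₈.arr _ (by simp), St.tick_arr, F₇.arr _ (by simp),
        F₆.arr _ (by simp)]
    refine (wp_greedyC hA hR₉ hok₈ ((F₁₉.reg _ (by simp)).trans hn) hum₉ hU₉ hnS).seq
      fun s₁₀ ⟨F₁₀, hR₁₀⟩ => ?_
    rw [univ_all (by rw [h₉]; simp)] at hR₁₀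
    change Rep s₁₀ (G.complete (CL.take p)) at hR₁₀
    have hok₁₀ := hok₈.complete
    have hlen₁₀ := hA.length_lt hok₁₀
    refine (wp_assign (x := .um) (e := .var .m) trivial).seq fun s₁₁ ⟨F₁₁, h₁₁⟩ => ?_
    simp only [Tm.eval_var, hR₁₀.m] at h₁₁
    refine (wp_copyC (k := (G.complete (CL.take p)).length)
      (l := (G.complete (CL.take p)).map Prod.fst) h1 (by simp) (by simp)
      ((F₁₁.reg _ (by simp)).trans hR₁₀.m) (by rw [F₁₁.arr _ (by simp)]; exact hR₁₀.A) (by simp)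
      (by omega) hSW).seq fun s₁₂ ⟨F₁₂, h₁₂⟩ => ?_
    rw [List.take_of_length_le (by simp)] at h₁₂
    have F₁₁₂ := ((F₁₉.trans (F₁₀.mono (ys := candVars) (bs := candArrs) (by simp) (by simp)
      le_rfl)).trans (F₁₁.mono (by simp) (by simp) le_rfl)).trans
      (F₁₂.mono (by simp) (by simp) le_rfl)
    have hvr₁₂ : ∀ x ∈ [Var.v, .r, .child], s₁₂.reg x = s.reg x := by
      intro x hx
      rw [F₁₂.reg _ (fun h => by fin_cases h; all_goals simp at hx),
        F₁₁.reg _ (fun h => by fin_cases h; all_goals simp at hx),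
        F₁₀.reg _ (fun h => by fin_cases h; all_goals simp at hx),
        F₉.reg _ (fun h => by fin_cases h; all_goals simp at hx),
        F₈.reg _ (fun h => by fin_cases h; all_goals simp at hx), St.tick_reg, hvr₇ x hx]
    set ul := (G.complete (CL.take p)).map Prod.fst with hul
    have hYc : ul.toFinset = G.cand xl.toFinset (s.reg .v) (s.reg .r) := rfl
    have hY : G.MaxBC ul.toFinset := hok₈.maxBC_complete
    have hulS : ul.length ≤ S := by rw [hul, List.length_map]; omega
    have hum₁₂ : s₁₂.reg .um = ul.length := by
      rw [F₁₂.reg _ (by simp), h₁₁, hul, List.length_map]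
    refine (wp_parentC hA ((F₁₁₂.reg _ (by simp)).trans hn) hum₁₂ h₁₂ hulS hY).seq
      fun s₁₃ ⟨F₁₃, hj, hO, hP⟩ => ?_
    have hvr₁₃ : ∀ x ∈ [Var.v, .r, .child], s₁₃.reg x = s.reg x := by
      intro x hx
      rw [F₁₃.reg _ (fun h => by fin_cases h; all_goals simp at hx), hvr₁₂ x hx]
    have F₁₁₃ := F₁₁₂.trans (F₁₃.mono (ys := candVars) (bs := candArrs) (by simp) (by simp) le_rfl)
    refine (wp_testC hA ((F₁₁₃.reg _ (by simp)).trans hxm)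
      (hX.congr (F₁₁₃.arr _ (by simp))) hM hxS.le hY ((hvr₁₃ _ (by simp)).trans hch) hj hO
      hP).mono ?_
    rintro s₁₄ ⟨F₁₄, h₁₄⟩
    rw [hvr₁₃ .v (by simp), hvr₁₃ .r (by simp)] at h₁₄
    refine ⟨?_, ?_, fun _ => ⟨ul, hok₁₀.nodup, hYc, ?_, ?_⟩⟩
    · refine (F₁₁₃.trans (F₁₄.mono (by simp) (by simp) le_rfl)).tick.mono (List.Subset.refl _)
        (List.Subset.refl _) ?_
      rw [heavyTime]; omega
    · rw [St.tick_reg, h₁₄, hYc]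
      exact ⟨fun h => ⟨hrX', hmem.mp hv', h⟩, fun h => h.2.2⟩
    · rw [St.tick_reg, F₁₄.reg _ (by simp), F₁₃.reg _ (by simp), hum₁₂]
    · exact h₁₂.congr (by rw [St.tick_arr, F₁₄.arr _ (by simp), F₁₃.arr _ (by simp)])

-- Division by `n` turns `k` into the pair `(v, r)`. The cheap test whether `r ∈ X` or `r = v` comes
-- before the construction of the candidate; the conditional time bound records this and is what
-- saves a factor in the sum over all `k`.
open Classical in
lemma wp_candC {s : St} {xl : List ℕ} (hn : s.reg .n = G.n) (hk : s.reg .k < G.n * G.n)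
    (hxm : s.reg .xm = xl.length)
    (hX : Lists (s.arr .X) xl) (hM : G.MaxBC xl.toFinset) (hxS : xl.length < S) :
    Wp I S W (candC bT eT) (fun s' => Frame candVars candArrs (lightTime S +
        if s.reg .k % G.n ∈ xl.toFinset ∨ s.reg .k % G.n = s.reg .k / G.n then
          heavyTime G.n S else 0) s s' ∧
      (0 < s'.reg .child ↔ G.IsChild xl.toFinset (s.reg .k / G.n) (s.reg .k % G.n)) ∧
      (0 < s'.reg .child → ∃ ul : List ℕ, ul.Nodup ∧
        ul.toFinset = G.cand xl.toFinset (s.reg .k / G.n) (s.reg .k % G.n) ∧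
        s'.reg .um = ul.length ∧ Lists (s'.arr .U) ul)) s := by
  have h1 := hA.one_lt
  have hSW := hA.S_le
  have hnW := hA.n_lt
  have hn0 : 0 < G.n := Nat.pos_of_ne_zero fun h => by simp [h] at hk
  have hv : s.reg .k / G.n < G.n := Nat.div_lt_of_lt_mul hk
  have hr : s.reg .k % G.n < G.n := Nat.mod_lt _ hn0
  have hdm := Nat.div_add_mod (s.reg .k) G.n
  rw [mul_comm] at hdm
  generalize hvv : s.reg .k / G.n = v at *
  generalize hrr : s.reg .k % G.n = r at *
  refine (wp_assign (x := .v) (e := .div (.var .k) (.var .n)) (by simp)).seq fun s₁ ⟨F₁, h₁⟩ => ?_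
  simp only [Tm.eval_div, Tm.eval_var, hn, hvv] at h₁
  have hn₁ : s₁.reg .n = G.n := (F₁.reg _ (by simp)).trans hn
  have hk₁ : s₁.reg .k = s.reg .k := F₁.reg _ (by simp)
  refine (wp_assign (x := .r) (e := .sub (.var .k) (.mul (.var .v) (.var .n)))
    (by simp [h₁, hn₁]; nlinarith)).seq fun s₂ ⟨F₂, h₂⟩ => ?_
  simp only [Tm.eval_sub, Tm.eval_mul, Tm.eval_var, h₁, hn₁, hk₁] at h₂
  replace h₂ : s₂.reg .r = r := by omega
  have hv₂ : s₂.reg .v = v := (F₂.reg _ (by simp)).trans h₁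
  refine (wp_assign (x := .u) (e := .var .r) trivial).seq fun s₃ ⟨F₃, h₃⟩ => ?_
  simp only [Tm.eval_var, h₂] at h₃
  refine (wp_assign (x := .all) (e := .eq (.var .r) (.var .v))
    (by simp [Tm.safe_eq h1])).seq fun s₄ ⟨F₄, h₄⟩ => ?_
  simp only [Tm.eval_eq, Tm.eval_var, F₃.reg .r (by simp), F₃.reg .v (by simp), hv₂, h₂] at h₄
  have F₁₄ := (((F₁.mono (ys := candVars) (bs := candArrs) (by simp) (by simp) le_rfl).trans
    (F₂.mono (by simp) (by simp) le_rfl)).trans (F₃.mono (by simp) (by simp) le_rfl)).trans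
    (F₄.mono (by simp) (by simp) le_rfl)
  refine (wp_memC (b := .X) (y := .xm) (l := xl) h1 (by simp) ((F₁₄.reg _ (by simp)).trans hxm)
    (hX.congr (F₁₄.arr _ (by simp))) hxS.le hSW).seq fun s₅ ⟨F₅, h₅⟩ => ?_
  rw [h₄, truth_pos, F₄.reg .u (by simp), h₃] at h₅
  refine (wp_assign (x := .child) (e := .const 0) (by simp; omega)).seq fun s₆ ⟨F₆, h₆⟩ => ?_
  have F₁₆ := (F₁₄.trans (F₅.mono (ys := candVars) (bs := candArrs) (by simp) (by simp)
    le_rfl)).trans (F₆.mono (by simp) (by simp) le_rfl)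
  have hv₆ : s₆.reg .v = v := by
    rw [F₆.reg _ (by simp), F₅.reg _ (by simp), F₄.reg _ (by simp), F₃.reg _ (by simp), hv₂]
  have hr₆ : s₆.reg .r = r := by
    rw [F₆.reg _ (by simp), F₅.reg _ (by simp), F₄.reg _ (by simp), F₃.reg _ (by simp), h₂]
  have hmem : 0 < s₆.reg .mem ↔ r ∈ xl.toFinset ∨ r = v := by
    rw [F₆.reg _ (by simp), h₅, List.mem_toFinset, or_comm]
  refine wp_when trivial (fun he => ?_) (fun he => ?_)
  · have he' := hmem.mp he
    rw [if_pos he']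
    refine (wp_heavyC hA (s := s₆.tick) ((F₁₆.reg _ (by simp)).trans hn)
      ((F₁₆.reg _ (by simp)).trans hxm) (hX.congr (F₁₆.arr _ (by simp))) hM hxS (hv₆ ▸ hv)
      (hr₆ ▸ hr) (by rw [St.tick_reg, hv₆, hr₆, ← List.mem_toFinset]; exact he') h₆).mono ?_
    rintro s' ⟨F, h, h'⟩
    rw [St.tick_reg, hv₆, hr₆] at h h'
    refine ⟨(F₁₆.tick.trans F).tick.mono (List.Subset.refl _) (List.Subset.refl _) ?_, h, h'⟩
    rw [lightTime]; omega
  · have he' : ¬ (r ∈ xl.toFinset ∨ r = v) := by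
      rw [← hmem]; simpa using he
    rw [if_neg he']
    refine ⟨F₁₆.tick.tick.mono (List.Subset.refl _) (List.Subset.refl _) ?_, ?_, ?_⟩
    · rw [lightTime]; omega
    · simp only [St.tick_reg, h₆, Tm.eval_const, lt_irrefl, false_iff]
      exact fun h => he' h.1
    · simp [h₆]

end Procedures

end RamWhile

/-! ### The tree of maximal bc-cliques -/

namespace ColGraph

variable {G : ColGraph}

/-- Should `v` be absent, `idxOf` is the length of the list and all of it is taken, so the argument
covers candidates that are not children. -/
lemma maxBC_cand (X : Finset ℕ) (v : ℕ) {r : ℕ} (hr : r < G.n) : G.MaxBC (G.cand X v r) := by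
  have h0 := okList_singleton (G := G) hr
  have h := h0.take_greedy ({x | x ∈ X ∧ G.E v x} ∪ {v})
    (((G.candList X v r).map Prod.fst).idxOf v)
  rw [List.length_singleton, add_comm] at h
  have hok : G.OkList ((G.candList X v r).take (((G.candList X v r).map Prod.fst).idxOf v + 1)) := by
    exact h ▸ h0.iterate _ _
  exact hok.maxBC_complete

variable (G) in
/-- The set `X` is the parent of `Z`. -/
def Up (Z X : Finset ℕ) : Prop := G.MaxBC Z ∧ G.parLen Z ≠ 0 ∧ G.parent Z = X

variable (G) in
/-- The set `Z` is a proper descendant of `X`. -/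
def Desc (X Z : Finset ℕ) : Prop := Relation.TransGen G.Up Z X

lemma Up.before {Z X : Finset ℕ} (h : G.Up Z X) : G.Before X Z :=
  h.2.2 ▸ h.1.parent_before h.2.1

lemma Desc.before {X Z : Finset ℕ} (h : G.Desc X Z) : G.Before X Z := by
  induction h with
  | single h => exact h.before
  | tail _ h ih => exact h.before.trans ih

lemma Desc.maxBC {X Z : Finset ℕ} (h : G.Desc X Z) : G.MaxBC Z := by
  obtain ⟨Y, h, -⟩ := Relation.TransGen.head'_iff.mp h
  exact h.1

lemma not_desc_self (X : Finset ℕ) : ¬ G.Desc X X := fun h => h.before.irrefl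

lemma IsChild.up {X : Finset ℕ} {v r : ℕ} (h : G.IsChild X v r) (hr : r < G.n) :
    G.Up (G.cand X v r) X :=
  ⟨maxBC_cand X v hr, h.2.2.1, h.2.2.2.2.2⟩

/-- The subtrees of different children are disjoint. -/
lemma eq_of_common_desc {X Y Y' Z : Finset ℕ} (h : G.Up Y X) (h' : G.Up Y' X)
    (hZ : Z = Y ∨ G.Desc Y Z) (hZ' : Z = Y' ∨ G.Desc Y' Z) : Y = Y' := by
  -- If `Y'` were a proper ancestor of `Y`, it would be `X` or an ancestor of `X`, although it is a
  -- child of `X`.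
  have key : ∀ {Y Y'}, G.Up Y X → G.Up Y' X → Relation.ReflTransGen G.Up Y Y' → Y = Y' := by
    intro Y Y' h h' hr
    rcases Relation.ReflTransGen.cases_head hr with rfl | ⟨V, hV, hr⟩
    · rfl
    · obtain rfl : X = V := h.2.2.symm.trans hV.2.2
      exact absurd (Relation.TransGen.tail' hr h') (not_desc_self X)
  have e : ∀ {Y}, (Z = Y ∨ G.Desc Y Z) → Relation.ReflTransGen G.Up Z Y := by
    rintro Y (rfl | h)
    · exact .refl
    · exact h.to_reflTransGen
  -- Parents are unique, so the ancestors of `Z` form a chain and the two children are comparable.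
  rcases Relation.ReflTransGen.total_of_right_unique
    (fun _ _ _ ha hb => ha.2.2.symm.trans hb.2.2) (e hZ) (e hZ') with hr | hr
  · exact key h h' hr
  · exact (key h' h hr).symm

/-! ### Descendants sorted by the number of the candidate, and induction along the tree -/

variable (G) in
/-- The proper descendants of `X` that come before or in the subtree of the `k`-th candidate. -/
def DescBelow (X : Finset ℕ) (k : ℕ) (Z : Finset ℕ) : Prop :=
  ∃ i < k, G.IsChild X (i / G.n) (i % G.n) ∧
    (Z = G.cand X (i / G.n) (i % G.n) ∨ G.Desc (G.cand X (i / G.n) (i % G.n)) Z)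

lemma descBelow_zero (X Z : Finset ℕ) : ¬ G.DescBelow X 0 Z := by
  rintro ⟨i, hi, -⟩
  omega

lemma descBelow_succ {X Z : Finset ℕ} {k : ℕ} : G.DescBelow X (k + 1) Z ↔
    G.DescBelow X k Z ∨ G.IsChild X (k / G.n) (k % G.n) ∧
      (Z = G.cand X (k / G.n) (k % G.n) ∨ G.Desc (G.cand X (k / G.n) (k % G.n)) Z) := by
  constructor
  · rintro ⟨i, hi, h⟩
    rcases Nat.lt_succ_iff_lt_or_eq.mp hi with hi | rfl
    · exact Or.inl ⟨i, hi, h⟩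
    · exact Or.inr h
  · rintro (⟨i, hi, h⟩ | h)
    · exact ⟨i, by omega, h⟩
    · exact ⟨k, by omega, h⟩

/-- A common member forces the two children to be equal, and a child determines its vertex and root,
hence its number. So no set is listed twice. -/
lemma DescBelow.not_of_isChild {X Z : Finset ℕ} {k : ℕ} (h : G.DescBelow X k Z) (hn : 0 < G.n)
    (hc : G.IsChild X (k / G.n) (k % G.n)) :
    ¬ (Z = G.cand X (k / G.n) (k % G.n) ∨ G.Desc (G.cand X (k / G.n) (k % G.n)) Z) := by
  intro hZ
  obtain ⟨i, hi, hci, hZi⟩ := h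
  have e := eq_of_common_desc (hci.up (Nat.mod_lt _ hn)) (hc.up (Nat.mod_lt _ hn)) hZi hZ
  obtain ⟨-, -, -, h1, h2, -⟩ := hci
  obtain ⟨-, -, -, h3, h4, -⟩ := hc
  rw [e] at h1 h2
  have hd := Nat.div_add_mod i G.n
  rw [← h1, ← h2, h3, h4, Nat.div_add_mod] at hd
  omega

/-- By `MaxBC.isChild` every child is found under the number `n * parVertex + parRoot`. -/
lemma descBelow_all {X Z : Finset ℕ} (hn : 0 < G.n) :
    G.DescBelow X (G.n * G.n) Z ↔ G.Desc X Z := by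
  constructor
  · rintro ⟨i, -, hc, rfl | h⟩
    · exact .single (hc.up (Nat.mod_lt _ hn))
    · exact h.tail (hc.up (Nat.mod_lt _ hn))
  · intro h
    obtain ⟨Y, hr, hY⟩ := Relation.TransGen.tail'_iff.mp h
    obtain ⟨hM, h0, rfl⟩ := hY
    obtain ⟨hc, he⟩ := hM.isChild h0
    have hv := hM.1.lt _ (hM.parVertex_mem h0)
    have hr' := hM.1.lt _ (hM.parRoot_mem h0)
    have e1 : (G.n * G.parVertex Y + G.parRoot Y) / G.n = G.parVertex Y := by
      rw [Nat.mul_add_div hn, Nat.div_eq_of_lt hr', add_zero]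
    have e2 : (G.n * G.parVertex Y + G.parRoot Y) % G.n = G.parRoot Y := by
      rw [Nat.mul_add_mod, Nat.mod_eq_of_lt hr']
    refine ⟨G.n * G.parVertex Y + G.parRoot Y, by nlinarith, ?_⟩
    rw [e1, e2, he]
    refine ⟨hc, ?_⟩
    rcases Relation.reflTransGen_iff_eq_or_transGen.mp hr with h | h
    · exact Or.inl h.symm
    · exact Or.inr h

open Classical in
/-- A measure for inductions along descendants. -/
noncomputable def height (X : Finset ℕ) : ℕ :=
  ((Finset.range G.n).powerset.filter fun Z => G.Before X Z).card

lemma MaxBC.mem_powerset {Y : Finset ℕ} (h : G.MaxBC Y) : Y ∈ (Finset.range G.n).powerset :=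
  Finset.mem_powerset.mpr fun x hx => Finset.mem_range.mpr (h.1.lt x hx)

/-- What comes after `Y` also comes after `X`, while `Y` comes after `X` but not after itself. -/
lemma Up.height_lt {Y X : Finset ℕ} (h : G.Up Y X) : G.height Y < G.height X := by
  classical
  refine Finset.card_lt_card ⟨fun Z hZ => ?_, fun hs => ?_⟩
  · rw [Finset.mem_filter] at hZ ⊢
    exact ⟨hZ.1, h.before.trans hZ.2⟩
  · have := hs (Finset.mem_filter.mpr ⟨h.1.mem_powerset, h.before⟩)
    exact (Finset.mem_filter.mp this).2.irrefl

/-- Every maximal bc-clique other than the root is a descendant of the root. -/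
lemma MaxBC.eq_or_desc {Z : Finset ℕ} (h : G.MaxBC Z) :
    Z = vs (G.complete []) ∨ G.Desc (vs (G.complete [])) Z := by
  classical
  -- The number of sets that precede `Z` drops on passing to the parent.
  induction hk : ((Finset.range G.n).powerset.filter fun X => G.Before X Z).card using
    Nat.strong_induction_on generalizing Z with
  | _ k ih =>
    by_cases h0 : G.parLen Z = 0
    · exact Or.inl (h.parLen_eq_zero.mp h0)
    · right
      have hp := maxBC_parent (G := G) Z
      have hb := h.parent_before h0
      have hu : G.Up Z (G.parent Z) := ⟨h, h0, rfl⟩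
      have hlt : ((Finset.range G.n).powerset.filter fun X => G.Before X (G.parent Z)).card < k := by
        rw [← hk]
        refine Finset.card_lt_card ⟨fun X hX => ?_, fun hs => ?_⟩
        · rw [Finset.mem_filter] at hX ⊢
          exact ⟨hX.1, hX.2.trans hb⟩
        · have := hs (Finset.mem_filter.mpr ⟨hp.mem_powerset, hb⟩)
          exact (Finset.mem_filter.mp this).2.irrefl
      rcases ih _ hlt hp rfl with e | e
      · rw [← e]; exact .single hu
      · exact .head hu e

lemma parLen_root : G.parLen (vs (G.complete [])) = 0 :=
  okList_nil.maxBC_complete.parLen_eq_zero.mpr rfl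

open Classical in
/-- Few numbers encode a candidate whose root is in `X` or equals its vertex. -/
lemma card_heavy_le (X : Finset ℕ) (n : ℕ) :
    ((Finset.range (n * n)).filter fun i => i % n ∈ X ∨ i % n = i / n).card ≤
      n * (X.card + 1) := by
  rcases Nat.eq_zero_or_pos n with rfl | hn
  · simp
  have hinj : Set.InjOn (fun i => (i / n, i % n))
      (((Finset.range (n * n)).filter fun i => i % n ∈ X ∨ i % n = i / n : Finset ℕ) : Set ℕ) := by
    intro i _ j _ h
    simp only [Prod.mk.injEq] at h
    rw [← Nat.div_add_mod i n, h.1, h.2, Nat.div_add_mod]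
  rw [← Finset.card_image_of_injOn hinj]
  -- A number is a pair `(v, r)`: there are `n * X.card` pairs with `r ∈ X` and `n` pairs with `r =
  -- v`.
  refine (Finset.card_le_card (t := Finset.range n ×ˢ X ∪ (Finset.range n).image fun i => (i, i))
    ?_).trans ((Finset.card_union_le _ _).trans ?_)
  · intro p hp
    obtain ⟨i, hi, rfl⟩ := Finset.mem_image.mp hp
    rw [Finset.mem_filter, Finset.mem_range] at hi
    have hd : i / n < n := Nat.div_lt_of_lt_mul hi.1
    rw [Finset.mem_union, Finset.mem_product, Finset.mem_image]
    rcases hi.2 with h | h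
    · exact Or.inl ⟨Finset.mem_range.mpr hd, h⟩
    · exact Or.inr ⟨i / n, Finset.mem_range.mpr hd, by rw [h]⟩
  · rw [Finset.card_product, Finset.card_range, mul_add, mul_one]
    exact Nat.add_le_add_left (Finset.card_image_le.trans (by simp)) _

end ColGraph

/-! ### The main program -/

namespace RamWhile

open WordRAM ColGraph

section Program

variable {I : Input} {S W : ℕ} {G : ColGraph} {nT : Tm} {bT eT : Tm → Tm → Tm} {wC : Tm → Cmd}
  {enc : ℕ → List ℕ}

/-- Write the set in the array `X` as a solution. -/
def writeC (wC : Tm → Cmd) : Cmd :=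
  .seq (.seq (.assign .i (.const 0)) (.loop (.lt (.var .i) (.var .xm))
    (.seq (wC (.get .X (.var .i))) (.assign .i (.add (.var .i) (.const 1)))))) .emit

/-- Go down to the child in the array `U`. -/
def enterC (wC : Tm → Cmd) : Cmd :=
  .seq (copyC .U .X .um) (.seq (.assign .xm (.var .um)) (.seq (.assign .k (.const 0))
    (.seq (.assign .par (.sub (.const 1) (.var .par))) (.ite (.var .par) .skip (writeC wC)))))

/-- Go back to the parent, or stop if there is none. -/
def leaveC (bT eT : Tm → Tm → Tm) (wC : Tm → Cmd) : Cmd :=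
  .seq (.when (.var .par) (writeC wC)) (.seq (.assign .um (.var .xm)) (.seq (copyC .X .U .xm)
    (.seq (parentC bT eT) (.ite (.var .j)
      (.seq (.assign .k (.add (.add (.mul (.var .n) (.get .O (.sub (.var .j) (.const 1))))
          (.get .O (.const 0))) (.const 1)))
        (.seq (copyC .P .X .pm) (.seq (.assign .xm (.var .pm))
          (.assign .par (.sub (.const 1) (.var .par))))))
      (.assign .run (.const 0))))))

/-- One round of the depth-first search. -/
def roundC (bT eT : Tm → Tm → Tm) (wC : Tm → Cmd) : Cmd :=
  .ite (.lt (.var .k) (.mul (.var .n) (.var .n)))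
    (.seq (candC bT eT) (.ite (.var .child) (enterC wC)
      (.assign .k (.add (.var .k) (.const 1)))))
    (leaveC bT eT wC)

/-- The program that lists the maximal bc-cliques. -/
def mainC (nT : Tm) (bT eT : Tm → Tm → Tm) (wC : Tm → Cmd) : Cmd :=
  .seq (.assign .n nT) (.seq (.assign .all (.const 1)) (.seq (greedyC bT eT)
    (.seq (copyC .A .X .m) (.seq (.assign .xm (.var .m)) (.seq (writeC wC)
      (.seq (.assign .run (.const 1)) (.loop (.var .run) (roundC bT eT wC))))))))

/-- A solution is written, in bounded time. -/
structure Wrote (enc : ℕ → List ℕ) (l : List ℕ) (τ : ℕ) (s s' : St) : Prop where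
  reg : ∀ x, x ≠ .i → s'.reg x = s.reg x
  arr : s'.arr = s.arr
  cur : s'.cur = []
  out : s'.out = s.out ++ [l.flatMap enc]
  last : s'.last = s'.time
  gap : s'.gap = max s.gap (s'.time - s.last)
  le : s.time ≤ s'.time
  time : s'.time ≤ s.time + τ

/-- No output is produced, in bounded time. -/
structure Quiet (τ : ℕ) (s s' : St) : Prop where
  out : s'.out = s.out
  last : s'.last = s.last
  gap : s'.gap = s.gap
  le : s.time ≤ s'.time
  time : s'.time ≤ s.time + τ

/-- One solution is produced, in bounded time. -/
structure Emits (enc : ℕ → List ℕ) (X : Finset ℕ) (τ : ℕ) (s s' : St) : Prop where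
  out : ∃ l : List ℕ, l.Nodup ∧ l.toFinset = X ∧ s'.out = s.out ++ [l.flatMap enc]
  last : s'.time ≤ s'.last + τ
  gap : s'.gap ≤ max s.gap (s.time + τ - s.last)

/-- The search is at the `k`-th candidate for a child of `X`, whose depth has the parity `d`. -/
structure At (G : ColGraph) (X : Finset ℕ) (k d : ℕ) (s : St) : Prop where
  n : s.reg .n = G.n
  k : s.reg .k = k
  par : s.reg .par = d
  run : s.reg .run = 1
  cur : s.cur = []
  le : s.last ≤ s.time
  X : ∃ xl : List ℕ, xl.Nodup ∧ xl.toFinset = X ∧ s.reg .xm = xl.length ∧ Lists (s.arr .X) xl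

/-- A round of the main loop. -/
def Round (I : Input) (S W : ℕ) (bT eT : Tm → Tm → Tm) (wC : Tm → Cmd) (s s' : St) : Prop :=
  0 < s.reg .run ∧ ∃ s₁, Exec I S W (roundC bT eT wC) s.tick s₁ ∧ s' = s₁.tick

/-- A time bound for writing a solution. -/
def writeTime (S : ℕ) : ℕ := 5 * S + 3

/-- A time bound for going down to a child. -/
def enterTime (n S : ℕ) : ℕ := lightTime S + heavyTime n S + 9 * S + 30

/-- A time bound for going back to the parent. -/
def leaveTime (n S : ℕ) : ℕ := parentTime n S + 13 * S + 40

open Classical in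
/-- A time bound for the test of the `k`-th candidate. -/
noncomputable def candTime (n S : ℕ) (X : Finset ℕ) (k : ℕ) : ℕ :=
  lightTime S + 10 + if k % n ∈ X ∨ k % n = k / n then heavyTime n S else 0

variable (hA : Access I S W G nT bT eT wC enc)

include hA

/-- The rule for bounded loops excludes output, so this loop is treated directly. An element costs
at most 2 for `wC`, 1 for the increment and 2 ticks, hence the factor 5. -/
lemma wp_writeC {s : St} {xl : List ℕ} (hxm : s.reg .xm = xl.length) (hX : Lists (s.arr .X) xl)
    (hxS : xl.length < S) (hxn : ∀ x ∈ xl, x < G.n) (hc : s.cur = []) :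
    Wp I S W (writeC wC) (Wrote enc xl (writeTime S) s) s := by
  have h1 := hA.one_lt
  have hSW := hA.S_le
  refine Wp.seq (R := fun s' => (∀ x, x ≠ .i → s'.reg x = s.reg x) ∧ s'.arr = s.arr ∧
    s'.cur = xl.flatMap enc ∧ s'.out = s.out ∧ s'.last = s.last ∧ s'.gap = s.gap ∧
    s.time ≤ s'.time ∧ s'.time ≤ s.time + (5 * S + 2)) ?_ ?_
  · refine (Wp.assign (Q := fun s' => s' = s.set .i 0) (by simp; omega) rfl).seq ?_
    rintro _ rfl
    refine (Wp.loop (fun s' => s'.reg .i ≤ xl.length ∧ (∀ x, x ≠ .i → s'.reg x = s.reg x) ∧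
      s'.arr = s.arr ∧ s'.cur = (xl.take (s'.reg .i)).flatMap enc ∧ s'.out = s.out ∧
      s'.last = s.last ∧ s'.gap = s.gap ∧ s.time ≤ s'.time ∧
      s'.time ≤ s.time + (5 * s'.reg .i + 1)) (fun s' => xl.length - s'.reg .i) ?_
      (fun s' _ => by simp [Tm.safe_lt h1]) ?_).mono ?_
    · refine ⟨by simp, fun x hx => by simp [hx], rfl, by simpa [St.set] using hc, rfl, rfl, rfl, ?_, ?_⟩
      · simp [St.set]
      · simp [St.set]
    · rintro s' ⟨hi, hreg, harr, hcur, hout, hlast, hgap, hle, htime⟩ he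
      simp only [Tm.eval_lt, Tm.eval_var, truth_pos, hreg .xm (by simp), hxm] at he
      have e1 : s'.arr .X (s'.reg .i) = xl[s'.reg .i] := by rw [harr]; exact hX.getElem he
      obtain ⟨t, ht, hw⟩ := hA.w_exec s'.tick (.get .X (.var .i)) (by simp; omega)
        (by simpa [e1] using hxn _ (List.getElem_mem he))
      refine Wp.seq (R := fun s₁ => s₁ = _) ⟨_, hw, rfl⟩ ?_
      rintro _ rfl
      refine Wp.assign (by simp [h1]; omega) ⟨⟨?_, ?_, ?_, ?_, ?_, ?_, ?_, ?_, ?_⟩, ?_⟩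
      · simpa using he
      · intro x hx
        simpa [hx] using hreg x hx
      · exact harr
      · change s'.cur ++ enc (s'.arr .X (s'.reg .i)) = _
        simp only [St.tick_reg, St.set_reg_self, Tm.eval_add, Tm.eval_var, Tm.eval_const]
        rw [← List.take_append_getElem he, List.flatMap_append, hcur, e1]
        simp
      · exact hout
      · exact hlast
      · exact hgap
      · simp only [St.tick, St.set]; omega
      · simp only [St.tick, St.set, Function.update_self, Tm.eval_add, Tm.eval_var, Tm.eval_const]
        omega
      · simp only [St.tick_reg, St.set_reg_self, Tm.eval_add, Tm.eval_var, Tm.eval_const]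
        omega
    · rintro _ ⟨s', ⟨hi, hreg, harr, hcur, hout, hlast, hgap, hle, htime⟩, he, rfl⟩
      simp only [Tm.eval_lt, Tm.eval_var, truth_eq_zero, hreg .xm (by simp), hxm] at he
      refine ⟨hreg, harr, ?_, hout, hlast, hgap, ?_, ?_⟩
      · change s'.cur = _
        rw [hcur, List.take_of_length_le (by omega)]
      · simp only [St.tick]; omega
      · simp only [St.tick]; omega
  · rintro s' ⟨hreg, harr, hcur, hout, hlast, hgap, hle, htime⟩
    refine ⟨_, .emit, ?_⟩
    refine ⟨hreg, harr, rfl, ?_, rfl, ?_, ?_, ?_⟩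
    · simp [St.emit, hout, hcur]
    · simp [St.emit, hgap, hlast]
    · simp only [St.emit]; omega
    · simp only [St.emit, writeTime]; omega

/-! ### The four kinds of rounds of the search -/

lemma round_stay {s : St} {X : Finset ℕ} {k d : ℕ} (h : At G X k d s) (hX : G.MaxBC X)
    (hk : k < G.n * G.n) (hc : ¬ G.IsChild X (k / G.n) (k % G.n)) :
    ∃ s', Round I S W bT eT wC s s' ∧ At G X (k + 1) d s' ∧ Quiet (candTime G.n S X k) s s' := by
  have h1 := hA.one_lt
  have hnW := hA.n_lt
  obtain ⟨xl, hxn, hxX, hxm, hxl⟩ := h.X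
  subst hxX
  have hxS : xl.length < S := by
    have := hA.card_lt _ hX.1
    rwa [List.toFinset_card_of_nodup hxn] at this
  suffices hw : Wp I S W (roundC bT eT wC) (fun s' => At G xl.toFinset (k + 1) d s'.tick ∧
      Quiet (candTime G.n S xl.toFinset k) s s'.tick) s.tick by
    obtain ⟨s', hs, h1, h2⟩ := hw
    exact ⟨_, ⟨by rw [h.run]; simp, s', hs, rfl⟩, h1, h2⟩
  refine Wp.ite (by simp [Tm.safe_lt h1, h.n]; nlinarith) (fun _ => ?_) (fun he => ?_)
  swap
  · simp [h.k, h.n] at he; omega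
  refine (wp_candC hA (s := s.tick.tick) h.n (h.k.trans_lt hk) hxm hxl hX hxS).seq
    fun s₁ ⟨F, hch, _⟩ => ?_
  simp only [St.tick_reg, h.k] at F hch
  refine Wp.ite trivial (fun he => absurd (hch.mp he) hc) (fun he => ?_)
  have hk₁ : s₁.reg .k = k := (F.reg _ (by simp)).trans h.k
  refine Wp.assign (by simp [hk₁, h1]; nlinarith) ⟨⟨?_, ?_, ?_, ?_, ?_, ?_, ?_⟩, ?_⟩
  · simpa using (F.reg _ (by simp)).trans h.n
  · simp [hk₁]
  · simpa using (F.reg _ (by simp)).trans h.par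
  · simpa using (F.reg _ (by simp)).trans h.run
  · exact F.cur.trans h.cur
  · have h2 := F.last; have h3 := F.le; have h4 := h.le
    simp only [St.tick, St.set] at *
    omega
  · refine ⟨xl, hxn, rfl, ?_, hxl.congr (F.arr _ (by simp))⟩
    simpa using (F.reg _ (by simp)).trans hxm
  · have h2 := F.le; have h3 := F.time
    refine ⟨F.out, F.last, F.gap, ?_, ?_⟩
    · simp only [St.tick, St.set] at *
      omega
    · simp only [St.tick, St.set, candTime] at *
      omega

/-- The child has parity `1 - d`. Sets of parity `0` are written on entry; those of parity `1` wait
until they are left. -/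
lemma wp_enterC {s : St} {ul : List ℕ} {d : ℕ} (hn : s.reg .n = G.n) (hpar : s.reg .par = d)
    (hd : d ≤ 1) (hrun : s.reg .run = 1) (hc : s.cur = []) (hl : s.last ≤ s.time)
    (hum : s.reg .um = ul.length) (hU : Lists (s.arr .U) ul) (hY : G.MaxBC ul.toFinset)
    (hu : ul.Nodup) :
    Wp I S W (enterC wC) (fun s' => At G ul.toFinset 0 (1 - d) s' ∧
      if d = 0 then Quiet (9 * S + 20) s s' else Emits enc ul.toFinset (9 * S + 20) s s') s := by
  have h1 := hA.one_lt
  have hSW := hA.S_le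
  have huS : ul.length < S := by
    have := hA.card_lt _ hY.1
    rwa [List.toFinset_card_of_nodup hu] at this
  refine (wp_copyC (l := ul) (k := ul.length) h1 (by simp) (by simp) hum hU le_rfl huS.le hSW).seq
    fun s₁ ⟨F₁, h₁⟩ => ?_
  rw [List.take_length] at h₁
  refine (wp_assign (x := .xm) (e := .var .um) trivial).seq fun s₂ ⟨F₂, h₂⟩ => ?_
  rw [Tm.eval_var, F₁.reg _ (by simp), hum] at h₂
  refine (wp_assign (x := .k) (e := .const 0) (by simp; omega)).seq fun s₃ ⟨F₃, h₃⟩ => ?_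
  refine (wp_assign (x := .par) (e := .sub (.const 1) (.var .par)) (by simp [h1])).seq
    fun s₄ ⟨F₄, h₄⟩ => ?_
  have F := (((F₁.mono (ys := [.i, .xm, .k, .par]) (bs := [.X]) (by simp) (by simp) le_rfl).trans
    (F₂.mono (by simp) (by simp) le_rfl)).trans (F₃.mono (by simp) (by simp) le_rfl)).trans
    (F₄.mono (by simp) (by simp) le_rfl)
  rw [Tm.eval_sub, Tm.eval_const, Tm.eval_var, F₃.reg _ (by simp), F₂.reg _ (by simp),
    F₁.reg _ (by simp), hpar] at h₄
  have hk₄ : s₄.reg .k = 0 := (F₄.reg _ (by simp)).trans h₃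
  have hxm₄ : s₄.reg .xm = ul.length := by rw [F₄.reg _ (by simp), F₃.reg _ (by simp), h₂]
  have hX₄ : Lists (s₄.arr .X) ul := h₁.congr <| by
    rw [F₄.arr _ (by simp), F₃.arr _ (by simp), F₂.arr _ (by simp)]
  have g1 := F.last
  have g2 := F.le
  have g3 := F.time
  have g4 := F.gap
  refine Wp.ite trivial (fun he => ?_) (fun he => ?_)
  · have hd0 : d = 0 := by simp only [Tm.eval_var, h₄] at he; omega
    simp only [if_pos hd0]
    refine Wp.skip ⟨⟨?_, hk₄, h₄, ?_, F.cur.trans hc, ?_, ul, hu, rfl, hxm₄, hX₄⟩,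
      F.out, g1, g4, ?_, ?_⟩
    · exact (F.reg _ (by simp)).trans hn
    · exact (F.reg _ (by simp)).trans hrun
    · simp only [St.tick]; omega
    · simp only [St.tick]; omega
    · simp only [St.tick]; omega
  · have hd0 : d ≠ 0 := by simp only [Tm.eval_var, h₄] at he; omega
    simp only [if_neg hd0]
    refine (wp_writeC hA (s := s₄.tick) hxm₄ hX₄ huS
      (fun x hx => hY.1.lt x (List.mem_toFinset.mpr hx)) (F.cur.trans hc)).mono
      fun s₅ h₅ => ?_
    have g5 := h₅.last
    have g6 := h₅.gap
    have g7 := h₅.le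
    have g8 := h₅.time
    simp only [St.tick, writeTime] at g6 g7 g8
    refine ⟨⟨?_, ?_, ?_, ?_, h₅.cur, ?_, ul, hu, rfl, ?_, ?_⟩, ⟨ul, hu, rfl, ?_⟩, ?_, ?_⟩
    · exact (h₅.reg _ (by simp)).trans ((F.reg _ (by simp)).trans hn)
    · exact (h₅.reg _ (by simp)).trans hk₄
    · exact (h₅.reg _ (by simp)).trans h₄
    · exact (h₅.reg _ (by simp)).trans ((F.reg _ (by simp)).trans hrun)
    · simp only [St.tick]; omega
    · exact (h₅.reg _ (by simp)).trans hxm₄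
    · exact hX₄.congr (by rw [St.tick_arr, h₅.arr]; rfl)
    · exact h₅.out.trans (by rw [show s₄.tick.out = s₄.out from rfl, F.out])
    · simp only [St.tick]; omega
    · simp only [St.tick]; omega

lemma round_enter {s : St} {X : Finset ℕ} {k d : ℕ} (h : At G X k d s) (hd : d ≤ 1)
    (hX : G.MaxBC X) (hk : k < G.n * G.n) (hc : G.IsChild X (k / G.n) (k % G.n)) :
    ∃ s', Round I S W bT eT wC s s' ∧ At G (G.cand X (k / G.n) (k % G.n)) 0 (1 - d) s' ∧
      if d = 0 then Quiet (enterTime G.n S) s s'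
      else Emits enc (G.cand X (k / G.n) (k % G.n)) (enterTime G.n S) s s' := by
  have h1 := hA.one_lt
  have hnW := hA.n_lt
  obtain ⟨xl, hxn, hxX, hxm, hxl⟩ := h.X
  subst hxX
  have hxS : xl.length < S := by
    have := hA.card_lt _ hX.1
    rwa [List.toFinset_card_of_nodup hxn] at this
  have hn0 : 0 < G.n := Nat.pos_of_ne_zero fun h => by simp [h] at hk
  set Y := G.cand xl.toFinset (k / G.n) (k % G.n) with hYdef
  have hY : G.MaxBC Y := maxBC_cand _ _ (Nat.mod_lt _ hn0)
  suffices hw : Wp I S W (roundC bT eT wC) (fun s' => At G Y 0 (1 - d) s'.tick ∧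
      if d = 0 then Quiet (enterTime G.n S) s s'.tick else Emits enc Y (enterTime G.n S) s s'.tick)
      s.tick by
    obtain ⟨s', hs, h1, h2⟩ := hw
    exact ⟨_, ⟨by rw [h.run]; simp, s', hs, rfl⟩, h1, h2⟩
  refine Wp.ite (by simp [Tm.safe_lt h1, h.n]; nlinarith) (fun _ => ?_) (fun he => ?_)
  swap
  · simp [h.k, h.n] at he; omega
  refine (wp_candC hA (s := s.tick.tick) h.n (h.k.trans_lt hk) hxm hxl hX hxS).seq
    fun s₁ ⟨F, hch, hU⟩ => ?_
  simp only [St.tick_reg, h.k] at F hch hU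
  have hpos := hch.mpr hc
  obtain ⟨ul, hun, huY, hum, hul⟩ := hU hpos
  rw [← hYdef] at huY
  have g1 := F.last
  have g2 := F.le
  have g3 := F.time
  have g4 := F.gap
  have hcand : (lightTime S + if k % G.n ∈ xl.toFinset ∨ k % G.n = k / G.n then
      heavyTime G.n S else 0) ≤ lightTime S + heavyTime G.n S := by split_ifs <;> omega
  have hle := h.le
  simp only [St.tick] at g1 g2 g3 g4
  refine Wp.ite trivial (fun he => ?_) (fun he => absurd he hpos.ne')
  refine (wp_enterC hA (s := s₁.tick) (ul := ul) ((F.reg _ (by simp)).trans h.n)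
    ((F.reg _ (by simp)).trans h.par) hd ((F.reg _ (by simp)).trans h.run) (F.cur.trans h.cur)
    (by simp only [St.tick]; omega) hum hul (huY ▸ hY) hun).mono ?_
  rintro s₂ ⟨hAt, hE⟩
  rw [huY] at hAt hE
  have hAt' : ∀ s, At G Y 0 (1 - d) s → At G Y 0 (1 - d) s.tick := fun s h =>
    ⟨h.n, h.k, h.par, h.run, h.cur, by have := h.le; simp only [St.tick]; omega, h.X⟩
  refine ⟨hAt' _ (hAt' _ (hAt' _ hAt)), ?_⟩
  split_ifs at hE ⊢ with hd0
  · have e1 := hE.last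
    have e2 := hE.le
    have e3 := hE.time
    have e4 := hE.gap
    simp only [St.tick] at e1 e2 e3 e4
    refine ⟨hE.out.trans F.out, ?_, ?_, ?_, ?_⟩
    all_goals simp only [St.tick, enterTime]; omega
  · have e1 := hE.last
    have e4 := hE.gap
    simp only [St.tick] at e1 e4
    obtain ⟨l, hl, hlY, hlo⟩ := hE.out
    refine ⟨⟨l, hl, hlY, hlo.trans ?_⟩, ?_, ?_⟩
    · rw [show s₁.tick.out = s₁.out from rfl, F.out]; rfl
    all_goals simp only [St.tick, enterTime]; omega

omit hA in
lemma At.tick {X : Finset ℕ} {k d : ℕ} {s : St} (h : At G X k d s) : At G X k d s.tick :=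
  ⟨h.n, h.k, h.par, h.run, h.cur, by have := h.le; simp only [St.tick]; omega, h.X⟩

omit hA in
/-- Quiet commands may follow. -/
lemma output_frame {X : Finset ℕ} {d τ τ' τ'' : ℕ} {s s' s'' : St} {xs : List Var} {as : List Arr}
    (h : if d = 0 then Quiet τ s s' else Emits enc X τ s s') (F : Frame xs as τ' s' s'')
    (hτ : τ + τ' ≤ τ'') : if d = 0 then Quiet τ'' s s'' else Emits enc X τ'' s s'' := by
  have g1 := F.last
  have g2 := F.le
  have g3 := F.time
  have g4 := F.gap
  split_ifs at h ⊢
  · have e1 := h.last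
    have e2 := h.le
    have e3 := h.time
    have e4 := h.gap
    refine ⟨F.out.trans h.out, ?_, ?_, ?_, ?_⟩
    all_goals omega
  · have e1 := h.last
    have e4 := h.gap
    obtain ⟨l, hl, hlY, hlo⟩ := h.out
    refine ⟨⟨l, hl, hlY, F.out.trans hlo⟩, ?_, ?_⟩
    all_goals omega

/-- The common part of going back to the parent and of stopping. -/
lemma wp_leaveC {s : St} {X : Finset ℕ} {k d : ℕ} (h : At G X k d s) (hX : G.MaxBC X)
    {Q : St → Prop} (hQ : ∀ s₁ : St, (∀ x ∈ [Var.n, .par, .run], s₁.reg x = s.reg x) →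
      s₁.cur = [] → s₁.last ≤ s₁.time →
      (if d = 0 then Quiet (parentTime G.n S + 9 * S + 20) s s₁
        else Emits enc X (parentTime G.n S + 9 * S + 20) s s₁) →
      s₁.reg .j = G.parLen X → Lists (s₁.arr .O) ((G.ord X).map Prod.fst) →
      (G.parLen X ≠ 0 → ∃ pl : List ℕ, pl.Nodup ∧ pl.toFinset = G.parent X ∧
        s₁.reg .pm = pl.length ∧ Lists (s₁.arr .P) pl) →
      Wp I S W (.ite (.var .j)
      (.seq (.assign .k (.add (.add (.mul (.var .n) (.get .O (.sub (.var .j) (.const 1))))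
          (.get .O (.const 0))) (.const 1)))
        (.seq (copyC .P .X .pm) (.seq (.assign .xm (.var .pm))
          (.assign .par (.sub (.const 1) (.var .par))))))
      (.assign .run (.const 0))) Q s₁) :
    Wp I S W (leaveC bT eT wC) Q s := by
  have h1 := hA.one_lt
  have hSW := hA.S_le
  obtain ⟨xl, hxn, hxX, hxm, hxl⟩ := h.X
  subst hxX
  have hxS : xl.length < S := by
    have := hA.card_lt _ hX.1
    rwa [List.toFinset_card_of_nodup hxn] at this
  have hle := h.le
  refine Wp.seq (R := fun s₁ => (∀ x, x ≠ .i → s₁.reg x = s.reg x) ∧ s₁.arr = s.arr ∧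
    s₁.cur = [] ∧ s₁.last ≤ s₁.time ∧ if d = 0 then Quiet (5 * S + 10) s s₁
      else Emits enc xl.toFinset (5 * S + 10) s s₁) ?_ ?_
  · refine wp_when trivial (fun he => ?_) (fun he => ?_)
    · have hd0 : d ≠ 0 := by simp only [Tm.eval_var, h.par] at he; omega
      simp only [if_neg hd0]
      refine (wp_writeC hA (s := s.tick) hxm hxl hxS
        (fun x hx => hX.1.lt x (List.mem_toFinset.mpr hx)) h.cur).mono fun s₁ h₁ => ?_
      have g5 := h₁.last
      have g6 := h₁.gap
      have g7 := h₁.le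
      have g8 := h₁.time
      simp only [St.tick, writeTime] at g6 g7 g8
      refine ⟨h₁.reg, h₁.arr, h₁.cur, ?_, ⟨xl, hxn, rfl, h₁.out⟩, ?_, ?_⟩
      all_goals simp only [St.tick]; omega
    · have hd0 : d = 0 := by simp only [Tm.eval_var, h.par] at he; omega
      simp only [if_pos hd0]
      refine ⟨fun _ _ => rfl, rfl, h.cur, ?_, rfl, rfl, rfl, ?_, ?_⟩
      all_goals simp only [St.tick]; omega
  · rintro s₁ ⟨hreg, harr, hcur, hle₁, hout⟩
    refine (wp_assign (x := .um) (e := .var .xm) trivial).seq fun s₂ ⟨F₂, h₂⟩ => ?_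
    rw [Tm.eval_var, hreg _ (by simp), hxm] at h₂
    refine (wp_copyC (l := xl) (k := xl.length) h1 (by simp) (by simp)
      (by rw [F₂.reg _ (by simp), hreg _ (by simp), hxm])
      (hxl.congr (by rw [F₂.arr _ (by simp), harr])) le_rfl hxS.le hSW).seq fun s₃ ⟨F₃, h₃⟩ => ?_
    rw [List.take_length] at h₃
    refine (wp_parentC hA (ul := xl) (by rw [F₃.reg _ (by simp), F₂.reg _ (by simp),
      hreg _ (by simp), h.n]) ((F₃.reg _ (by simp)).trans h₂) h₃ hxS.le hX).seq
      fun s₄ ⟨F₄, hj, hO, hP⟩ => ?_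
    have F := ((F₂.mono (ys := .um :: parentVars) (bs := .U :: parentArrs) (by simp) (by simp)
      le_rfl).trans (F₃.mono (by simp) (by simp) le_rfl)).trans (F₄.mono (by simp) (by simp) le_rfl)
    have g1 := F.last
    have g2 := F.le
    refine hQ s₄ (fun x hx => ?_) (F.cur.trans hcur) (by omega)
      (output_frame hout F (by omega)) hj hO hP
    rw [F.reg _ (fun hm => by fin_cases hx <;> simp at hm),
      hreg _ (fun hm => by subst hm; simp at hx)]

/-- The recomputed `parVertex` and `parRoot` give the number under which `X` was found, so the
search of the parent resumes at the next number without a stack. -/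
lemma round_leave {s : St} {X : Finset ℕ} {k d : ℕ} (h : At G X k d s)
    (hX : G.MaxBC X) (hk : G.n * G.n ≤ k) (h0 : G.parLen X ≠ 0) :
    ∃ s', Round I S W bT eT wC s s' ∧
      At G (G.parent X) (G.n * G.parVertex X + G.parRoot X + 1) (1 - d) s' ∧
      if d = 0 then Quiet (leaveTime G.n S) s s' else Emits enc X (leaveTime G.n S) s s' := by
  have h1 := hA.one_lt
  have hSW := hA.S_le
  have hnW := hA.n_lt
  suffices hw : Wp I S W (roundC bT eT wC) (fun s' =>
      At G (G.parent X) (G.n * G.parVertex X + G.parRoot X + 1) (1 - d) s'.tick ∧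
      if d = 0 then Quiet (leaveTime G.n S) s s'.tick
      else Emits enc X (leaveTime G.n S) s s'.tick) s.tick by
    obtain ⟨s', hs, h1, h2⟩ := hw
    exact ⟨_, ⟨by rw [h.run]; simp, s', hs, rfl⟩, h1, h2⟩
  have hv := hX.1.lt _ (hX.parVertex_mem h0)
  have hr := hX.1.lt _ (hX.parRoot_mem h0)
  refine Wp.ite (by simp [Tm.safe_lt h1, h.n]; nlinarith) (fun he => ?_) (fun _ => ?_)
  · simp [h.k, h.n] at he; omega
  refine wp_leaveC hA h.tick.tick hX fun s₁ hreg hcur hle hout hj hO hP => ?_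
  obtain ⟨pl, hpn, hpX, hpm, hPl⟩ := hP h0
  have hpS := hA.card_lt _ (maxBC_parent (G := G) X).1
  rw [← hpX, List.toFinset_card_of_nodup hpn] at hpS
  have hlt := hX.parLen_le
  have hoS := hA.length_lt (okList_ord (G := G) X)
  have eV : s₁.arr .O (G.parLen X - 1) = G.parVertex X := by
    obtain ⟨l, hl⟩ := hX.exists_parVertex h0
    exact hO _ _ (by rw [List.getElem?_map, hl]; rfl)
  have eR : s₁.arr .O 0 = G.parRoot X :=
    hO _ _ (by rw [List.getElem?_map, hX.ord_zero h0]; rfl)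
  have hn₁ : s₁.reg .n = G.n := (hreg _ (by simp)).trans h.n
  refine Wp.ite trivial (fun _ => ?_) (fun he => absurd (hj ▸ he) h0)
  refine (wp_assign (s := s₁.tick) (x := .k) ?_).seq fun s₂ ⟨F₂, h₂⟩ => ?_
  · simp only [Tm.safe_add, Tm.safe_mul, Tm.safe_get, Tm.safe_sub, Tm.safe_var, Tm.safe_const,
      Tm.eval_add, Tm.eval_mul, Tm.eval_get, Tm.eval_sub, Tm.eval_var, Tm.eval_const, St.tick_reg,
      St.tick_arr, hn₁, hj, eV, eR, true_and]
    have : G.n * G.parVertex X + G.parRoot X + 1 < W := by nlinarith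
    omega
  · simp only [Tm.eval_add, Tm.eval_mul, Tm.eval_get, Tm.eval_sub, Tm.eval_var, Tm.eval_const,
      St.tick_reg, St.tick_arr, hn₁, hj, eV, eR] at h₂
    refine (wp_copyC (l := pl) (k := pl.length) h1 (by simp) (by simp)
      ((F₂.reg _ (by simp)).trans hpm) (hPl.congr (F₂.arr _ (by simp))) le_rfl hpS.le hSW).seq
      fun s₃ ⟨F₃, h₃⟩ => ?_
    rw [List.take_length] at h₃
    refine (wp_assign (x := .xm) (e := .var .pm) trivial).seq fun s₄ ⟨F₄, h₄⟩ => ?_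
    rw [Tm.eval_var, F₃.reg _ (by simp), F₂.reg _ (by simp), St.tick_reg, hpm] at h₄
    refine (wp_assign (x := .par) (e := .sub (.const 1) (.var .par)) (by simp [h1])).mono
      fun s₅ ⟨F₅, h₅⟩ => ?_
    have F := (((F₂.mono (ys := [.i, .xm, .k, .par]) (bs := [.X]) (by simp) (by simp) le_rfl).trans
      (F₃.mono (by simp) (by simp) le_rfl)).trans (F₄.mono (by simp) (by simp) le_rfl)).trans
      (F₅.mono (by simp) (by simp) le_rfl)
    have g1 := F.last
    have g2 := F.le
    rw [Tm.eval_sub, Tm.eval_const, Tm.eval_var, F₄.reg _ (by simp), F₃.reg _ (by simp),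
      F₂.reg _ (by simp), St.tick_reg, hreg _ (by simp), St.tick_reg, St.tick_reg, h.par] at h₅
    refine ⟨(At.tick ⟨?_, ?_, h₅, ?_, F.cur.trans hcur, ?_, pl, hpn, hpX, ?_, ?_⟩).tick.tick, ?_⟩
    · exact (F.reg _ (by simp)).trans hn₁
    · rw [F₅.reg _ (by simp), F₄.reg _ (by simp), F₃.reg _ (by simp), h₂]
    · exact (F.reg _ (by simp)).trans ((hreg _ (by simp)).trans h.run)
    · simp only [St.tick] at g1 g2; omega
    · rw [F₅.reg _ (by simp), h₄]
    · exact h₃.congr (by rw [F₅.arr _ (by simp), F₄.arr _ (by simp)])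
    · have key := output_frame (τ'' := parentTime G.n S + 13 * S + 30) hout
        (F.tick_left.tick.tick.tick) (by omega)
      split_ifs at key ⊢
      · have e1 := key.le
        have e2 := key.time
        have e3 := key.last
        simp only [St.tick] at e1 e2 e3
        refine ⟨key.out, e3, key.gap, ?_, ?_⟩
        all_goals simp only [St.tick, leaveTime]; omega
      · have e1 := key.last
        have e3 := key.gap
        simp only [St.tick] at e1 e3
        refine ⟨key.out, ?_, ?_⟩
        all_goals simp only [St.tick, leaveTime]; omega

/-- Only the root has no parent; it has parity `0`, so nothing is left to be written. -/
lemma round_stop {s : St} {X : Finset ℕ} {k : ℕ} (h : At G X k 0 s)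
    (hX : G.MaxBC X) (hk : G.n * G.n ≤ k) (h0 : G.parLen X = 0) :
    ∃ s', Round I S W bT eT wC s s' ∧ s'.reg .run = 0 ∧ Quiet (leaveTime G.n S) s s' := by
  have h1 := hA.one_lt
  have hnW := hA.n_lt
  suffices hw : Wp I S W (roundC bT eT wC) (fun s' => s'.reg .run = 0 ∧
      Quiet (leaveTime G.n S) s s'.tick) s.tick by
    obtain ⟨s', hs, h1, h2⟩ := hw
    exact ⟨_, ⟨by rw [h.run]; simp, s', hs, rfl⟩, h1, h2⟩
  refine Wp.ite (by simp [Tm.safe_lt h1, h.n]; nlinarith) (fun he => ?_) (fun _ => ?_)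
  · simp [h.k, h.n] at he; omega
  refine wp_leaveC hA h.tick.tick hX fun s₁ hreg hcur hle hout hj hO hP => ?_
  rw [if_pos rfl] at hout
  have e1 := hout.le
  have e2 := hout.time
  have e3 := hout.last
  have e4 := hout.gap
  simp only [St.tick] at e1 e2 e3 e4
  refine Wp.ite trivial (fun he => absurd he (by simp [hj, h0])) (fun _ => ?_)
  refine Wp.assign (by simp; omega) ⟨by simp, hout.out, ?_, ?_, ?_, ?_⟩
  all_goals simp only [St.tick, St.set, leaveTime]; omega

end Program

end RamWhile

/-! ### Correctness of the main program -/

namespace RamWhile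

open WordRAM ColGraph

/-- Between two stages of the output, exactly the sets with property `P` are written. -/
def Outs (enc : ℕ → List ℕ) (P : Finset ℕ → Prop) (o o' : List (List ℕ)) : Prop :=
  ∃ Ls : List (List ℕ), o' = o ++ Ls.map (fun l => l.flatMap enc) ∧ (∀ l ∈ Ls, l.Nodup) ∧
    (Ls.map List.toFinset).Nodup ∧ ∀ Z, Z ∈ Ls.map List.toFinset ↔ P Z

lemma Outs.nil {enc : ℕ → List ℕ} {P : Finset ℕ → Prop} (h : ∀ Z, ¬ P Z) (o : List (List ℕ)) :
    Outs enc P o o :=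
  ⟨[], by simp, by simp, by simp, fun Z => by simp [h Z]⟩

lemma Outs.append {enc : ℕ → List ℕ} {P Q R : Finset ℕ → Prop} {o o' o'' : List (List ℕ)}
    (h : Outs enc P o o') (h' : Outs enc Q o' o'') (hd : ∀ Z, P Z → ¬ Q Z)
    (hR : ∀ Z, R Z ↔ P Z ∨ Q Z) : Outs enc R o o'' := by
  obtain ⟨Ls, rfl, h1, h2, h3⟩ := h
  obtain ⟨Ls', rfl, h1', h2', h3'⟩ := h'
  refine ⟨Ls ++ Ls', by simp, ?_, ?_, ?_⟩
  · intro l hl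
    rcases List.mem_append.mp hl with hl | hl
    · exact h1 l hl
    · exact h1' l hl
  · rw [List.map_append, List.nodup_append]
    refine ⟨h2, h2', ?_⟩
    rintro Z hZ _ hZ' rfl
    exact hd Z ((h3 Z).mp hZ) ((h3' Z).mp hZ')
  · intro Z
    rw [List.map_append, List.mem_append, h3, h3', hR]

lemma Emits.outs {enc : ℕ → List ℕ} {X : Finset ℕ} {τ : ℕ} {s s' : St} (h : Emits enc X τ s s') :
    Outs enc (fun Z => Z = X) s.out s'.out := by
  obtain ⟨l, hl, hX, ho⟩ := h.out
  exact ⟨[l], by simpa using ho, by simpa using hl, by simp, by simp [hX]⟩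

section Program

variable {I : Input} {S W : ℕ} {G : ColGraph} {nT : Tm} {bT eT : Tm → Tm → Tm} {wC : Tm → Cmd}
  {enc : ℕ → List ℕ}

/-- The induction over the tree concatenates sequences of rounds; they become an execution of the
loop only at the end. -/
lemma exec_loop_of_rounds {s s' s'' : St} (h : Relation.ReflTransGen (Round I S W bT eT wC) s s')
    (h' : Exec I S W (.loop (.var .run) (roundC bT eT wC)) s' s'') :
    Exec I S W (.loop (.var .run) (roundC bT eT wC)) s s'' := by
  induction h using Relation.ReflTransGen.head_induction_on with
  | refl => exact h'
  | head hr _ ih =>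
    obtain ⟨hrun, s₁, he, rfl⟩ := hr
    exact .loopTrue trivial hrun he ih

/-! ### Time at one node and the traversal of the tree -/

/-- A time bound for the tests of the first candidates. -/
noncomputable def testsTime (n S : ℕ) (X : Finset ℕ) (k : ℕ) : ℕ :=
  ∑ i ∈ Finset.range k, candTime n S X i

/-- The delay of the program is at most five times this. -/
def listTime (n S : ℕ) : ℕ :=
  n * n * (lightTime S + 10) + n * (S + 1) * heavyTime n S + enterTime n S + leaveTime n S

lemma testsTime_mono (n S : ℕ) (X : Finset ℕ) : Monotone (testsTime n S X) := fun _ _ h =>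
  Finset.sum_le_sum_of_subset (Finset.range_mono h)

/-- All `n * n` candidates pay for the light test, but only those counted by `card_heavy_le` for the
heavy one. -/
lemma testsTime_le {n S : ℕ} {X : Finset ℕ} (hX : X.card ≤ S) :
    testsTime n S X (n * n) + enterTime n S + leaveTime n S ≤ listTime n S := by
  classical
  have h1 : testsTime n S X (n * n) = n * n * (lightTime S + 10) +
      ((Finset.range (n * n)).filter fun i => i % n ∈ X ∨ i % n = i / n).card * heavyTime n S := by
    simp only [testsTime, candTime, Finset.sum_add_distrib, Finset.sum_ite, Finset.sum_const,
      Finset.card_range, smul_eq_mul, mul_zero, add_zero]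
    ring
  have h2 : ((Finset.range (n * n)).filter fun i => i % n ∈ X ∨ i % n = i / n).card *
      heavyTime n S ≤ n * (S + 1) * heavyTime n S :=
    Nat.mul_le_mul_right _ ((card_heavy_le X n).trans (Nat.mul_le_mul_left _ (by omega)))
  rw [h1, listTime]
  omega

variable (hA : Access I S W G nT bT eT wC enc)

include hA

/-- The search visits exactly the proper descendants of `X`. -/
lemma exists_rounds (hn : 0 < G.n) {M : ℕ} (hM : M = listTime G.n S) (h : ℕ) :
    ∀ X, G.height X = h → G.MaxBC X → ∀ d, d = 0 ∨ d = 1 → ∀ s, At G X 0 d s → s.gap ≤ 5 * M →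
      s.time ≤ s.last + (M + 2 * d * M) → ∃ s', Relation.ReflTransGen (Round I S W bT eT wC) s s' ∧
        At G X (G.n * G.n) d s' ∧ Outs enc (G.Desc X) s.out s'.out ∧ s'.gap ≤ 5 * M ∧
        s'.time ≤ s'.last + (M + 2 * d * M) + testsTime G.n S X (G.n * G.n) := by
  -- Here `M` bounds the work at one node. A set with `d = 0` was written on entry and starts within
  -- `M` of the last output; one with `d = 1` starts unwritten within `3 * M`. After the visit to a
  -- child these bounds hold again, up to the time for the tests made so far, and no gap exceeds `5
  -- * M`.
  induction h using Nat.strong_induction_on with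
  | _ h ih =>
  intro X hX hM' d hd s hs hgap htime
  have htests : ∀ Z, G.MaxBC Z → testsTime G.n S Z (G.n * G.n) + enterTime G.n S +
      leaveTime G.n S ≤ M := fun Z hZ => hM ▸ testsTime_le (hA.card_lt _ hZ.1).le
  suffices H : ∀ k ≤ G.n * G.n, ∃ s', Relation.ReflTransGen (Round I S W bT eT wC) s s' ∧
      At G X k d s' ∧ Outs enc (G.DescBelow X k) s.out s'.out ∧ s'.gap ≤ 5 * M ∧
      s'.time ≤ s'.last + (M + 2 * d * M) + testsTime G.n S X k by
    obtain ⟨s', h1, h2, h3, h4⟩ := H _ le_rfl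
    exact ⟨s', h1, h2, by rwa [show G.DescBelow X (G.n * G.n) = G.Desc X from
      funext fun Z => propext (descBelow_all hn)] at h3, h4⟩
  intro k
  induction k with
  | zero =>
    intro _
    exact ⟨s, .refl, hs, .nil (descBelow_zero X) _, hgap, by omega⟩
  | succ k ihk =>
    intro hk
    obtain ⟨s₀, hr₀, hat₀, hout₀, hgap₀, htime₀⟩ := ihk (by omega)
    have hle₀ := hat₀.le
    have hsucc : testsTime G.n S X (k + 1) = testsTime G.n S X k + candTime G.n S X k :=
      Finset.sum_range_succ _ _
    have hmono := testsTime_mono G.n S X (show k ≤ G.n * G.n by omega)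
    have hbX := htests X hM'
    by_cases hc : G.IsChild X (k / G.n) (k % G.n)
    swap
    · obtain ⟨s₁, hr₁, hat₁, hq⟩ := round_stay hA hat₀ hM' (by omega) hc
      refine ⟨s₁, hr₀.tail hr₁, hat₁, ?_, by rw [hq.gap]; exact hgap₀, ?_⟩
      · rw [hq.out]
        have e : G.DescBelow X (k + 1) = G.DescBelow X k := funext fun Z => propext <| by
          rw [descBelow_succ]
          simp [hc]
        rwa [e]
      · have e1 := hq.last
        have e2 := hq.time
        omega
    · set Y := G.cand X (k / G.n) (k % G.n) with hY
      have hup : G.Up Y X := hc.up (Nat.mod_lt _ hn)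
      have hbY := htests Y hup.1
      have hdisj : ∀ Z, G.DescBelow X k Z → ¬ (Z = Y ∨ G.Desc Y Z) := fun Z hZ =>
        hZ.not_of_isChild hn hc
      have hall : ∀ Z, G.DescBelow X (k + 1) Z ↔ G.DescBelow X k Z ∨ (Z = Y ∨ G.Desc Y Z) := by
        intro Z
        rw [descBelow_succ]
        simp [hc, ← hY]
      -- The number restored after the visit to the child is the one at which the search went down,
      -- increased by one.
      have hback : G.n * G.parVertex Y + G.parRoot Y + 1 = k + 1 := by
        rw [hc.2.2.2.1, hc.2.2.2.2.1, Nat.div_add_mod]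
      obtain ⟨s₁, hr₁, hat₁, hE⟩ := round_enter hA hat₀ (by omega) hM' (by omega) hc
      rw [← hY] at hat₁ hE
      rcases hd with rfl | rfl
      -- At even depth the child is entered silently and written after its descendants.
      · rw [if_pos rfl] at hE
        have e1 := hE.last
        have e2 := hE.time
        have e3 := hE.gap
        obtain ⟨s₂, hr₂, hat₂, hout₂, hgap₂, htime₂⟩ := ih _ (hX ▸ hup.height_lt) Y rfl hup.1 1
          (by omega) s₁ hat₁ (by omega) (by omega)
        have hle₂ := hat₂.le
        obtain ⟨s₃, hr₃, hat₃, hL⟩ := round_leave hA hat₂ hup.1 le_rfl hup.2.1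
        rw [hup.2.2, hback] at hat₃
        rw [if_neg (by simp)] at hL
        have e4 := hL.last
        have e5 := hL.gap
        refine ⟨s₃, ((hr₀.tail hr₁).trans hr₂).tail hr₃, hat₃, ?_, by omega, by omega⟩
        refine hout₀.append (hE.out ▸ (hout₂.append hL.outs ?_ fun Z => or_comm)) hdisj hall
        rintro Z hZ rfl
        exact not_desc_self _ hZ
      -- At odd depth the child is written first and left silently. It ends within `2 * M` of an
      -- output, inside the slack `3 * M` of its parent.
      · rw [if_neg (by simp)] at hE
        have e1 := hE.last
        have e3 := hE.gap
        obtain ⟨s₂, hr₂, hat₂, hout₂, hgap₂, htime₂⟩ := ih _ (hX ▸ hup.height_lt) Y rfl hup.1 0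
          (by omega) s₁ hat₁ (by omega) (by omega)
        have hle₂ := hat₂.le
        obtain ⟨s₃, hr₃, hat₃, hL⟩ := round_leave hA hat₂ hup.1 le_rfl hup.2.1
        rw [hup.2.2, hback] at hat₃
        rw [if_pos rfl] at hL
        have e4 := hL.last
        have e5 := hL.gap
        have e6 := hL.time
        refine ⟨s₃, ((hr₀.tail hr₁).trans hr₂).tail hr₃, hat₃, ?_, by omega, by omega⟩
        refine hout₀.append (hL.out ▸ (hE.outs.append hout₂ ?_ fun Z => Iff.rfl)) hdisj hall
        rintro Z rfl hZ
        exact not_desc_self _ hZ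

/-- The root is written before the search, the rounds write its proper descendants, and by
`MaxBC.eq_or_desc` nothing else exists. -/
theorem exists_exec_mainC (hn : 0 < G.n) :
    ∃ s', Exec I S W (mainC nT bT eT wC) St.init s' ∧ s'.maxGap ≤ 5 * listTime G.n S ∧
      Outs enc G.MaxBC [] s'.out := by
  have h1 := hA.one_lt
  have hSW := hA.S_le
  set M := listTime G.n S with hM
  have hML : leaveTime G.n S ≤ M := by rw [hM, listTime]; omega
  have hg : greedyTime G.n S + 9 * S + 40 ≤ leaveTime G.n S := by
    rw [leaveTime, parentTime]; omega
  suffices hw : Wp I S W (mainC nT bT eT wC) (fun s' => s'.maxGap ≤ 5 * M ∧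
      Outs enc G.MaxBC [] s'.out) St.init by
    obtain ⟨s', h, h'⟩ := hw
    exact ⟨s', h, h'⟩
  refine (wp_assign (x := .n) (e := nT) (hA.n_safe _)).seq fun s₁ ⟨F₁, h₁⟩ => ?_
  rw [hA.n_eval] at h₁
  refine (wp_assign (x := .all) (e := .const 1) h1).seq fun s₂ ⟨F₂, h₂⟩ => ?_
  have F₁₂ := (F₁.mono (ys := [.n, .all]) (bs := []) (by simp) (by simp) le_rfl).trans
    (F₂.mono (by simp) (by simp) le_rfl)
  have hinit : ∀ x, x ≠ .n → x ≠ .all → s₂.reg x = 0 := fun x h h' => by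
    rw [F₁₂.reg x (by simp [h, h'])]; rfl
  have hn₂ : s₂.reg .n = G.n := (F₂.reg _ (by simp)).trans h₁
  refine (wp_greedyC hA (s := s₂) (L := []) (ul := []) ⟨hinit _ (by simp) (by simp),
    by intro i y hy; simp at hy, by intro i y hy; simp at hy⟩ okList_nil hn₂
    (hinit _ (by simp) (by simp)) (by intro i y hy; simp at hy) (by simp)).seq
    fun s₃ ⟨F₃, hR₃⟩ => ?_
  rw [univ_all (by rw [h₂]; simp)] at hR₃
  change Rep s₃ (G.complete []) at hR₃
  have hok := okList_nil (G := G).complete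
  have hroot := okList_nil (G := G).maxBC_complete
  have hlen := hA.length_lt hok
  refine (wp_copyC (k := (G.complete []).length) (l := (G.complete []).map Prod.fst) h1 (by simp)
    (by simp) hR₃.m hR₃.A (by simp) (by omega) hSW).seq fun s₄ ⟨F₄, h₄⟩ => ?_
  rw [List.take_of_length_le (by simp)] at h₄
  refine (wp_assign (x := .xm) (e := .var .m) trivial).seq fun s₅ ⟨F₅, h₅⟩ => ?_
  rw [Tm.eval_var, F₄.reg _ (by simp), hR₃.m] at h₅
  have F₃₅ := ((F₃.mono (ys := .xm :: greedyVars) (bs := [.A, .L, .X]) (by simp) (by simp)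
    le_rfl).trans (F₄.mono (by simp) (by simp) le_rfl)).trans (F₅.mono (by simp) (by simp) le_rfl)
  refine (wp_writeC hA (s := s₅) (xl := (G.complete []).map Prod.fst) (by rw [h₅, List.length_map])
    (h₄.congr (F₅.arr _ (by simp))) (by rw [List.length_map]; omega)
    (fun x hx => hok.bc.lt x (List.mem_toFinset.mpr hx)) (F₃₅.cur.trans F₁₂.cur)).seq
    fun s₆ h₆ => ?_
  refine (wp_assign (x := .run) (e := .const 1) h1).seq fun s₇ ⟨F₇, h₇⟩ => ?_
  have t1 := F₁₂.time
  have t2 := F₃₅.time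
  have t3 := h₆.time
  have t4 := F₇.time
  have t5 := h₆.last
  have t6 := F₇.last
  have t7 := h₆.gap
  have t8 := F₇.gap
  have t9 := F₃₅.gap
  have t10 := F₁₂.gap
  have t11 := F₇.le
  rw [show St.init.gap = 0 from rfl] at t10
  rw [show St.init.time = 0 from rfl] at t1
  rw [writeTime] at t3
  have hat : At G (vs (G.complete [])) 0 0 s₇ := by
    refine ⟨?_, ?_, ?_, h₇, F₇.cur.trans h₆.cur, by omega, _, hok.nodup, rfl, ?_, ?_⟩
    · rw [F₇.reg _ (by simp), h₆.reg _ (by simp), F₃₅.reg _ (by simp), hn₂]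
    · rw [F₇.reg _ (by simp), h₆.reg _ (by simp), F₃₅.reg _ (by simp), hinit _ (by simp) (by simp)]
    · rw [F₇.reg _ (by simp), h₆.reg _ (by simp), F₃₅.reg _ (by simp), hinit _ (by simp) (by simp)]
    · rw [F₇.reg _ (by simp), h₆.reg _ (by simp), h₅, List.length_map]
    · exact h₄.congr (by rw [F₇.arr _ (by simp), h₆.arr, F₅.arr _ (by simp)])
  obtain ⟨s₈, hr₈, hat₈, hout₈, hgap₈, htime₈⟩ := exists_rounds hA hn hM _ _ rfl hroot 0
    (Or.inl rfl) s₇ hat (by omega) (by omega)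
  obtain ⟨s₉, hr₉, hrun, hq⟩ := round_stop hA hat₈ hroot le_rfl parLen_root
  refine ⟨s₉.tick, exec_loop_of_rounds (hr₈.tail hr₉) (.loopFalse trivial hrun), ?_, ?_⟩
  · have e1 := hq.last
    have e2 := hq.gap
    have e3 := hq.time
    have e4 := testsTime_le (n := G.n) (hA.card_lt _ hroot.1).le
    simp only [St.maxGap, St.tick]
    omega
  · have ho : Outs enc (fun Z => Z = vs (G.complete [])) [] s₇.out := by
      refine ⟨[(G.complete []).map Prod.fst], ?_, by simpa using hok.nodup, by simp, ?_⟩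
      · rw [F₇.out, h₆.out, F₃₅.out, F₁₂.out]
        simp [St.init]
      · simp [vs]
    change Outs enc G.MaxBC [] s₉.out
    rw [hq.out]
    refine ho.append hout₈ ?_ fun Z => ⟨MaxBC.eq_or_desc, ?_⟩
    · rintro Z rfl hZ
      exact not_desc_self _ hZ
    · rintro (rfl | hZ)
      · exact hroot
      · exact hZ.maxBC

-- A scan costs `n S`, a greedy search `n S²`, a parent and hence a heavy test `n S³`; about `n S`
-- heavy tests at a node give `n² S⁴`.
omit hA in
lemma listTime_le {n S : ℕ} (hn : 1 ≤ n) (hS : 1 ≤ S) : listTime n S ≤ 3000 * (n ^ 2 * S ^ 4) := by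
  have hn2 : n ≤ n ^ 2 := Nat.le_self_pow (by simp) n
  have hS2 : S ≤ S ^ 2 := Nat.le_self_pow (by simp) S
  have hS3 : S ^ 2 ≤ S ^ 3 := Nat.pow_le_pow_right hS (by simp)
  have hS4 : S ^ 3 ≤ S ^ 4 := Nat.pow_le_pow_right hS (by simp)
  have hscan : scanTime n S ≤ 31 * (n * S) := by
    rw [scanTime]
    nlinarith [Nat.mul_le_mul hn hS]
  have hgreedy : greedyTime n S ≤ 78 * (n * S ^ 2) := by
    have e : (S + 1) * (scanTime n S + 7) ≤ 2 * S * (38 * (n * S)) :=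
      Nat.mul_le_mul (by omega) (by nlinarith [Nat.mul_le_mul hn hS])
    rw [greedyTime]
    nlinarith [Nat.mul_le_mul hn (hS.trans hS2)]
  have hround : parentRound n S ≤ 130 * (n * S ^ 2) := by
    rw [parentRound]
    have e1 : S ^ 2 ≤ n * S ^ 2 := Nat.le_mul_of_pos_left _ hn
    have e2 : S * (6 * S + 10) ≤ 16 * S ^ 2 := by nlinarith
    omega
  have hparent : parentTime n S ≤ 400 * (n * S ^ 3) := by
    have e : (S + 1) * parentRound n S ≤ 2 * S * (130 * (n * S ^ 2)) :=
      Nat.mul_le_mul (by omega) hround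
    have e1 : n * S ^ 2 ≤ n * S ^ 3 := Nat.mul_le_mul_left _ hS3
    have e2 : S ≤ n * S ^ 3 := (hS2.trans hS3).trans (Nat.le_mul_of_pos_left _ hn)
    have e3 : 2 * S * (130 * (n * S ^ 2)) = 260 * (n * S ^ 3) := by ring
    rw [parentTime]
    omega
  have hheavy : heavyTime n S ≤ 700 * (n * S ^ 3) := by
    have e1 : n * S ^ 2 ≤ n * S ^ 3 := Nat.mul_le_mul_left _ hS3
    have e2 : S ≤ n * S ^ 3 := (hS2.trans hS3).trans (Nat.le_mul_of_pos_left _ hn)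
    have e3 : S * (6 * S + 10) ≤ 16 * (n * S ^ 3) := by
      have : S * (6 * S + 10) ≤ 16 * S ^ 2 := by nlinarith
      exact this.trans (Nat.mul_le_mul_left _ (hS3.trans (Nat.le_mul_of_pos_left _ hn)))
    rw [heavyTime]
    omega
  have e1 : n * S ^ 3 ≤ n ^ 2 * S ^ 4 := Nat.mul_le_mul hn2 hS4
  have e2 : S ≤ n ^ 2 * S ^ 4 :=
    ((hS2.trans hS3).trans (Nat.le_mul_of_pos_left _ hn)).trans e1
  have e3 : n * (S + 1) * heavyTime n S ≤ n * (2 * S) * (700 * (n * S ^ 3)) :=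
    Nat.mul_le_mul (Nat.mul_le_mul_left _ (by omega)) hheavy
  have e4 : n * (2 * S) * (700 * (n * S ^ 3)) = 1400 * (n ^ 2 * S ^ 4) := by ring
  have e5 : n * n * (lightTime S + 10) ≤ 26 * (n ^ 2 * S ^ 4) := by
    have : lightTime S + 10 ≤ 26 * S ^ 4 := by rw [lightTime]; omega
    calc n * n * (lightTime S + 10) ≤ n * n * (26 * S ^ 4) := Nat.mul_le_mul_left _ this
      _ = 26 * (n ^ 2 * S ^ 4) := by ring
  rw [listTime, enterTime, leaveTime, lightTime]
  rw [lightTime] at e5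
  omega

end Program

end RamWhile

/-! ### Graphs with black and white edges -/

namespace RamWhile

open WordRAM ColGraph

section Bridge

variable {V : Type*} {N : ℕ}

/-- A graph with black and white edges, with its vertices numbered. -/
def _root_.BWGraph.toColGraph (H : BWGraph V) (e : V ≃ Fin N) : ColGraph where
  n := N
  B u w := ∃ x y, (e x : ℕ) = u ∧ (e y : ℕ) = w ∧ H.black.Adj x y
  E u w := ∃ x y, (e x : ℕ) = u ∧ (e y : ℕ) = w ∧ (H.black ⊔ H.white).Adj x y
  B_symm := by
    rintro u w ⟨x, y, hx, hy, h⟩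
    exact ⟨y, x, hy, hx, h.symm⟩
  E_symm := by
    rintro u w ⟨x, y, hx, hy, h⟩
    exact ⟨y, x, hy, hx, h.symm⟩
  E_irrefl := by
    rintro u ⟨x, y, hx, hy, h⟩
    exact h.ne (e.injective (Fin.ext (hx.trans hy.symm)))

/-- The numbering as an embedding into the natural numbers. -/
def number (e : V ≃ Fin N) : V ↪ ℕ := e.toEmbedding.trans Fin.valEmbedding

@[simp] lemma number_apply (e : V ≃ Fin N) (v : V) : number e v = e v := rfl

variable {H : BWGraph V} {e : V ≃ Fin N}

lemma toColGraph_B {x y : V} : (H.toColGraph e).B (e x) (e y) ↔ H.black.Adj x y := by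
  constructor
  · rintro ⟨x', y', hx, hy, h⟩
    rwa [e.injective (Fin.ext hx), e.injective (Fin.ext hy)] at h
  · exact fun h => ⟨x, y, rfl, rfl, h⟩

lemma toColGraph_E {x y : V} : (H.toColGraph e).E (e x) (e y) ↔ (H.black ⊔ H.white).Adj x y := by
  constructor
  · rintro ⟨x', y', hx, hy, h⟩
    rwa [e.injective (Fin.ext hx), e.injective (Fin.ext hy)] at h
  · exact fun h => ⟨x, y, rfl, rfl, h⟩

lemma exists_map_number {Z : Finset ℕ} (hZ : ∀ x ∈ Z, x < N) :
    ∃ X : Finset V, Z = X.map (number e) := by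
  classical
  refine ⟨(Finset.univ.filter fun i : Fin N => (i : ℕ) ∈ Z).map e.symm.toEmbedding, ?_⟩
  ext x
  simp only [Finset.mem_map, Finset.mem_filter, Finset.mem_univ, true_and, Equiv.coe_toEmbedding,
    number_apply]
  constructor
  · intro hx
    exact ⟨_, ⟨⟨x, hZ x hx⟩, hx, rfl⟩, by simp⟩
  · rintro ⟨_, ⟨i, hi, rfl⟩, rfl⟩
    simpa using hi

/-- In one direction, the vertices reachable from a point form a set that no black edge leaves, so
they are all of `X`. In the other, a black walk that starts inside a cut and ends outside crosses
its boundary. -/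
lemma isBC_map_number {X : Finset V} :
    (H.toColGraph e).IsBC (X.map (number e)) ↔ H.IsBCClique (X : Set V) := by
  classical
  have hinj : ∀ {x y : V}, (e x : ℕ) = e y → x = y := fun h => e.injective (Fin.ext h)
  constructor
  · intro h
    refine ⟨fun x hx y hy hne => ?_, ?_⟩
    · exact toColGraph_E.mp (h.clique _ (Finset.mem_map_of_mem _ hx) _ (Finset.mem_map_of_mem _ hy)
        fun he => hne (hinj he))
    · intro u w
      by_contra hr
      obtain ⟨Z, hZm⟩ : ∃ Z : Finset V, ∀ v, v ∈ Z ↔ v ∈ X ∧ ∃ hv : v ∈ (X : Set V),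
          (H.black.induce (X : Set V)).Reachable u ⟨v, hv⟩ :=
        ⟨X.filter fun v => ∃ hv : v ∈ (X : Set V),
          (H.black.induce (X : Set V)).Reachable u ⟨v, hv⟩, fun v => Finset.mem_filter⟩
      have hZ : Z.map (number e) ⊆ X.map (number e) :=
        Finset.map_subset_map.mpr fun v hv => ((hZm v).mp hv).1
      have huZ : (u : V) ∈ Z := (hZm _).mpr ⟨u.2, u.2, .refl _⟩
      have hwZ : (w : V) ∉ Z := fun hw => hr ((hZm _).mp hw).2.2
      obtain ⟨x, hx, y, hy, hyZ, hB⟩ := h.cut _ hZ ⟨_, Finset.mem_map_of_mem _ huZ⟩ fun he =>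
        hwZ (Finset.map_inj.mp he ▸ w.2)
      obtain ⟨x', hx', rfl⟩ := Finset.mem_map.mp hx
      obtain ⟨y', hy', rfl⟩ := Finset.mem_map.mp hy
      obtain ⟨hxX, hxX', hxr⟩ := (hZm _).mp hx'
      refine hyZ (Finset.mem_map_of_mem _ ((hZm _).mpr ⟨hy', hy', hxr.trans ?_⟩))
      exact SimpleGraph.Adj.reachable (toColGraph_B.mp hB)
  · rintro ⟨hc, hp⟩
    refine ⟨?_, ?_, ?_⟩
    · intro x hx
      obtain ⟨x, -, rfl⟩ := Finset.mem_map.mp hx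
      exact (e x).2
    · intro x hx y hy hne
      obtain ⟨x', hx', rfl⟩ := Finset.mem_map.mp hx
      obtain ⟨y', hy', rfl⟩ := Finset.mem_map.mp hy
      exact toColGraph_E.mpr (hc hx' hy' fun h => hne (by rw [h]))
    · intro Z hZ hne hneq
      obtain ⟨z, hz⟩ := hne
      obtain ⟨z', hz', rfl⟩ := Finset.mem_map.mp (hZ hz)
      obtain ⟨y, hy, hyZ⟩ := Finset.exists_of_ssubset (hZ.ssubset_of_ne hneq)
      obtain ⟨y', hy', rfl⟩ := Finset.mem_map.mp hy
      obtain ⟨p⟩ := hp ⟨z', hz'⟩ ⟨y', hy'⟩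
      obtain ⟨d, -, h1, h2⟩ := p.exists_boundary_dart {v | number e v ∈ Z} hz hyZ
      exact ⟨_, h1, _, Finset.mem_map_of_mem _ d.snd.2, h2, toColGraph_B.mpr d.adj⟩

lemma maxBC_map_number {X : Finset V} :
    (H.toColGraph e).MaxBC (X.map (number e)) ↔ Maximal H.IsBCClique (X : Set V) := by
  classical
  have hfin : Finite V := Finite.of_equiv _ e.symm
  constructor
  · rintro ⟨h, hm⟩
    refine ⟨isBC_map_number.mp h, fun Y hY hXY => ?_⟩
    obtain ⟨Y, rfl⟩ := (Set.toFinite Y).exists_finset_coe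
    have := hm _ (isBC_map_number.mpr hY) (Finset.map_subset_map.mpr (Finset.coe_subset.mp hXY))
    rw [Finset.map_inj.mp this]
  · rintro ⟨h, hm⟩
    refine ⟨isBC_map_number.mpr h, fun Z hZ hXZ => ?_⟩
    obtain ⟨Y, rfl⟩ := exists_map_number (e := e) hZ.lt
    have := hm (isBC_map_number.mp hZ) (Finset.coe_subset.mpr (Finset.map_subset_map.mp hXZ))
    exact Finset.map_inj.mpr ((Finset.map_subset_map.mp hXZ).antisymm (Finset.coe_subset.mp this))

/-! ### Output in terms of vertices, and running time from delay -/

variable [Fintype V]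

lemma card_le_maxSolutionSize {F : Set V → Prop} {X : Finset V} (h : F (X : Set V)) :
    X.card ≤ maxSolutionSize F := by
  classical
  unfold maxSolutionSize
  exact Finset.le_sup (f := Finset.card) (Finset.mem_filter.mpr ⟨Finset.mem_univ _, h⟩)

lemma card_lt_of_isBC {Z : Finset ℕ} (h : (H.toColGraph e).IsBC Z) :
    Z.card < maxSolutionSize H.IsBCClique + 1 := by
  obtain ⟨X, rfl⟩ := exists_map_number (e := e) h.lt
  rw [Finset.card_map, Nat.lt_succ_iff]
  exact card_le_maxSolutionSize (isBC_map_number.mp h)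

/-- Single vertices are bc-cliques; `1 ≤ q` later absorbs additive constants. -/
lemma maxSolutionSize_pos [Nonempty V] : 1 ≤ maxSolutionSize H.IsBCClique := by
  obtain ⟨v⟩ := ‹Nonempty V›
  refine (card_le_maxSolutionSize (X := {v}) ?_).trans' (by simp)
  rw [Finset.coe_singleton]
  refine ⟨Set.pairwise_singleton _ _, ?_⟩
  rintro ⟨x, rfl⟩ ⟨y, rfl⟩
  exact .refl _

lemma maxSolutionSize_le (e : V ≃ Fin N) (F : Set V → Prop) : maxSolutionSize F ≤ N := by
  classical
  unfold maxSolutionSize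
  refine Finset.sup_le fun X _ => (Finset.card_le_univ X).trans ?_
  rw [Fintype.card_congr e, Fintype.card_fin]

omit [Fintype V] in
/-- The output of the program, in terms of the vertices of the graph. -/
lemma exists_output [Nonempty V] {enc : ℕ → List ℕ} {encV : V → List ℕ}
    (henc : ∀ v, encV v = enc (e v)) {o : List (List ℕ)}
    (h : Outs enc (H.toColGraph e).MaxBC [] o) :
    ∃ L : List (List V), o = L.map (fun l => l.flatMap encV) ∧ (∀ l ∈ L, l.Nodup) ∧
      L.Pairwise (fun l l' => ¬ ∀ v, v ∈ l ↔ v ∈ l') ∧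
      ∀ X : Finset V, X ∈ {X : Finset V | Maximal H.IsBCClique (X : Set V)} ↔
        ∃ l ∈ L, ∀ v, v ∈ X ↔ v ∈ l := by
  classical
  obtain ⟨Ls, rfl, h1, h2, h3⟩ := h
  have hlt : ∀ l ∈ Ls, ∀ x ∈ l, x < N := fun l hl x hx =>
    ((h3 _).mp (List.mem_map_of_mem hl)).1.lt x (List.mem_toFinset.mpr hx)
  have hex : ∀ l ∈ Ls, ∃ l' : List V, l = l'.map (number e) := by
    intro l hl
    have := hlt l hl
    clear * - this
    induction l with
    | nil => exact ⟨[], rfl⟩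
    | cons x l ih =>
      obtain ⟨l', rfl⟩ := ih fun y hy => this y (by simp [hy])
      exact ⟨e.symm ⟨x, this x (by simp)⟩ :: l', by simp⟩
  obtain ⟨L, rfl⟩ : ∃ L : List (List V), Ls = L.map (List.map (number e)) := by
    clear * - hex
    induction Ls with
    | nil => exact ⟨[], rfl⟩
    | cons l Ls ih =>
      obtain ⟨L, rfl⟩ := ih fun l hl => hex l (by simp [hl])
      obtain ⟨l', rfl⟩ := hex l (by simp)
      exact ⟨l' :: L, rfl⟩
  have hfin : ∀ l : List V, (l.map (number e)).toFinset = l.toFinset.map (number e) := fun l => by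
    ext; simp
  refine ⟨L, ?_, ?_, ?_, ?_⟩
  · simp only [List.nil_append, List.map_map, Function.comp_def, List.flatMap_map, number_apply,
      funext henc]
  · intro l hl
    exact (h1 _ (List.mem_map_of_mem hl)).of_map _
  · rw [List.map_map, List.Nodup, List.pairwise_map] at h2
    refine h2.imp fun {l l'} hne hll => hne ?_
    simp only [Function.comp_apply, hfin, Finset.map_inj]
    ext v
    simpa using hll v
  · intro X
    rw [Set.mem_ofPred_eq, ← maxBC_map_number (e := e), ← h3]
    simp only [List.map_map, List.mem_map, Function.comp_apply, hfin, Finset.map_inj]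
    refine exists_congr fun l => and_congr_right fun _ => ?_
    rw [eq_comm, Finset.ext_iff]
    simp

-- Arrays have length `q + 1`, and interleaving with stride 8 makes this `8 * (q + 1)` memory cells.
omit [Fintype V] in
theorem exists_enumerates [Nonempty V] {I : Input} {S W q : ℕ} {nT : Tm} {bT eT : Tm → Tm → Tm}
    {wC : Tm → Cmd} {enc : ℕ → List ℕ} {encV : V → List ℕ} (henc : ∀ v, encV v = enc (e v))
    (hA : Access I (q + 1) W (H.toColGraph e) nT bT eT wC enc) (hS : 8 * (q + 1) ≤ S) {D : ℕ}
    (hD : (mainC nT bT eT wC).cost * (5 * listTime N (q + 1)) + 1 ≤ D) :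
    ∃ T, Enumerates ((mainC nT bT eT wC).comp 0) I encV
      {X : Finset V | Maximal H.IsBCClique (X : Set V)} T D S W := by
  have hN : 0 < N := by
    obtain ⟨v⟩ := ‹Nonempty V›
    exact (Nat.zero_le _).trans_lt (e v).2
  obtain ⟨s', hE, hM, hO⟩ := exists_exec_mainC hA hN
  obtain ⟨T, h1, h2, h3, h4, h5, h6⟩ := hE.run_comp hA.S_lt hA.one_lt hM
  refine ⟨T, h1, h2, ?_, h4 D hD, fun t ht i hi a ha => (h5 t ht i hi a ha).trans_le hS, h6⟩
  rw [h3]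
  exact exists_output henc hO

lemma out_length_monotone (P : Program) (I : Input) :
    Monotone fun t => (run P I t).out.length :=
  monotone_nat_of_le_succ fun t => by
    rw [run, run, Function.iterate_succ_apply']
    exact out_length_step _

omit [Fintype V] in
lemma _root_.WordRAM.Enumerates.mono {P : Program} {I : Input} {enc : V → List ℕ}
    {𝓢 : Set (Finset V)} {T D D' S W : ℕ} (h : Enumerates P I enc 𝓢 T D S W) (hD : D ≤ D') :
    Enumerates P I enc 𝓢 T D' S W :=
  ⟨h.running, h.halted, h.output, fun t ht => (h.delay t (by omega)).trans_le
    (out_length_monotone P I (by omega)), h.space, h.word⟩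

omit [Fintype V] in
/-- A bound on the running time from the delay and the number of solutions. -/
lemma _root_.WordRAM.Enumerates.time_le [Finite V] {P : Program} {I : Input} {enc : V → List ℕ}
    {𝓢 : Set (Finset V)} {T D S W : ℕ} (h : Enumerates P I enc 𝓢 T D S W) (hD : 0 < D) :
    T ≤ (𝓢.ncard + 1) * D := by
  classical
  obtain ⟨L, hL, -, hp, hX⟩ := h.output
  have hlen : L.length ≤ 𝓢.ncard := by
    have hn : (L.map List.toFinset).Nodup := by
      rw [List.Nodup, List.pairwise_map]
      refine hp.imp fun {l l'} hne he => hne fun v => ?_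
      rw [← List.mem_toFinset, he, List.mem_toFinset]
    rw [← List.length_map (f := List.toFinset), ← List.toFinset_card_of_nodup hn,
      ← Set.ncard_coe_finset]
    refine Set.ncard_le_ncard (fun X hX' => ?_) (Set.toFinite _)
    simp only [List.coe_toFinset, List.mem_map, Set.mem_ofPred_eq] at hX'
    obtain ⟨l, hl, rfl⟩ := hX'
    exact (hX _).mpr ⟨l, hl, fun v => List.mem_toFinset⟩
  -- Each block of `D` steps completes a solution, so there are at most as many full blocks as
  -- solutions, followed by less than `D` steps.
  have hout : ∀ j, j * D ≤ T → j ≤ (run P I (j * D)).out.length := by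
    intro j
    induction j with
    | zero => simp
    | succ j ih =>
      intro hj
      rw [Nat.add_mul, one_mul] at hj ⊢
      have := h.delay _ hj
      have := ih (by omega)
      omega
  have hmono : (run P I (T / D * D)).out.length ≤ (run P I T).out.length :=
    out_length_monotone P I (Nat.div_mul_le_self T D)
  have h1 := hout (T / D) (Nat.div_mul_le_self T D)
  rw [hL, List.length_map] at hmono
  have h2 : T / D ≤ 𝓢.ncard := by omega
  have h3 := Nat.lt_div_mul_add (a := T) hD
  have h4 := Nat.mul_le_mul_right D h2
  rw [Nat.add_mul]
  omega

end Bridge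

/-! ### Constants and word size -/

/-- The constants of the theorem. -/
lemma exists_constants (c : ℕ) {N q : ℕ} (hN : 1 ≤ N) (hq : 1 ≤ q) :
    c * (5 * listTime N (q + 1)) + 1 ≤ (240000 * c + 1) * (q ^ 5 * N ^ 2) := by
  have h1 : listTime N (q + 1) ≤ 48000 * (q ^ 5 * N ^ 2) := by
    -- The factor 16 comes from `q + 1 ≤ 2 * q`. The bound obtained is of order `q ^ 4`; one factor
    -- `q` is given away at the end.
    calc listTime N (q + 1) ≤ 3000 * (N ^ 2 * (q + 1) ^ 4) := listTime_le hN (by omega)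
      _ ≤ 3000 * (N ^ 2 * (2 * q) ^ 4) := by gcongr; omega
      _ = 48000 * (q ^ 4 * N ^ 2) := by ring
      _ ≤ 48000 * (q ^ 5 * N ^ 2) := by gcongr; simp
  have h2 : 1 ≤ q ^ 5 * N ^ 2 := Nat.mul_pos (Nat.pow_pos hq) (Nat.pow_pos hN)
  have h3 : c * (5 * listTime N (q + 1)) ≤ c * (5 * (48000 * (q ^ 5 * N ^ 2))) := by gcongr
  nlinarith

/-- With `p = 2 ^ Nat.size N ≥ 2` one has `N + 2 < 2 * p`, and `2 ^ 5 * p ^ 2 ≤ p ^ 8`. The left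
side dominates both the addresses and the numbers of candidates. -/
lemma lt_two_pow_mul_size {N C : ℕ} (hC : 8 ≤ C) (hN : 1 ≤ N) :
    8 * (N + 2) * (N + 2) < 2 ^ (C * Nat.size N) := by
  have h1 : N < 2 ^ Nat.size N := Nat.lt_size_self N
  have h2 : 2 ≤ 2 ^ Nat.size N := by omega
  have h3 : (2 ^ Nat.size N) ^ 8 ≤ 2 ^ (C * Nat.size N) := by
    rw [← pow_mul, mul_comm]
    exact Nat.pow_le_pow_right (by simp) (Nat.mul_le_mul_right _ hC)
  refine lt_of_lt_of_le ?_ h3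
  generalize 2 ^ Nat.size N = p at *
  calc 8 * (N + 2) * (N + 2) < 8 * (2 * p) * (2 * p) := by
        have : N + 2 ≤ 2 * p := by omega
        have h : N + 2 < 2 * p := by omega
        nlinarith
    _ = 2 ^ 5 * p ^ 2 := by ring
    _ ≤ p ^ 6 * p ^ 2 := Nat.mul_le_mul_right _ ((Nat.pow_le_pow_left h2 5).trans
        (Nat.pow_le_pow_right (by omega) (by simp)))
    _ = p ^ 8 := by ring

end RamWhile

/-! ### Isomorphisms between connected induced subgraphs -/

section Product

variable {V W : Type*} {A : SimpleGraph V} {B : SimpleGraph W}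

/-- Forgetting colours, an edge says that both coordinates differ and that adjacency agrees, which
is the condition on two pairs of a partial isomorphism. -/
lemma productGraph_adj {p q : V × W} : ((productGraph A B).black ⊔ (productGraph A B).white).Adj p q ↔
    p.1 ≠ q.1 ∧ p.2 ≠ q.2 ∧ (A.Adj p.1 q.1 ↔ B.Adj p.2 q.2) := by
  simp only [SimpleGraph.sup_adj, productGraph]
  constructor
  · rintro (⟨h, h'⟩ | ⟨⟨h, h'⟩, h'', h'''⟩)
    · exact ⟨h.ne, h'.ne, by simp [h, h']⟩
    · exact ⟨h, h'', by simp [h', h''']⟩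
  · rintro ⟨h1, h2, h3⟩
    by_cases h : A.Adj p.1 q.1
    · exact Or.inl ⟨h, h3.mp h⟩
    · exact Or.inr ⟨⟨h1, h⟩, h2, fun h' => h (h3.mpr h')⟩

/-- The map `s ↦ (s, φ s)` is a homomorphism from `A[S]` onto the black graph on the pairs, and it
carries connectivity over. -/
lemma IsConnectedInducedIso.isBCClique {X : Set (V × W)} (h : IsConnectedInducedIso A B X) :
    (productGraph A B).IsBCClique X := by
  obtain ⟨S, T, φ, hS, rfl⟩ := h
  refine ⟨?_, ?_⟩
  · rintro _ ⟨s, rfl⟩ _ ⟨s', rfl⟩ hne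
    have hss : s ≠ s' := fun h => hne (by rw [h])
    refine productGraph_adj.mpr ⟨fun h => hss (Subtype.ext h),
      fun h => hss (φ.injective (Subtype.ext h)), ?_⟩
    exact (φ.map_adj_iff (v := s) (w := s')).symm
  · let f : A.induce S →g (productGraph A B).black.induce (isoPairs φ) :=
      ⟨fun s => ⟨(s, φ s), s, rfl⟩, fun {s s'} hss => ⟨hss, φ.map_adj_iff.mpr hss⟩⟩
    refine hS.map f ?_
    rintro ⟨_, s, rfl⟩
    exact ⟨s, rfl⟩

/-- Distinct members of a clique differ in both coordinates, so both projections are injective and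
their composite is an isomorphism. The first one maps the black graph onto `A[S]`, which is
therefore connected. -/
lemma isConnectedInducedIso_of_isBCClique {X : Set (V × W)}
    (h : (productGraph A B).IsBCClique X) : IsConnectedInducedIso A B X := by
  obtain ⟨hc, hp⟩ := h
  have h1 : Set.InjOn Prod.fst X := fun p hp q hq he => by
    by_contra hne
    exact (productGraph_adj.mp (hc hp hq hne)).1 he
  have h2 : Set.InjOn Prod.snd X := fun p hp q hq he => by
    by_contra hne
    exact (productGraph_adj.mp (hc hp hq hne)).2.1 he
  have h3 : ∀ p ∈ X, ∀ q ∈ X, (A.Adj p.1 q.1 ↔ B.Adj p.2 q.2) := fun p hp q hq => by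
    by_cases hpq : p = q
    · simp [hpq]
    · exact (productGraph_adj.mp (hc hp hq hpq)).2.2
  let f := Equiv.Set.imageOfInjOn Prod.fst X h1
  let g := Equiv.Set.imageOfInjOn Prod.snd X h2
  have hf : ∀ p : X, ((f p : V)) = p.1.1 := fun _ => rfl
  have hg : ∀ p : X, ((g p : W)) = p.1.2 := fun _ => rfl
  let φ : A.induce (Prod.fst '' X) ≃g B.induce (Prod.snd '' X) :=
    ⟨f.symm.trans g, fun {s s'} => by
      obtain ⟨p, rfl⟩ := f.surjective s
      obtain ⟨p', rfl⟩ := f.surjective s'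
      simp only [Equiv.trans_apply, Equiv.symm_apply_apply, SimpleGraph.comap_adj,
        Function.Embedding.subtype_apply, hf, hg]
      exact (h3 _ p.2 _ p'.2).symm⟩
  have hφ : ∀ p, φ (f p) = g p := fun p => by
    change g (f.symm (f p)) = g p
    rw [Equiv.symm_apply_apply]
  refine ⟨_, _, φ, ?_, ?_⟩
  · let F : (productGraph A B).black.induce X →g A.induce (Prod.fst '' X) :=
      ⟨f, fun {p p'} hpp => hpp.1⟩
    exact hp.map F f.surjective
  · ext p
    constructor
    · intro hpX
      exact ⟨f ⟨p, hpX⟩, by rw [hφ, hf, hg]⟩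
    · rintro ⟨s, rfl⟩
      obtain ⟨p, rfl⟩ := f.surjective s
      rw [hφ, hf, hg]
      exact p.2

lemma isConnectedInducedIso_eq :
    IsConnectedInducedIso A B = (productGraph A B).IsBCClique :=
  funext fun _ => propext ⟨fun h => h.isBCClique, isConnectedInducedIso_of_isBCClique⟩

/-- The domain of an extension is a common connected induced subgraph containing `S`, hence equals
`S`; and two isomorphisms with the same domain, one contained in the other, coincide. -/
lemma maximal_isoPairs {S : Set V} {T : Set W} (φ : A.induce S ≃g B.induce T)
    (h : Maximal (IsCommonConnectedInduced A B) S) :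
    Maximal (IsConnectedInducedIso A B) (isoPairs φ) := by
  refine ⟨⟨S, T, φ, h.1.1, rfl⟩, ?_⟩
  rintro _ ⟨S', T', ψ, hS', rfl⟩ hle
  have hsub : S ⊆ S' := fun s hs => by
    obtain ⟨t, ht⟩ := hle ⟨⟨s, hs⟩, rfl⟩
    rw [show s = t from congrArg Prod.fst ht]
    exact t.2
  have hsub' : S' ⊆ S := h.2 ⟨hS', T', ⟨ψ⟩⟩ hsub
  rintro _ ⟨s, rfl⟩
  obtain ⟨t, ht⟩ := hle ⟨⟨s, hsub' s.2⟩, rfl⟩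
  obtain rfl : s = t := Subtype.ext (congrArg Prod.fst ht)
  exact ⟨⟨s, hsub' s.2⟩, ht.symm⟩

end Product

/-! ### The two programs -/

namespace RamWhile

open WordRAM ColGraph

@[simp] lemma Tm.eval_query₁ {I : Input} (s : St) (a b : Tm) :
    (Tm.query₁ a b).eval I s = truth (I.rel₁ (a.eval I s) (b.eval I s)) := rfl

@[simp] lemma Tm.eval_query₂ {I : Input} (s : St) (a b : Tm) :
    (Tm.query₂ a b).eval I s = truth (I.rel₂ (a.eval I s) (b.eval I s)) := rfl

lemma adjRel_coe {n : ℕ} {G : SimpleGraph (Fin n)} (i j : Fin n) :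
    adjRel G (i : ℕ) (j : ℕ) ↔ G.Adj i j :=
  ⟨fun ⟨_, _, h⟩ => h, fun h => ⟨i.2, j.2, h⟩⟩

lemma exists_number {V : Type*} {N : ℕ} (e : V ≃ Fin N) {u : ℕ} (hu : u < N) :
    ∃ p, u = e p := ⟨e.symm ⟨u, hu⟩, by simp⟩

/-- The program for a graph with black and white edges. -/
def bwProgram : Cmd := mainC .size₁ .query₁ (fun a b => .or (.query₁ a b) (.query₂ a b)) .write

lemma access_bw {n q C : ℕ} (hn : 0 < n) (G : BWGraph (Fin n))
    (hq : q = maxSolutionSize G.IsBCClique) (hC : 8 ≤ C) :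
    Access (bwInput G) (q + 1) (2 ^ (C * Nat.size n)) (G.toColGraph (Equiv.refl _)) .size₁ .query₁
      (fun a b => .or (.query₁ a b) (.query₂ a b)) .write fun v => [v] := by
  have hW := lt_two_pow_mul_size hC hn
  have hqn : q ≤ n := hq ▸ maxSolutionSize_le (Equiv.refl _) _
  generalize 2 ^ (C * Nat.size n) = W at *
  have h1 : 1 < W := by nlinarith
  refine ⟨fun Z hZ => hq ▸ card_lt_of_isBC hZ, by nlinarith, ?_, fun s => ?_, fun s => rfl,
    fun s a b ha hb _ _ => ⟨ha, hb⟩, fun s a b ha hb => ?_, fun s a b ha hb _ _ => ?_,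
    fun s a b ha hb => ?_, fun s e he _ => ⟨1, by simp, .write he⟩⟩
  · change (n + 2) * (n + 2) < W
    nlinarith
  · change n < W
    nlinarith
  · obtain ⟨i, hi⟩ := exists_number (Equiv.refl (Fin n)) ha
    obtain ⟨j, hj⟩ := exists_number (Equiv.refl (Fin n)) hb
    rw [Tm.eval_query₁, hi, hj, toColGraph_B]
    exact congrArg truth (propext (adjRel_coe i j))
  · exact (Tm.safe_or h1 _ _ _).mpr ⟨⟨ha, hb⟩, ha, hb⟩
  · obtain ⟨i, hi⟩ := exists_number (Equiv.refl (Fin n)) ha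
    obtain ⟨j, hj⟩ := exists_number (Equiv.refl (Fin n)) hb
    rw [Tm.eval_or, Tm.eval_query₁, Tm.eval_query₂, hi, hj, toColGraph_E, truth_pos, truth_pos]
    exact congrArg truth (propext (or_congr (adjRel_coe i j) (adjRel_coe i j)))

/-! ### The product graph computed from two input graphs -/

/-- The first coordinate of a numbered pair. -/
def Tm.fst (a : Tm) : Tm := .div a .size₂

/-- The second coordinate of a numbered pair. -/
def Tm.snd (a : Tm) : Tm := .sub a (.mul (.div a .size₂) .size₂)

/-- Are two pairs joined by a black edge of the product graph? -/
def pairBlack (a b : Tm) : Tm := .and (.query₁ a.fst b.fst) (.query₂ a.snd b.snd)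

/-- Are two pairs joined by a white edge of the product graph? -/
def pairWhite (a b : Tm) : Tm :=
  .and (.and (.not (.eq a.fst b.fst)) (.not (.query₁ a.fst b.fst)))
    (.and (.not (.eq a.snd b.snd)) (.not (.query₂ a.snd b.snd)))

/-- Are two pairs joined by an edge of the product graph? -/
def pairEdge (a b : Tm) : Tm := .or (pairBlack a b) (pairWhite a b)

/-- Write a pair. -/
def pairWrite (e : Tm) : Cmd := .seq (.write e.fst) (.write e.snd)

/-- The program for a pair of graphs. -/
def pairProgram : Cmd := mainC (.mul .size₁ .size₂) pairBlack pairEdge pairWrite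

/-- Terms do not read the output, so the second coordinate of a pair is unaffected by writing the
first. -/
lemma Tm.eval_append {I : Input} (s : St) (x : ℕ) (e : Tm) :
    e.eval I (s.append x) = e.eval I s := by
  induction e with
  | const | var | size₁ | size₂ => rfl
  | add _ _ h h' | sub _ _ h h' | mul _ _ h h' | div _ _ h h' => simp only [Tm.eval, h, h']
  | query₁ _ _ h h' => rw [eval_query₁, eval_query₁, h, h']
  | query₂ _ _ h h' => rw [eval_query₂, eval_query₂, h, h']
  | get _ _ h =>
    rw [eval_get, eval_get, h]
    rfl

lemma Tm.safe_append {I : Input} {S W : ℕ} (s : St) (x : ℕ) (e : Tm) :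
    e.Safe I S W (s.append x) ↔ e.Safe I S W s := by
  induction e <;> simp_all [Tm.Safe, Tm.eval_append]

section Pair

variable {a b : ℕ} {A : SimpleGraph (Fin a)} {B : SimpleGraph (Fin b)}

/-- The equivalence `finProdFinEquiv` numbers a pair by `p.2 + b * p.1`, so division by the second
size separates the coordinates. -/
lemma eval_fst {s : St} {x : Tm} {p : Fin a × Fin b}
    (h : x.eval (pairInput A B) s = finProdFinEquiv p) : x.fst.eval (pairInput A B) s = p.1 := by
  have hb : 0 < b := (Nat.zero_le _).trans_lt p.2.2
  rw [Tm.fst, Tm.eval_div, h, finProdFinEquiv_apply_val]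
  change (_ + b * _) / b = _
  rw [Nat.add_mul_div_left _ _ hb, Nat.div_eq_of_lt p.2.2, zero_add]

lemma eval_snd {s : St} {x : Tm} {p : Fin a × Fin b}
    (h : x.eval (pairInput A B) s = finProdFinEquiv p) : x.snd.eval (pairInput A B) s = p.2 := by
  have h1 := eval_fst h
  rw [Tm.fst] at h1
  rw [Tm.snd, Tm.eval_sub, Tm.eval_mul, h1, h, finProdFinEquiv_apply_val]
  change _ + b * _ - _ * b = _
  rw [mul_comm b, Nat.add_sub_cancel]

lemma safe_snd {S W : ℕ} {s : St} {x : Tm} (h : x.Safe (pairInput A B) S W s)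
    (hx : x.eval (pairInput A B) s < W) (hb : b < W) : x.snd.Safe (pairInput A B) S W s :=
  ⟨h, ⟨h, hb⟩, hb, (Nat.div_mul_le_self _ _).trans_lt hx⟩

lemma eval_pairBlack {s : St} {x y : Tm} {p p' : Fin a × Fin b}
    (hx : x.eval (pairInput A B) s = finProdFinEquiv p)
    (hy : y.eval (pairInput A B) s = finProdFinEquiv p') :
    (pairBlack x y).eval (pairInput A B) s = truth ((productGraph A B).black.Adj p p') := by
  rw [pairBlack, Tm.eval_and, Tm.eval_query₁, Tm.eval_query₂, eval_fst hx, eval_fst hy,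
    eval_snd hx, eval_snd hy, truth_pos, truth_pos]
  exact congrArg truth (propext (and_congr (adjRel_coe _ _) (adjRel_coe _ _)))

lemma eval_pairWhite {s : St} {x y : Tm} {p p' : Fin a × Fin b}
    (hx : x.eval (pairInput A B) s = finProdFinEquiv p)
    (hy : y.eval (pairInput A B) s = finProdFinEquiv p') :
    (pairWhite x y).eval (pairInput A B) s = truth ((productGraph A B).white.Adj p p') := by
  simp only [pairWhite, Tm.eval_and, Tm.eval_not, Tm.eval_eq, Tm.eval_query₁, Tm.eval_query₂,
    eval_fst hx, eval_fst hy, eval_snd hx, eval_snd hy, truth_pos, truth_eq_zero, Fin.val_inj]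
  exact congrArg truth (propext (and_congr
    (and_congr Iff.rfl (not_congr (adjRel_coe _ _)))
    (and_congr Iff.rfl (not_congr (adjRel_coe _ _)))))

/-- The product graph is never stored: its adjacency is a fixed term in the two input queries, so
the space stays `O(q)`. -/
lemma access_pair {q C : ℕ} (ha : 0 < a) (hb : 0 < b)
    (hq : q = maxSolutionSize (productGraph A B).IsBCClique) (hC : 8 ≤ C) :
    Access (pairInput A B) (q + 1) (2 ^ (C * Nat.size (a * b)))
      ((productGraph A B).toColGraph finProdFinEquiv) (.mul .size₁ .size₂) pairBlack pairEdge
      pairWrite fun v => [v / b, v % b] := by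
  have hab : 0 < a * b := Nat.mul_pos ha hb
  have hW := lt_two_pow_mul_size hC hab
  have hqn : q ≤ a * b := hq ▸ maxSolutionSize_le finProdFinEquiv _
  have haW : a ≤ a * b := Nat.le_mul_of_pos_right _ hb
  have hbW : b ≤ a * b := Nat.le_mul_of_pos_left _ ha
  generalize 2 ^ (C * Nat.size (a * b)) = W at *
  have hNW : a * b < W := by nlinarith
  have h1 : 1 < W := by nlinarith
  have hbW' : b < W := by omega
  have hblack : ∀ s x y, x.Safe (pairInput A B) (q + 1) W s → y.Safe (pairInput A B) (q + 1) W s →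
      x.eval (pairInput A B) s < a * b → y.eval (pairInput A B) s < a * b →
      (pairBlack x y).Safe (pairInput A B) (q + 1) W s := fun s x y hx hy hx' hy' =>
    (Tm.safe_and h1 _ _ _).mpr ⟨⟨⟨hx, hbW'⟩, hy, hbW'⟩, safe_snd hx (by omega) hbW',
      safe_snd hy (by omega) hbW'⟩
  refine ⟨fun Z hZ => hq ▸ card_lt_of_isBC hZ, by nlinarith, ?_, fun s => ?_, fun s => rfl,
    hblack, fun s x y hx hy => ?_, fun s x y hx hy hx' hy' => ?_, fun s x y hx hy => ?_,
    fun s e he he' => ?_⟩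
  · change (a * b + 2) * (a * b + 2) < W
    nlinarith
  · exact ⟨by change a < W; omega, hbW', hNW⟩
  · obtain ⟨p, hp⟩ := exists_number finProdFinEquiv hx
    obtain ⟨p', hp'⟩ := exists_number finProdFinEquiv hy
    rw [eval_pairBlack hp hp', hp, hp', toColGraph_B]
  · have hx₂ := safe_snd hx (hx'.trans hNW) hbW'
    have hy₂ := safe_snd hy (hy'.trans hNW) hbW'
    refine (Tm.safe_or h1 _ _ _).mpr ⟨hblack s x y hx hy hx' hy', ?_⟩
    simp only [pairWhite, Tm.safe_and h1, Tm.safe_not h1, Tm.safe_eq h1]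
    exact ⟨⟨⟨⟨hx, hbW'⟩, hy, hbW'⟩, ⟨hx, hbW'⟩, hy, hbW'⟩, ⟨hx₂, hy₂⟩, hx₂, hy₂⟩
  · obtain ⟨p, hp⟩ := exists_number finProdFinEquiv hx
    obtain ⟨p', hp'⟩ := exists_number finProdFinEquiv hy
    rw [pairEdge, Tm.eval_or, eval_pairBlack hp hp', eval_pairWhite hp hp', truth_pos, truth_pos,
      hp, hp', toColGraph_E, SimpleGraph.sup_adj]
  · refine ⟨2, le_rfl, ?_⟩
    have h2 := safe_snd he (he'.trans hNW) hbW'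
    have := Exec.seq (Exec.write (e := e.fst) (s := s) ⟨he, hbW'⟩)
      (Exec.write (e := e.snd) ((Tm.safe_append _ _ _).mpr h2))
    obtain ⟨p, hp⟩ := exists_number finProdFinEquiv he'
    have hd : e.fst.eval (pairInput A B) s = e.eval (pairInput A B) s / b := rfl
    have hm : e.snd.eval (pairInput A B) s = e.eval (pairInput A B) s % b := by
      rw [eval_snd hp, hp, finProdFinEquiv_apply_val, Nat.add_mul_mod_self_left,
        Nat.mod_eq_of_lt p.2.2]
    rw [Tm.eval_append, hd, hm] at this
    simpa [pairWrite, St.append, add_assoc] using this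

end Pair

/-! ### Assembly of the two algorithms -/

theorem exists_bw_enumerates {n q C : ℕ} (hn : 0 < n) (G : BWGraph (Fin n))
    (hq : q = maxSolutionSize G.IsBCClique) (hC : 240000 * bwProgram.cost + 16 ≤ C) :
    ∃ T, Enumerates (bwProgram.comp 0) (bwInput G) (fun v : Fin n => [(v : ℕ)])
      {X : Finset (Fin n) | Maximal G.IsBCClique (X : Set (Fin n))} T
      (C * (q ^ 5 * n ^ 2)) (C * q) (2 ^ (C * Nat.size n)) := by
  have : Nonempty (Fin n) := ⟨⟨0, hn⟩⟩
  have hq1 : 1 ≤ q := hq ▸ maxSolutionSize_pos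
  have hD := exists_constants bwProgram.cost hn hq1
  -- The summand 16 in the constant gives `8 * (q + 1) ≤ 16 * q ≤ C * q`, and also the exponent `8 ≤
  -- C` for the words.
  obtain ⟨T, hT⟩ := exists_enumerates (e := Equiv.refl (Fin n)) (S := C * q)
    (encV := fun v : Fin n => [(v : ℕ)]) (fun _ => rfl) (access_bw hn G hq (C := C) (by omega))
    (by nlinarith) hD
  exact ⟨T, hT.mono (Nat.mul_le_mul_right _ (by omega))⟩

theorem exists_pair_enumerates {a b q C : ℕ} (ha : 0 < a) (hb : 0 < b)
    (A : SimpleGraph (Fin a)) (B : SimpleGraph (Fin b))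
    (hq : q = maxSolutionSize (productGraph A B).IsBCClique)
    (hC : 480000 * pairProgram.cost + 16 ≤ C) :
    ∃ T, Enumerates (pairProgram.comp 0) (pairInput A B)
        (fun p : Fin a × Fin b => [(p.1 : ℕ), (p.2 : ℕ)])
        {X : Finset (Fin a × Fin b) |
          Maximal (productGraph A B).IsBCClique (X : Set (Fin a × Fin b))}
        T (C * (q ^ 5 * (a * b) ^ 2)) (C * q) (2 ^ (C * Nat.size (a * b))) ∧
      T ≤ C * {X : Set (Fin a × Fin b) | Maximal (productGraph A B).IsBCClique X}.ncard *
        (q ^ 5 * (a * b) ^ 2) := by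
  have hab : 0 < a * b := Nat.mul_pos ha hb
  have : Nonempty (Fin a × Fin b) := ⟨⟨0, ha⟩, ⟨0, hb⟩⟩
  have hq1 : 1 ≤ q := hq ▸ maxSolutionSize_pos
  have hD := exists_constants pairProgram.cost hab hq1
  obtain ⟨T, hT⟩ := exists_enumerates (e := finProdFinEquiv) (V := Fin a × Fin b) (S := C * q)
    (encV := fun p : Fin a × Fin b => [(p.1 : ℕ), (p.2 : ℕ)]) (fun p => by
      rw [finProdFinEquiv_apply_val, Nat.add_mul_div_left _ _ hb, Nat.div_eq_of_lt p.2.2, zero_add,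
        Nat.add_mul_mod_self_left, Nat.mod_eq_of_lt p.2.2])
    (access_pair ha hb hq (C := C) (by omega)) (by nlinarith) hD
  have hpos : 0 < q ^ 5 * (a * b) ^ 2 := Nat.mul_pos (Nat.pow_pos hq1) (Nat.pow_pos hab)
  refine ⟨T, hT.mono (Nat.mul_le_mul_right _ (by omega)), ?_⟩
  have hcard : {X : Finset (Fin a × Fin b) |
      Maximal (productGraph A B).IsBCClique (X : Set (Fin a × Fin b))}.ncard =
      {X : Set (Fin a × Fin b) | Maximal (productGraph A B).IsBCClique X}.ncard := by
    rw [← Set.ncard_image_of_injective _ Finset.coe_injective]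
    congr 1
    ext X
    constructor
    · rintro ⟨Y, hY, rfl⟩
      exact hY
    · intro hX
      obtain ⟨Y, rfl⟩ := (Set.toFinite X).exists_finset_coe
      exact ⟨Y, hX, rfl⟩
  -- The empty bc-clique extends to a maximal one, so `α + 1 ≤ 2 * α`; this doubles the constant.
  have hα : 1 ≤ {X : Set (Fin a × Fin b) | Maximal (productGraph A B).IsBCClique X}.ncard := by
    obtain ⟨X, -, hX⟩ := Set.Finite.exists_le_maximal
      (Set.toFinite {X : Set (Fin a × Fin b) | (productGraph A B).IsBCClique X})
      (a := ∅) ⟨Set.pairwise_empty _, fun x => x.2.elim⟩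
    exact (Set.ncard_pos (Set.toFinite _)).mpr ⟨X, hX⟩
  have ht := hT.time_le (Nat.mul_pos (by omega) hpos)
  rw [hcard] at ht
  generalize {X : Set (Fin a × Fin b) | Maximal (productGraph A B).IsBCClique X}.ncard = α at *
  generalize q ^ 5 * (a * b) ^ 2 = Q at *
  calc T ≤ (α + 1) * ((240000 * pairProgram.cost + 1) * Q) := ht
    _ ≤ (2 * α) * ((240000 * pairProgram.cost + 1) * Q) := Nat.mul_le_mul_right _ (by omega)
    _ = (480000 * pairProgram.cost + 2) * α * Q := by ring
    _ ≤ C * α * Q := by gcongr; omega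

end RamWhile

theorem mainTheorem6 :
    -- listing the maximal bc-cliques
    (∃ (P : WordRAM.Program) (C : ℕ), ∀ (n : ℕ), 0 < n → ∀ (G : BWGraph (Fin n)) (q : ℕ),
      q = maxSolutionSize G.IsBCClique →
      ∃ T : ℕ, WordRAM.Enumerates P (WordRAM.bwInput G) (fun v : Fin n => [(v : ℕ)])
        {X : Finset (Fin n) | Maximal G.IsBCClique (X : Set (Fin n))}
        T (C * (q ^ 5 * n ^ 2)) (C * q) (2 ^ (C * Nat.size n))) ∧
    -- the product graph turns isomorphisms into bc-cliques, maximal ones into maximal ones,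
    -- and each isomorphism of a maximal common connected induced subgraph is maximal
    (∀ {V W : Type*} (A : SimpleGraph V) (B : SimpleGraph W),
      (∀ X : Set (V × W), IsConnectedInducedIso A B X ↔ (productGraph A B).IsBCClique X) ∧
      (∀ X : Set (V × W),
        Maximal (IsConnectedInducedIso A B) X ↔ Maximal (productGraph A B).IsBCClique X) ∧
      (∀ (S : Set V) (T : Set W) (φ : A.induce S ≃g B.induce T),
        Maximal (IsCommonConnectedInduced A B) S →
          Maximal (IsConnectedInducedIso A B) (isoPairs φ))) ∧
    -- listing the maximal isomorphisms between connected induced subgraphs of two graphs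
    (∃ (P : WordRAM.Program) (C : ℕ), ∀ (a b : ℕ), 0 < a → 0 < b →
      ∀ (A : SimpleGraph (Fin a)) (B : SimpleGraph (Fin b)) (q : ℕ),
      q = maxSolutionSize (IsConnectedInducedIso A B) →
      ∃ T : ℕ, WordRAM.Enumerates P (WordRAM.pairInput A B)
          (fun p : Fin a × Fin b => [(p.1 : ℕ), (p.2 : ℕ)])
          {X : Finset (Fin a × Fin b) |
            Maximal (IsConnectedInducedIso A B) (X : Set (Fin a × Fin b))}
          T (C * (q ^ 5 * (a * b) ^ 2)) (C * q) (2 ^ (C * Nat.size (a * b))) ∧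
        T ≤ C * {X : Set (Fin a × Fin b) | Maximal (IsConnectedInducedIso A B) X}.ncard *
          (q ^ 5 * (a * b) ^ 2)) := by
  refine ⟨⟨RamWhile.bwProgram.comp 0, 240000 * RamWhile.bwProgram.cost + 16, fun n hn G q hq =>
    RamWhile.exists_bw_enumerates hn G hq le_rfl⟩, fun A B => ?_,
    ⟨RamWhile.pairProgram.comp 0, 480000 * RamWhile.pairProgram.cost + 16, fun a b ha hb A B q hq => ?_⟩⟩
  · rw [isConnectedInducedIso_eq]
    exact ⟨fun X => Iff.rfl, fun X => Iff.rfl, fun S T φ h => by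
      rw [← isConnectedInducedIso_eq]
      exact maximal_isoPairs φ h⟩
  -- The two predicates are equal as functions, so `q`, the listed family and its cardinality agree.
  · rw [isConnectedInducedIso_eq] at hq ⊢
    exact RamWhile.exists_pair_enumerates ha hb A B hq le_rfl
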